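/- Let $J_1,J_2,\ldots$ be independent random variables on a probability space, $J_k$ uniformly distributed on $\{1,\ldots,k\}$, and let $Y_n$ be the random recursive tree with node set $\{1,\ldots,n\}$ and root $1$ in which $J_k$ is the direct ancestor of $k+1$, $1\le k<n$. Let $\mathbb V=\mathbb N^\star$ be the set of finite words over $\mathbb N=\{1,2,\ldots\}$. Encode the root by the empty word, and encode a node $j\ge 2$ by the word of its direct ancestor followed by the letter $\#\{2\le i\le j: i \text{ has the same direct ancestor as } j\}$. Let $X_n\subset\mathbb V$ be the set of the words of the nodes of $Y_n$ (the Harris tree of $Y_n$), and let $\#X_n(u)$ be the number of elements of $X_n$ with prefix $u\in\mathbb V$. Let $\bar{\mathbb V}$ consist of the finite words, the infinite words, and the finite words continued by $\infty,\infty,\ldots$, let $A_u\subset\bar{\mathbb V}$ be the set of elements with prefix $u\in\mathbb V$, and endow $\bar{\mathbb V}$ with the $\sigma$-field generated by the sets $A_u$. Then there is a random probability measure $X_\infty$ on $\bar{\mathbb V}$ such that, almost surely, $\#X_n(u)/n\to X_\infty(A_u)$ for all $u\in\mathbb V$ (convergence in the Doob-Martin topology). Almost surely, for all $u\in\mathbb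 V$, $X_\infty(A_u)>0$ and the ratios $\rho_i(X_\infty,u)=X_\infty(A_{ui})/X_\infty(A_u)$, $i\in\mathbb N$, sum to $1$ with $\sum_i\rho_i(X_\infty,u)\log\rho_i(X_\infty,u)$ convergent. Put $C(s)=1+\sum_{i\ge1}s_i\log s_i$ and $|u|_1=u_1+\cdots+u_k$ for $u=(u_1,\ldots,u_k)$. Then the limit $$Y_\infty=\sum_{u\in\mathbb V}X_\infty(A_u)\,C\bigl(\rho(X_\infty,u)\bigr):=\lim_{k\to\infty}\ \sum_{|u|_1\le k}X_\infty(A_u)\,C\bigl(\rho(X_\infty,u)\bigr)$$ exists in $L^p$ for all $p\ge1$, and the series $W_\infty=\sum_{u\in\mathbb V}X_\infty(A_u)^2$ (which includes the empty word) converges almost surely. Let $\mathrm{WI}(X_n)=\frac12\sum_{(u,v)\in X_n\times X_n}d(u,v)$ be the Wiener index of $X_n$, where $d$ is the graph distance in the tree $X_n$ (with edges between each word and its direct ancestor), and $H_n=\sum_{k=1}^n 1/k$. Then, as $n\to\infty$, $$\frac1{n^2}\,\mathrm{WI}(X_n)-H_n\;\longrightarrow\;Y_\infty-W_\infty$$ almost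 surely and in $L^p$ for every $p>0$. Moreover, $E\,\mathrm{WI}(X_n)=n(n+1)H_n-2n^2$ for all $n\in\mathbb N$. -/

import Mathlib

open MeasureTheory ProbabilityTheory Filter Topology

/-! ### Recursive trees and Harris trees -/

/-- A consistent family of recursive trees, one for each size. The node labels are `0, 1, 2, …`
(so they are shifted by one against the labels `1, 2, 3, …`): the root is `0`, and `j k` is the
direct ancestor of the node `k + 1`. The `n`-th tree consists of the nodes `0, …, n - 1`. -/
abbrev ParentSeq : Type := (k : ℕ) → Fin (k + 1)

/-- The word that encodes a node of a recursive tree: the root is the empty word, and the node `m + 1`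
is the `i`-th child of its direct ancestor `j m`, where `i - 1` is the number of earlier nodes with the
same direct ancestor. Letters are positive integers. -/
def nodeWord (j : ParentSeq) : ℕ → List ℕ+
  | 0 => []
  | m + 1 =>
      nodeWord j (j m) ++
        [Nat.succPNat ((Finset.range m).filter (fun i => (j i : ℕ) = (j m : ℕ))).card]
  termination_by m => m
  decreasing_by exact (j m).isLt

/-- The Harris tree of the recursive tree with the nodes `0, …, n - 1`. -/
def harrisTree (j : ParentSeq) (n : ℕ) : Finset (List ℕ+) :=
  (Finset.range n).image (nodeWord j)

/-- The chain of random recursive trees: in each step, the direct ancestor of the new node is uniform on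
the nodes of the current tree and independent of the previous choices. -/
structure IsRandomRecursiveTreeChain {Ω : Type*} [MeasurableSpace Ω] (P : Measure Ω)
    (J : (k : ℕ) → Ω → Fin (k + 1)) : Prop where
  measurable : ∀ k, Measurable (J k)
  indep : iIndepFun J P
  uniform : ∀ k (i : Fin (k + 1)), P.real (J k ⁻¹' {i}) = 1 / ((k : ℝ) + 1)

/-- The Harris chain `X` associated with the chain of recursive trees. -/
def harrisChain {Ω : Type*} (J : (k : ℕ) → Ω → Fin (k + 1)) (n : ℕ) (ω : Ω) : Finset (List ℕ+) :=
  harrisTree (fun k => J k ω) n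

/-- `#x(u)`, the number of nodes of `x` that have the prefix `u`. -/
def subtreeSize (x : Finset (List ℕ+)) (u : List ℕ+) : ℕ :=
  (x.filter (fun w => u <+: w)).card

/-! ### The Wiener index -/

/-- The Wiener index of a finite graph. -/
noncomputable def wienerIndex {V : Type*} [Fintype V] (G : SimpleGraph V) : ℝ :=
  (1 / 2 : ℝ) * ∑ u : V, ∑ v : V, (G.dist u v : ℝ)

/-- A set of words as a graph: the edges join a node to its direct ancestor. -/
def treeGraph (x : Finset (List ℕ+)) : SimpleGraph x where
  Adj u v := (∃ i : ℕ+, (v : List ℕ+) = (u : List ℕ+) ++ [i]) ∨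
    (∃ i : ℕ+, (u : List ℕ+) = (v : List ℕ+) ++ [i])
  symm := ⟨fun _ _ h => h.symm⟩
  loopless := ⟨fun u h => by rcases h with ⟨i, h⟩ | ⟨i, h⟩ <;> simp at h⟩

/-- The Wiener index of a tree of words. -/
noncomputable def treeWienerIndex (x : Finset (List ℕ+)) : ℝ := wienerIndex (treeGraph x)

/-! ### The limit space -/

/-- The compactified set of nodes: the finite words, the infinite words, and the finite words
continued by `∞, ∞, …`. -/
inductive NodeBar : Type
  | finite (u : List ℕ+)
  | infinite (s : ℕ → ℕ+)
  | ended (u : List ℕ+)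

/-- The finite word `u` is a prefix of `v`. -/
def NodeBar.HasPrefix (u : List ℕ+) : NodeBar → Prop
  | .finite w => u <+: w
  | .infinite s => ∀ (i : ℕ) (hi : i < u.length), u[i] = s i
  | .ended w => u <+: w

/-- The set `A_u` of all elements with prefix `u`. -/
def cylinderSet (u : List ℕ+) : Set NodeBar := {v | v.HasPrefix u}

/-- The σ-field generated by the sets `A_u`. -/
instance : MeasurableSpace NodeBar := MeasurableSpace.generateFrom (Set.range cylinderSet)

/-- Convergence in the Doob-Martin topology of trees `x n` with `n` nodes to a probability measure `μ`:
the uniform distribution on `x n` gives `A_u` the mass `#x_n(u) / n`. -/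
def DoobMartinTendsto (x : ℕ → Finset (List ℕ+)) (μ : Measure NodeBar) : Prop :=
  ∀ u : List ℕ+,
    Tendsto (fun n : ℕ => (subtreeSize (x n) u : ℝ) / (n : ℝ)) atTop (𝓝 (μ.real (cylinderSet u)))

/-- The random probability measure `Xinf` is the almost sure limit of the random trees `X n`. -/
structure IsDoobMartinLimit {Ω : Type*} [MeasurableSpace Ω] (P : Measure Ω)
    (X : ℕ → Ω → Finset (List ℕ+)) (Xinf : Ω → Measure NodeBar) : Prop where
  isProbabilityMeasure : ∀ ω, IsProbabilityMeasure (Xinf ω)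
  measurable : ∀ u, Measurable (fun ω => (Xinf ω).real (cylinderSet u))
  tendsto : ∀ᵐ ω ∂P, DoobMartinTendsto (fun n => X n ω) (Xinf ω)

/-! ### The functionals of the limit -/

/-- `ρ_i(μ, u) = μ(A_{ui}) / μ(A_u)`. -/
noncomputable def massRatio (μ : Measure NodeBar) (u : List ℕ+) (i : ℕ+) : ℝ :=
  μ.real (cylinderSet (u ++ [i])) / μ.real (cylinderSet u)

/-- `C(s) = 1 + ∑ s_i log s_i`. -/
noncomputable def entropyToll (s : ℕ+ → ℝ) : ℝ := 1 + ∑' i, s i * Real.log (s i)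

/-- `|u|_1`, the sum of the letters of `u`. -/
def letterSum (u : List ℕ+) : ℕ := (u.map (fun i : ℕ+ => (i : ℕ))).sum

theorem finite_letterSum_le (k : ℕ) : {u : List ℕ+ | letterSum u ≤ k}.Finite := by
  induction k using Nat.strong_induction_on with
  | _ k ih =>
    have hsub : {u : List ℕ+ | letterSum u ≤ k} ⊆
        {[]} ∪ ⋃ i ∈ Set.Iic k, if h : i < k then
          (fun v => Nat.succPNat i :: v) '' {v | letterSum v ≤ k - 1 - i} else ∅ := by
      intro u hu
      cases u with
      | nil => simp
      | cons a v =>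
        have ha : 0 < (a : ℕ) := a.pos
        have hav : (a : ℕ) + letterSum v ≤ k := by simpa [letterSum] using hu
        refine Or.inr ?_
        simp only [Set.mem_iUnion]
        refine ⟨(a : ℕ) - 1, Set.mem_Iic.2 (by omega), ?_⟩
        rw [dif_pos (by omega)]
        refine ⟨v, ?_, ?_⟩
        · show letterSum v ≤ _
          omega
        · show _ :: _ = _
          congr 1
          apply PNat.eq
          show (a : ℕ) - 1 + 1 = a
          omega
    refine Set.Finite.subset ?_ hsub
    refine (Set.finite_singleton _).union ((Set.finite_Iic k).biUnion fun i _ => ?_)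
    split_ifs with h
    · exact (ih _ (by omega)).image _
    · exact Set.finite_empty

/-- `Y_{∞,k} = ∑_{|u|_1 ≤ k} μ(A_u) C(ρ(μ, u))`. -/
noncomputable def pathLengthPartialSum (μ : Measure NodeBar) (k : ℕ) : ℝ :=
  ∑ u ∈ (finite_letterSum_le k).toFinset,
    μ.real (cylinderSet u) * entropyToll (massRatio μ u)

/-- `Yinf` is the sum `∑_u X_∞(A_u) C(ρ(X_∞, u))`, that is, the limit of `Y_{∞,k}` as `k → ∞`, in `L^p`
for all `p ≥ 1`. -/
def IsPathLengthLimit {Ω : Type*} [MeasurableSpace Ω] (P : Measure Ω)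
    (Xinf : Ω → Measure NodeBar) (Yinf : Ω → ℝ) : Prop :=
  ∀ p : ℝ, 1 ≤ p → MemLp Yinf (ENNReal.ofReal p) P ∧
    Tendsto (fun k : ℕ => eLpNorm (fun ω => pathLengthPartialSum (Xinf ω) k - Yinf ω)
      (ENNReal.ofReal p) P) atTop (𝓝 0)

/-- `W_∞ = ∑_u μ(A_u)^2`. -/
noncomputable def squareSum (μ : Measure NodeBar) : ℝ :=
  ∑' u : List ℕ+, μ.real (cylinderSet u) ^ 2

/-! ### The words of the nodes -/

/-! The distance of two words is the size of the symmetric difference of their prefix sets. Counting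
the pairs that each node separates gives WI = ∑_a N_a (n - N_a), where N_a is the size of the
subtree of a among n nodes. Hence WI/n² - H_n = (∑_a N_a/n - H_n) - ∑_a (N_a/n)²
(`treeWienerIndex_standardized`), and the two parts are treated separately.

Each N_a is a Pólya urn: it grows by one with probability N_a/n. Every F with `IsUrnHarmonic F`
therefore gives a martingale F(n, N_a). Ratios of rising factorials give the masses and their
moments, `entropyTerm` tends to -x log x, and the nonnegative `logTerm`, which converges almost
surely, forces the masses to be positive. Sums over infinitely many nodes pass to the limit by
`ae_tendsto_sum_of_condExp`: each term is the conditional expectation of its limit, so a Fatou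
argument bounds the sum from below and Lévy's upward theorem from above. Consequently no mass is
lost between a node and its children, the entropy sums converge, and the squares converge to W_∞.

For the path length, ∑_a N_a - n H_n telescopes into a sum of tolls, one for each node. The toll of
a is 0 when a is born, its quotient by the number of nodes has centred increments, and this quotient
converges to X_∞(A_u) C(ρ(X_∞, u)) for the word u of a. So the toll sum is a martingale for every
weight on the words. Its even moments b_m satisfy 1 + b_{m+1} ≤ (1 + A (m+2)^{-3/2}) (1 + b_m), with
A independent of the weight. They are bounded, and if the sum vanishes at time k the bound tends to
0 as k → ∞ (`exists_tollSum_moment_bound`). Weight 1 gives the limit Y_∞; the weight 1_{|u|_1 > k}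
shows that the partial sums converge to it in L^p. -/

theorem nodeWord_zero (j : ParentSeq) : nodeWord j 0 = [] := by
  rw [nodeWord]

theorem nodeWord_succ (j : ParentSeq) (m : ℕ) :
    nodeWord j (m + 1) = nodeWord j (j m) ++
      [Nat.succPNat (((Finset.range m).filter (fun i => (j i : ℕ) = (j m : ℕ))).card)] := by
  rw [nodeWord]

/-- Induction on the direct ancestor: two children of the same node get different letters because
the count for the later one includes the earlier one. -/
theorem nodeWord_injective (j : ParentSeq) : Function.Injective (nodeWord j) := by
  have key : ∀ m n, m < n → j m = (j n : ℕ) →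
      ((Finset.range m).filter (fun i => (j i : ℕ) = (j m : ℕ))).card <
        ((Finset.range n).filter (fun i => (j i : ℕ) = (j n : ℕ))).card := by
    intro m n hmn h
    apply Finset.card_lt_card
    rw [Finset.ssubset_iff_of_subset]
    · exact ⟨m, by simp [hmn, h], by simp⟩
    · intro i
      simp only [Finset.mem_filter, Finset.mem_range]
      rintro ⟨h1, h2⟩
      exact ⟨h1.trans hmn, h2.trans h⟩
  intro a
  induction a using Nat.strong_induction_on with
  | _ a ih =>
    intro b hab
    rcases a with _ | m <;> rcases b with _ | n
    · rfl
    · rw [nodeWord_zero, nodeWord_succ] at hab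
      simp at hab
    · rw [nodeWord_zero, nodeWord_succ] at hab
      simp at hab
    · rw [nodeWord_succ, nodeWord_succ] at hab
      obtain ⟨h1, h2⟩ := List.append_inj' hab rfl
      have h3 : (j m : ℕ) = j n := ih _ (j m).isLt h1
      have h4 := Nat.succPNat_injective (List.cons.inj h2).1
      rcases lt_trichotomy m n with h | h | h
      · exact absurd h4 (key m n h h3).ne
      · rw [h]
      · exact absurd h4.symm (key n m h h3.symm).ne

theorem nodeWord_congr {j j' : ParentSeq} {m : ℕ} (h : ∀ i < m, j i = j' i) :
    nodeWord j m = nodeWord j' m := by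
  induction m using Nat.strong_induction_on with
  | _ m ih =>
    rcases m with _ | m
    · rw [nodeWord_zero, nodeWord_zero]
    · have hm := h m m.lt_succ_self
      rw [nodeWord_succ, nodeWord_succ, ← hm,
        ih _ (j m).isLt fun i hi => h i (hi.trans (j m).isLt)]
      have : (Finset.range m).filter (fun i => (j i : ℕ) = (j m : ℕ)) =
          (Finset.range m).filter (fun i => (j' i : ℕ) = (j m : ℕ)) := by
        apply Finset.filter_congr
        intro i hi
        rw [h i ((Finset.mem_range.1 hi).trans m.lt_succ_self)]
      rw [this]

/-- Infinitely many children provide every letter below every node. Together with injectivity this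
lets sums over all words be computed as sums over all nodes. -/
theorem nodeWord_surjective {j : ParentSeq} (h : ∀ a : ℕ, {k : ℕ | (j k : ℕ) = a}.Infinite) :
    Function.Surjective (nodeWord j) := by
  intro u
  induction u using List.reverseRecOn with
  | nil => exact ⟨0, nodeWord_zero j⟩
  | append_singleton u i ih =>
    obtain ⟨a, rfl⟩ := ih
    set k := Nat.nth (fun k => (j k : ℕ) = a) i.natPred with hk
    have h1 : (j k : ℕ) = a := Nat.nth_mem_of_infinite (h a) _
    refine ⟨k + 1, ?_⟩
    rw [nodeWord_succ, h1, ← Nat.count_eq_card_filter_range, hk,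
      Nat.count_nth_of_infinite (h a), PNat.succPNat_natPred]

theorem nodeWord_nth {j : ParentSeq} {a : ℕ} (h : {k : ℕ | (j k : ℕ) = a}.Infinite) (i : ℕ+) :
    nodeWord j (Nat.nth (fun k => (j k : ℕ) = a) i.natPred + 1) = nodeWord j a ++ [i] := by
  have h1 : (j (Nat.nth (fun k => (j k : ℕ) = a) i.natPred) : ℕ) = a :=
    Nat.nth_mem_of_infinite h _
  rw [nodeWord_succ, h1, ← Nat.count_eq_card_filter_range,
    Nat.count_nth_of_infinite h, PNat.succPNat_natPred]

theorem prefix_nodeWord_succ {j : ParentSeq} {u : List ℕ+} {m : ℕ} :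
    u <+: nodeWord j (m + 1) ↔ u = nodeWord j (m + 1) ∨ u <+: nodeWord j (j m) := by
  rw [nodeWord_succ, List.prefix_concat_iff]

theorem exists_nodeWord_of_prefix {j : ParentSeq} {u : List ℕ+} {b : ℕ}
    (h : u <+: nodeWord j b) : ∃ a ≤ b, nodeWord j a = u := by
  induction b using Nat.strong_induction_on with
  | _ b ih =>
    rcases b with _ | m
    · rw [nodeWord_zero, List.prefix_nil] at h
      exact ⟨0, le_rfl, by rw [nodeWord_zero, h]⟩
    · rcases prefix_nodeWord_succ.1 h with h | h
      · exact ⟨m + 1, le_rfl, h.symm⟩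
      · obtain ⟨a, ha, hu⟩ := ih _ (j m).isLt h
        exact ⟨a, ha.trans (j m).isLt.le, hu⟩

theorem le_of_nodeWord_prefix {j : ParentSeq} {a b : ℕ} (h : nodeWord j a <+: nodeWord j b) :
    a ≤ b := by
  obtain ⟨a', h1, h2⟩ := exists_nodeWord_of_prefix h
  rwa [← nodeWord_injective j h2]

theorem nodeWord_prefix_succ {j : ParentSeq} {a m : ℕ} (ha : a ≤ m) :
    nodeWord j a <+: nodeWord j (m + 1) ↔ nodeWord j a <+: nodeWord j (j m) := by
  rw [prefix_nodeWord_succ, or_iff_right]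
  intro h
  have := nodeWord_injective j h
  omega

/-! ### Descendants -/

/-- The number of descendants of the node `a`, including `a`, in the tree with the nodes
`0, …, n - 1`. -/
def descCount (j : ParentSeq) (n a : ℕ) : ℕ :=
  ((Finset.range n).filter (fun b => nodeWord j a <+: nodeWord j b)).card

theorem descCount_le (j : ParentSeq) (n a : ℕ) : descCount j n a ≤ n :=
  (Finset.card_filter_le _ _).trans (Finset.card_range n).le

theorem descCount_succ (j : ParentSeq) (n a : ℕ) : descCount j (n + 1) a =
    descCount j n a + if nodeWord j a <+: nodeWord j n then 1 else 0 := by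
  unfold descCount
  rw [Finset.range_add_one, Finset.filter_insert]
  split_ifs with h
  · rw [Finset.card_insert_of_notMem (by simp)]
  · rfl

theorem descCount_eq_zero {j : ParentSeq} {n a : ℕ} (h : n ≤ a) : descCount j n a = 0 := by
  unfold descCount
  rw [Finset.card_eq_zero, Finset.filter_eq_empty_iff]
  intro b hb hab
  have := le_of_nodeWord_prefix hab
  rw [Finset.mem_range] at hb
  omega

theorem descCount_self_succ (j : ParentSeq) (a : ℕ) : descCount j (a + 1) a = 1 := by
  rw [descCount_succ, descCount_eq_zero le_rfl, if_pos List.prefix_rfl]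

theorem descCount_mono (j : ParentSeq) (a : ℕ) : Monotone (fun n => descCount j n a) :=
  monotone_nat_of_le_succ fun n => by
    show descCount j n a ≤ descCount j (n + 1) a
    rw [descCount_succ]
    exact Nat.le_add_right _ _

theorem one_le_descCount {j : ParentSeq} {n a : ℕ} (h : a < n) : 1 ≤ descCount j n a :=
  (descCount_self_succ j a).symm.le.trans (descCount_mono j a (Nat.succ_le_of_lt h))

/-- The Pólya urn step: the new node `m + 1` enters the subtree of an older node exactly when its
direct ancestor lies there. -/
theorem descCount_add_two {j : ParentSeq} {m a : ℕ} (ha : a ≤ m) : descCount j (m + 2) a =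
    descCount j (m + 1) a + if nodeWord j a <+: nodeWord j (j m) then 1 else 0 := by
  rw [descCount_succ]
  simp only [nodeWord_prefix_succ ha]

theorem descCount_congr {j j' : ParentSeq} {m a : ℕ} (h : ∀ i < m, j i = j' i) :
    descCount j (m + 1) a = descCount j' (m + 1) a := by
  rcases le_or_gt (m + 1) a with ha | ha
  · rw [descCount_eq_zero ha, descCount_eq_zero ha]
  · unfold descCount
    congr 1
    apply Finset.filter_congr
    intro b hb
    rw [Finset.mem_range] at hb
    rw [nodeWord_congr (j := j) (j' := j') (m := a) fun i hi => h i (by omega),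
      nodeWord_congr (j := j) (j' := j') (m := b) fun i hi => h i (by omega)]

theorem descCount_zero_right (j : ParentSeq) (n : ℕ) : descCount j n 0 = n := by
  unfold descCount
  simp [nodeWord_zero]

/-- A proper descendant of `a` has exactly one child of `a` as an ancestor. -/
theorem sum_children_prefix {j : ParentSeq} {M a : ℕ} : ∀ {x : ℕ}, x ≤ M →
    (∑ k ∈ Finset.range M, if (j k : ℕ) = a then
      (if nodeWord j (k + 1) <+: nodeWord j x then 1 else 0) else 0) + (if x = a then 1 else 0) =
      if nodeWord j a <+: nodeWord j x then 1 else 0 := by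
  intro x
  induction x using Nat.strong_induction_on with
  | _ x ih =>
    intro hx
    rcases x with _ | m
    · rw [Finset.sum_eq_zero, zero_add]
      · have : nodeWord j a <+: nodeWord j 0 ↔ 0 = a := by
          rw [nodeWord_zero, List.prefix_nil, ← nodeWord_zero j, (nodeWord_injective j).eq_iff,
            eq_comm]
        simp only [this]
      · intro k _
        have : ¬ nodeWord j (k + 1) <+: nodeWord j 0 := fun h => by
          have := le_of_nodeWord_prefix h
          omega
        simp [this]
    · have ih' := ih (j m) (j m).isLt ((j m).isLt.le.trans hx)
      -- Passing from `j m` to its child `m + 1` adds a single prefix, the word of `m + 1` itself,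
      -- so only the index `k = m` changes.
      have h1 : ∀ k, (if (j k : ℕ) = a then
          (if nodeWord j (k + 1) <+: nodeWord j (m + 1) then 1 else 0) else 0) =
          (if (j k : ℕ) = a then
          (if nodeWord j (k + 1) <+: nodeWord j (j m) then 1 else 0) else 0) +
          if k = m then (if (j m : ℕ) = a then 1 else 0) else 0 := by
        intro k
        have h2 : nodeWord j (k + 1) = nodeWord j (m + 1) ↔ k = m := by
          rw [(nodeWord_injective j).eq_iff]
          omega
        simp only [prefix_nodeWord_succ (m := m), h2]
        by_cases hk : k = m
        · subst hk
          have : ¬ nodeWord j (k + 1) <+: nodeWord j (j k) := fun h => by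
            have := le_of_nodeWord_prefix h
            have := (j k).isLt
            omega
          simp [this]
        · simp [hk]
      rw [Finset.sum_congr rfl fun k _ => h1 k, Finset.sum_add_distrib,
        Finset.sum_ite_eq' (Finset.range M) m, if_pos (Finset.mem_range.2 hx), ih']
      have h2 : nodeWord j a = nodeWord j (m + 1) ↔ m + 1 = a := by
        rw [(nodeWord_injective j).eq_iff, eq_comm]
      simp only [prefix_nodeWord_succ (m := m), h2]
      by_cases hk : m + 1 = a
      · subst hk
        have : ¬ nodeWord j (m + 1) <+: nodeWord j (j m) := fun h => by
          have := le_of_nodeWord_prefix h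
          have := (j m).isLt
          omega
        simp [this]
      · simp [hk]

/-- The proper descendants of a node are partitioned by the subtrees of its children. -/
theorem sum_children_descCount {j : ParentSeq} {m a : ℕ} (ha : a ≤ m) :
    ∑ k ∈ Finset.range m, (if (j k : ℕ) = a then descCount j (m + 1) (k + 1) else 0) + 1 =
      descCount j (m + 1) a := by
  have h2 : ∀ b, descCount j (m + 1) b =
      ∑ x ∈ Finset.range (m + 1), if nodeWord j b <+: nodeWord j x then 1 else 0 := by
    intro b
    rw [descCount, Finset.card_filter]
  rw [h2 a, ← Finset.sum_congr rfl fun x hx =>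
      sum_children_prefix (M := m) (Nat.le_of_lt_succ (Finset.mem_range.1 hx)),
    Finset.sum_add_distrib, Finset.sum_comm]
  congr 1
  · apply Finset.sum_congr rfl
    intro k _
    rw [h2]
    split_ifs with h
    · rfl
    · simp
  · rw [Finset.sum_ite_eq' (Finset.range (m + 1)) a, if_pos (Finset.mem_range.2 (by omega))]

theorem subtreeSize_harrisTree (j : ParentSeq) (n a : ℕ) :
    subtreeSize (harrisTree j n) (nodeWord j a) = descCount j n a := by
  unfold subtreeSize harrisTree descCount
  rw [Finset.filter_image, Finset.card_image_of_injective _ (nodeWord_injective j)]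

theorem card_ancestors_le (j : ParentSeq) (n b : ℕ) :
    ((Finset.range n).filter (fun a => nodeWord j a <+: nodeWord j b)).card ≤
      (nodeWord j b).length + 1 := by
  rw [← List.length_inits]
  calc _ ≤ ((nodeWord j b).inits.toFinset).card := by
        apply Finset.card_le_card_of_injOn (nodeWord j) _ (nodeWord_injective j).injOn
        intro a ha
        simpa using (Finset.mem_filter.1 ha).2
    _ ≤ _ := List.toFinset_card_le _

/-! ### The Wiener index of a tree of words -/

/-- The set of the prefixes of a word. -/
def prefixes (u : List ℕ+) : Finset (List ℕ+) := u.inits.toFinset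

theorem mem_prefixes {u w : List ℕ+} : w ∈ prefixes u ↔ w <+: u := by
  simp [prefixes]

theorem prefixes_concat (u : List ℕ+) (i : ℕ+) :
    prefixes (u ++ [i]) = insert (u ++ [i]) (prefixes u) := by
  ext w
  rw [Finset.mem_insert, mem_prefixes, mem_prefixes, List.prefix_concat_iff]

theorem not_mem_prefixes_concat (u : List ℕ+) (i : ℕ+) : u ++ [i] ∉ prefixes u := by
  rw [mem_prefixes]
  intro h
  have := h.length_le
  simp at this

theorem card_symmDiff_prefixes_le {u v : List ℕ+}
    (h : (∃ i : ℕ+, v = u ++ [i]) ∨ (∃ i : ℕ+, u = v ++ [i])) :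
    (symmDiff (prefixes u) (prefixes v)).card ≤ 1 := by
  wlog h' : ∃ i : ℕ+, v = u ++ [i] generalizing u v
  · rw [symmDiff_comm]
    exact this h.symm (h.resolve_left h')
  obtain ⟨i, rfl⟩ := h'
  rw [prefixes_concat]
  have : symmDiff (prefixes u) (insert (u ++ [i]) (prefixes u)) ⊆ {u ++ [i]} := by
    intro w
    simp only [Finset.mem_symmDiff, Finset.mem_insert, Finset.mem_singleton]
    tauto
  exact (Finset.card_le_card this).trans (Finset.card_singleton _).le

/-- Lower bound for the distance: crossing an edge changes the prefix set by at most one word. -/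
theorem card_symmDiff_prefixes_le_length {x : Finset (List ℕ+)} {u v : x}
    (p : (treeGraph x).Walk u v) :
    (symmDiff (prefixes u) (prefixes v)).card ≤ p.length := by
  induction p with
  | nil => simp
  | @cons u v w h p ih =>
    have h1 : symmDiff (prefixes u) (prefixes w) ⊆
        symmDiff (prefixes u) (prefixes v) ∪ symmDiff (prefixes v) (prefixes w) :=
      symmDiff_triangle _ _ _
    have h2 := (Finset.card_le_card h1).trans (Finset.card_union_le _ _)
    have h3 := card_symmDiff_prefixes_le h
    rw [SimpleGraph.Walk.length_cons]
    omega

/-- Upper bound for the distance: dropping the last letter of a word that is not a prefix of the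
other one is a step along an edge and shrinks the symmetric difference by one. -/
theorem exists_walk_length_le {x : Finset (List ℕ+)}
    (hx : ∀ u ∈ x, ∀ w, w <+: u → w ∈ x) (u v : x) :
    ∃ p : (treeGraph x).Walk u v, p.length ≤ (symmDiff (prefixes u) (prefixes v)).card := by
  induction hk : (u : List ℕ+).length + (v : List ℕ+).length using Nat.strong_induction_on
    generalizing u v with
  | _ k ih =>
    -- Distinct words cannot be prefixes of each other, so after exchanging them if necessary the
    -- first one is not a prefix of the second; the total length is unchanged.
    wlog h : ¬ (u : List ℕ+) <+: v generalizing u v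
    · by_cases huv : u = v
      · subst huv
        exact ⟨SimpleGraph.Walk.nil, by simp⟩
      · have h' : ¬ (v : List ℕ+) <+: u := fun h' =>
          huv (Subtype.ext ((not_not.1 h).eq_of_length_le h'.length_le))
        obtain ⟨p, hp⟩ := this v u (by omega) h'
        exact ⟨p.reverse, by rwa [SimpleGraph.Walk.length_reverse, symmDiff_comm]⟩
    · obtain ⟨u, hu⟩ := u
      rcases List.eq_nil_or_concat' u with rfl | ⟨u', i, rfl⟩
      · exact absurd List.nil_prefix h
      · have hu' : u' ∈ x := hx _ hu _ (List.prefix_append _ _)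
        obtain ⟨p, hp⟩ := ih _ (by simp only [← hk]; simp) ⟨u', hu'⟩ v rfl
        have hadj : (treeGraph x).Adj ⟨u' ++ [i], hu⟩ ⟨u', hu'⟩ := Or.inr ⟨i, rfl⟩
        refine ⟨SimpleGraph.Walk.cons hadj p, ?_⟩
        have h1 : symmDiff (prefixes (u' ++ [i])) (prefixes v) =
            insert (u' ++ [i]) (symmDiff (prefixes u') (prefixes v)) := by
          have h2 : u' ++ [i] ∉ prefixes v := by rwa [mem_prefixes]
          have h3 := not_mem_prefixes_concat u' i
          rw [prefixes_concat]
          ext w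
          simp only [Finset.mem_symmDiff, Finset.mem_insert]
          by_cases hw : w = u' ++ [i]
          · subst hw
            simp [h2]
          · simp [hw]
        rw [SimpleGraph.Walk.length_cons]
        show _ ≤ (symmDiff (prefixes (u' ++ [i])) (prefixes v)).card
        rw [h1, Finset.card_insert_of_notMem]
        · exact Nat.succ_le_succ hp
        · rw [Finset.mem_symmDiff, mem_prefixes (u := v)]
          have h3 := not_mem_prefixes_concat u' i
          have h4 : ¬ u' ++ [i] <+: (v : List ℕ+) := h
          tauto

theorem treeGraph_dist {x : Finset (List ℕ+)}
    (hx : ∀ u ∈ x, ∀ w, w <+: u → w ∈ x) (u v : x) :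
    (treeGraph x).dist u v = (symmDiff (prefixes u) (prefixes v)).card := by
  obtain ⟨p, hp⟩ := exists_walk_length_le hx u v
  apply le_antisymm ((SimpleGraph.dist_le p).trans hp)
  obtain ⟨q, hq⟩ := p.reachable.exists_walk_length_eq_dist
  rw [← hq]
  exact card_symmDiff_prefixes_le_length q

/-- A word `w` lies in the symmetric difference for those pairs of which exactly one member is below
`w`. There are 2 N (n - N) such ordered pairs, and the factor 1/2 removes the 2. The root
contributes 0. -/
theorem treeWienerIndex_eq_sum {x : Finset (List ℕ+)}
    (hx : ∀ u ∈ x, ∀ w, w <+: u → w ∈ x) : treeWienerIndex x =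
      ∑ w ∈ x, ((x.card : ℝ) * subtreeSize x w - (subtreeSize x w : ℝ) ^ 2) := by
  have h1 : ∀ u ∈ x, ∀ v ∈ x, ((symmDiff (prefixes u) (prefixes v)).card : ℝ) =
      ∑ w ∈ x, ((if w <+: u then (1 : ℝ) else 0) + (if w <+: v then 1 else 0) -
        2 * ((if w <+: u then 1 else 0) * (if w <+: v then 1 else 0))) := by
    intro u hu v hv
    have h2 : symmDiff (prefixes u) (prefixes v) =
        x.filter (fun w => w ∈ symmDiff (prefixes u) (prefixes v)) := by
      ext w
      rw [Finset.mem_filter, iff_and_self, Finset.mem_symmDiff, mem_prefixes, mem_prefixes]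
      rintro (h | h)
      · exact hx u hu w h.1
      · exact hx v hv w h.1
    rw [h2, Finset.card_filter]
    push_cast
    apply Finset.sum_congr rfl
    intro w _
    simp only [Finset.mem_symmDiff, mem_prefixes]
    by_cases h3 : w <+: u <;> by_cases h4 : w <+: v <;> simp [h3, h4]
    norm_num
  have h2 : ∀ w, (subtreeSize x w : ℝ) = ∑ u ∈ x, if w <+: u then (1 : ℝ) else 0 := by
    intro w
    rw [subtreeSize, Finset.card_filter]
    push_cast
    rfl
  unfold treeWienerIndex wienerIndex
  have h3 : ∑ u : x, ∑ v : x, ((treeGraph x).dist u v : ℝ) =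
      ∑ u ∈ x, ∑ v ∈ x, ((symmDiff (prefixes u) (prefixes v)).card : ℝ) := by
    rw [← Finset.sum_coe_sort x]
    apply Finset.sum_congr rfl
    intro u _
    rw [← Finset.sum_coe_sort x]
    apply Finset.sum_congr rfl
    intro v _
    rw [treeGraph_dist hx]
  rw [h3, Finset.sum_congr rfl fun u hu => Finset.sum_congr rfl fun v hv => h1 u hu v hv,
    Finset.sum_congr rfl fun u _ => Finset.sum_comm, Finset.sum_comm, Finset.mul_sum]
  apply Finset.sum_congr rfl
  intro w _
  simp only [Finset.sum_sub_distrib, Finset.sum_add_distrib, ← Finset.mul_sum, ← Finset.sum_mul,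
    ← h2, Finset.sum_const, nsmul_eq_mul]
  ring

theorem treeWienerIndex_harrisTree (j : ParentSeq) (n : ℕ) : treeWienerIndex (harrisTree j n) =
    ∑ a ∈ Finset.range n, ((n : ℝ) * descCount j n a - (descCount j n a : ℝ) ^ 2) := by
  have hcl : ∀ u ∈ harrisTree j n, ∀ w, w <+: u → w ∈ harrisTree j n := by
    intro u hu w hw
    obtain ⟨b, hb, rfl⟩ := Finset.mem_image.1 hu
    obtain ⟨a, ha, rfl⟩ := exists_nodeWord_of_prefix hw
    exact Finset.mem_image_of_mem _ (Finset.mem_range.2 (ha.trans_lt (Finset.mem_range.1 hb)))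
  have hcard : (harrisTree j n).card = n := by
    rw [harrisTree, Finset.card_image_of_injective _ (nodeWord_injective j), Finset.card_range]
  rw [treeWienerIndex_eq_sum hcl, hcard]
  conv_lhs => rw [harrisTree, Finset.sum_image (nodeWord_injective j).injOn]
  apply Finset.sum_congr rfl
  intro a _
  rw [← harrisTree, subtreeSize_harrisTree]

/-! ### The filtration of the chain -/

/-- `Φ` is a function of the first `n` choices. -/
def IsLocal {β : Type*} (n : ℕ) (Φ : ParentSeq → β) : Prop :=
  ∀ j j' : ParentSeq, (∀ i < n, j i = j' i) → Φ j = Φ j'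

theorem IsLocal.mono {β : Type*} {n m : ℕ} {Φ : ParentSeq → β} (h : IsLocal n Φ) (hnm : n ≤ m) :
    IsLocal m Φ :=
  fun j j' hj => h j j' fun i hi => hj i (hi.trans_le hnm)

theorem IsLocal.update {β : Type*} {n : ℕ} {Φ : ParentSeq → β} (h : IsLocal n Φ) (j : ParentSeq)
    (i : Fin (n + 1)) : Φ (Function.update j n i) = Φ j :=
  h _ _ fun _ hk => Function.update_of_ne hk.ne _ _

theorem isLocal_const {β : Type*} (n : ℕ) (b : β) : IsLocal n (fun _ => b) := fun _ _ _ => rfl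

theorem IsLocal.update_succ {β : Type*} {n : ℕ} {Φ : ParentSeq → β} (h : IsLocal (n + 1) Φ)
    (i : Fin (n + 1)) : IsLocal n (fun j => Φ (Function.update j n i)) := by
  intro j j' hj
  apply h
  intro k hk
  rcases Nat.lt_succ_iff_lt_or_eq.1 hk with hk | rfl
  · rw [Function.update_of_ne hk.ne, Function.update_of_ne hk.ne, hj k hk]
  · rw [Function.update_self, Function.update_self]

/-- The tree with `m + 1` nodes is determined by `m` choices; this is the source of the index shift
in all the processes below. -/
theorem isLocal_descCount (m a : ℕ) : IsLocal m (fun j => descCount j (m + 1) a) :=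
  fun _ _ h => descCount_congr h

theorem isLocal_nodeWord {m a : ℕ} (h : a ≤ m) : IsLocal m (fun j => nodeWord j a) :=
  fun _ _ hj => nodeWord_congr fun i hi => hj i (hi.trans_le h)

/-- Factoring through a finite discrete space gives measurability, boundedness and integrability at
once. -/
theorem IsLocal.exists_factor {β : Type*} {n : ℕ} {Φ : ParentSeq → β} (h : IsLocal n Φ) :
    ∃ g : ((i : Finset.range n) → Fin ((i : ℕ) + 1)) → β,
      ∀ j : ParentSeq, Φ j = g (fun i => j i) := by
  -- The choices from `n` on are filled with the root; by locality this default is irrelevant.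
  refine ⟨fun x => Φ (fun k => if hk : k < n then x ⟨k, Finset.mem_range.2 hk⟩ else 0), ?_⟩
  intro j
  apply h
  intro i hi
  rw [dif_pos hi]

section Chain

variable {Ω : Type*} [mΩ : MeasurableSpace Ω] {P : Measure Ω} {J : (k : ℕ) → Ω → Fin (k + 1)}

/-- The sequence of the direct ancestors at `ω`. -/
def parentSeq (J : (k : ℕ) → Ω → Fin (k + 1)) (ω : Ω) : ParentSeq := fun k => J k ω

/-- The σ-field of the first `n` choices, as a filtration. -/
def history (hJ : IsRandomRecursiveTreeChain P J) : Filtration ℕ mΩ where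
  seq n := MeasurableSpace.comap (fun ω (i : Finset.range n) => J i ω) inferInstance
  mono' := by
    intro n m hnm
    refine MeasurableSpace.comap_le_iff_le_map.2 ?_
    have h : (fun ω (i : Finset.range n) => J i ω) =
        (fun (x : (i : Finset.range m) → Fin ((i : ℕ) + 1)) (i : Finset.range n) =>
          x ⟨i, Finset.range_mono hnm i.2⟩) ∘ (fun ω (i : Finset.range m) => J i ω) := rfl
    refine Measurable.le_map ?_
    rw [h]
    exact Measurable.comp (measurable_pi_lambda _ fun i => measurable_pi_apply _)
      (comap_measurable _)
  le' := by
    intro n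
    exact Measurable.comap_le (measurable_pi_lambda _ fun i => hJ.measurable i)

theorem IsLocal.stronglyMeasurable {n : ℕ} {Φ : ParentSeq → ℝ} (h : IsLocal n Φ)
    (hJ : IsRandomRecursiveTreeChain P J) :
    StronglyMeasurable[history hJ n] (fun ω => Φ (parentSeq J ω)) := by
  obtain ⟨g, hg⟩ := h.exists_factor
  have : (fun ω => Φ (parentSeq J ω)) = g ∘ (fun ω (i : Finset.range n) => J i ω) :=
    funext fun ω => hg _
  rw [this]
  exact (Measurable.comp (.of_discrete) (comap_measurable _)).stronglyMeasurable

theorem IsLocal.measurable {n : ℕ} {Φ : ParentSeq → ℝ} (h : IsLocal n Φ)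
    (hJ : IsRandomRecursiveTreeChain P J) : Measurable (fun ω => Φ (parentSeq J ω)) :=
  ((h.stronglyMeasurable hJ).mono ((history hJ).le n)).measurable

theorem IsLocal.exists_bound {n : ℕ} {Φ : ParentSeq → ℝ} (h : IsLocal n Φ) :
    ∃ C, ∀ j, ‖Φ j‖ ≤ C := by
  obtain ⟨g, hg⟩ := h.exists_factor
  refine ⟨∑ x, ‖g x‖, fun j => ?_⟩
  rw [hg]
  exact Finset.single_le_sum (f := fun x => ‖g x‖) (fun _ _ => norm_nonneg _) (Finset.mem_univ _)

theorem IsLocal.integrable [IsProbabilityMeasure P] {n : ℕ} {Φ : ParentSeq → ℝ} (h : IsLocal n Φ)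
    (hJ : IsRandomRecursiveTreeChain P J) : Integrable (fun ω => Φ (parentSeq J ω)) P := by
  obtain ⟨C, hC⟩ := h.exists_bound
  exact Integrable.of_bound (h.measurable hJ).aestronglyMeasurable C
    (Eventually.of_forall fun ω => hC _)

theorem condExp_indicator_choice [IsProbabilityMeasure P] (hJ : IsRandomRecursiveTreeChain P J)
    (n : ℕ) (i : Fin (n + 1)) :
    P[(J n ⁻¹' {i}).indicator (fun _ => (1 : ℝ)) | history hJ n] =ᵐ[P]
      fun _ => 1 / ((n : ℝ) + 1) := by
  have hind : IndepFun (J n) (fun ω (i : Finset.range n) => J i ω) P := by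
    have h := hJ.indep.indepFun_finset {n} (Finset.range n) (by simp) hJ.measurable
    exact h.comp (φ := fun x : (i : ({n} : Finset ℕ)) → Fin ((i : ℕ) + 1) =>
      x ⟨n, Finset.mem_singleton_self n⟩) (ψ := id) (measurable_pi_apply _) measurable_id
  have hmeas : Measurable[MeasurableSpace.comap (J n) inferInstance]
      ((J n ⁻¹' {i}).indicator (fun _ => (1 : ℝ))) :=
    Measurable.indicator measurable_const ⟨{i}, measurableSet_singleton i, rfl⟩
  refine (condExp_indep_eq (hJ.measurable n).comap_le ((history hJ).le n)
    hmeas.stronglyMeasurable hind).trans ?_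
  rw [integral_indicator_const _ (hJ.measurable n (measurableSet_singleton i)), hJ.uniform]
  simp

/-- Conditionally on the first `n` choices, the next one is uniform. -/
theorem condExp_next [IsProbabilityMeasure P] (hJ : IsRandomRecursiveTreeChain P J) {n : ℕ}
    {Φ : ParentSeq → ℝ} (hΦ : IsLocal (n + 1) Φ) :
    P[fun ω => Φ (parentSeq J ω) | history hJ n] =ᵐ[P]
      fun ω => (∑ i : Fin (n + 1), Φ (Function.update (parentSeq J ω) n i)) / ((n : ℝ) + 1) := by
  -- `Φ` is split according to the value of the choice `J n`. Each coefficient then depends on the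
  -- first `n` choices only and leaves the conditional expectation.
  have h1 : (fun ω => Φ (parentSeq J ω)) = ∑ i : Fin (n + 1),
      (fun ω => Φ (Function.update (parentSeq J ω) n i)) *
        (J n ⁻¹' {i}).indicator (fun _ => (1 : ℝ)) := by
    ext ω
    rw [Finset.sum_apply, Finset.sum_eq_single (J n ω)]
    · have : Function.update (parentSeq J ω) n (J n ω) = parentSeq J ω :=
        Function.update_eq_self n _
      simp [this]
    · intro i _ hi
      simp [Set.indicator, hi.symm]
    · simp
  have hint : ∀ i : Fin (n + 1), Integrable ((J n ⁻¹' {i}).indicator (fun _ => (1 : ℝ))) P :=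
    fun i => (integrable_const _).indicator (hJ.measurable n (measurableSet_singleton i))
  have hb : ∀ i : Fin (n + 1), ∃ C, ∀ j, ‖Φ (Function.update j n i)‖ ≤ C :=
    fun i => (hΦ.update_succ i).exists_bound
  choose C hC using hb
  have h2 : ∀ i : Fin (n + 1), P[(fun ω => Φ (Function.update (parentSeq J ω) n i)) *
        (J n ⁻¹' {i}).indicator (fun _ => (1 : ℝ)) | history hJ n] =ᵐ[P]
      fun ω => Φ (Function.update (parentSeq J ω) n i) * (1 / ((n : ℝ) + 1)) := by
    intro i
    refine (condExp_stronglyMeasurable_mul_of_bound ((history hJ).le n)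
      ((hΦ.update_succ i).stronglyMeasurable hJ) (hint i) (C i)
      (Eventually.of_forall fun ω => hC i _)).trans ?_
    filter_upwards [condExp_indicator_choice hJ n i] with ω hω
    simp only [Pi.mul_apply, hω]
  rw [h1]
  refine (condExp_finsetSum (fun i _ => ?_) _).trans ?_
  · exact (hint i).bdd_mul ((hΦ.update_succ i).measurable hJ).aestronglyMeasurable
      (Eventually.of_forall fun ω => hC i (parentSeq J ω))
  · filter_upwards [ae_all_iff.2 h2] with ω hω
    rw [Finset.sum_apply, Finset.sum_congr rfl fun i _ => hω i, ← Finset.sum_mul]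
    ring

theorem integral_next [IsProbabilityMeasure P] (hJ : IsRandomRecursiveTreeChain P J) {n : ℕ}
    {Φ : ParentSeq → ℝ} (hΦ : IsLocal (n + 1) Φ) :
    ∫ ω, Φ (parentSeq J ω) ∂P =
      ∫ ω, (∑ i : Fin (n + 1), Φ (Function.update (parentSeq J ω) n i)) / ((n : ℝ) + 1) ∂P := by
  rw [← integral_condExp ((history hJ).le n)]
  exact integral_congr_ae (condExp_next hJ hΦ)

/-- Every node has infinitely many children. -/
theorem ae_infinite_children [IsProbabilityMeasure P] (hJ : IsRandomRecursiveTreeChain P J) :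
    ∀ᵐ ω ∂P, ∀ a : ℕ, {k : ℕ | (parentSeq J ω k : ℕ) = a}.Infinite := by
  rw [ae_all_iff]
  intro a
  set s : ℕ → Set Ω := fun k => J k ⁻¹' {i | (i : ℕ) = a} with hs
  have hsm : ∀ k, MeasurableSet (s k) := fun k => hJ.measurable k (MeasurableSet.of_discrete)
  have hind : iIndepSet s P := by
    rw [iIndepSet_iff_meas_biInter hsm]
    intro t
    exact (iIndepFun_iff_measure_inter_preimage_eq_mul.1 hJ.indep) t
      (sets := fun k => {i | (i : ℕ) = a}) fun i _ => MeasurableSet.of_discrete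
  have hprob : ∀ k, a ≤ k → P (s k) = ENNReal.ofReal (1 / ((k : ℝ) + 1)) := by
    intro k hk
    have h1 : s k = J k ⁻¹' {⟨a, Nat.lt_succ_of_le hk⟩} := by
      ext ω
      simp [hs, Fin.ext_iff]
    rw [h1, ← hJ.uniform k ⟨a, Nat.lt_succ_of_le hk⟩, measureReal_def,
      ENNReal.ofReal_toReal (measure_ne_top _ _)]
  -- Second Borel–Cantelli lemma: the probabilities are 1/(k+1) for `k ≥ a`, a tail of the harmonic
  -- series.
  have hsum : ∑' k, P (s k) = ⊤ := by
    by_contra hne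
    have h2 : Summable (fun k => (P (s k)).toReal) := ENNReal.summable_toReal hne
    have h3 : Summable (fun k : ℕ => 1 / (((k + a : ℕ) : ℝ) + 1)) := by
      refine ((summable_nat_add_iff a).2 h2).congr ?_
      intro k
      rw [hprob _ (Nat.le_add_left _ _), ENNReal.toReal_ofReal (by positivity)]
    have h4 : Summable (fun k : ℕ => 1 / (k : ℝ)) := by
      refine (summable_nat_add_iff (a + 1)).1 (h3.congr fun k => ?_)
      push_cast
      ring
    exact Real.not_summable_one_div_natCast h4
  have h := measure_limsup_eq_one hsm hind hsum
  have h5 : ∀ᵐ ω ∂P, ω ∈ limsup s atTop := by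
    rw [ae_iff, ← Set.compl_def, prob_compl_eq_zero_iff]
    · exact h
    · exact MeasurableSet.measurableSet_limsup hsm
  filter_upwards [h5] with ω hω
  rw [mem_limsup_iff_frequently_mem] at hω
  exact Nat.frequently_atTop_iff_infinite.1 hω

end Chain

/-! ### Functions of the subtree sizes that are harmonic for the urn -/

/-- The harmonic numbers as real numbers. -/
noncomputable def harm (n : ℕ) : ℝ := (harmonic n : ℝ)

theorem harm_zero : harm 0 = 0 := by simp [harm]

theorem harm_succ (n : ℕ) : harm (n + 1) = harm n + 1 / ((n : ℝ) + 1) := by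
  unfold harm
  rw [harmonic_succ]
  push_cast
  rw [one_div]

theorem harm_one : harm 1 = 1 := by
  rw [show (1 : ℕ) = 0 + 1 from rfl, harm_succ, harm_zero]
  norm_num

theorem harm_mono : Monotone harm :=
  monotone_nat_of_le_succ fun n => by
    rw [harm_succ]
    have : (0 : ℝ) ≤ 1 / ((n : ℝ) + 1) := by positivity
    linarith

theorem harm_nonneg (n : ℕ) : 0 ≤ harm n := by
  rw [← harm_zero]
  exact harm_mono n.zero_le

theorem log_le_harm (n : ℕ) : Real.log ((n : ℝ) + 1) ≤ harm n := by
  have := log_add_one_le_harmonic n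
  push_cast at this
  exact this

theorem harm_le (n : ℕ) : harm n ≤ 1 + Real.log n := harmonic_le_one_add_log n

theorem harm_sub_le {n N : ℕ} (h : N ≤ n) : harm n - harm N ≤ ((n : ℝ) - N) / ((N : ℝ) + 1) := by
  induction n, h using Nat.le_induction with
  | base => simp
  | succ n hn ih =>
    rw [harm_succ]
    have h1 : 1 / ((n : ℝ) + 1) ≤ 1 / ((N : ℝ) + 1) := by
      apply one_div_le_one_div_of_le (by positivity)
      have : (N : ℝ) ≤ n := by exact_mod_cast hn
      linarith
    push_cast
    calc harm n + 1 / ((n : ℝ) + 1) - harm N ≤ ((n : ℝ) - N) / ((N : ℝ) + 1) + 1 / ((N : ℝ) + 1) := by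
          linarith
      _ = _ := by ring

/-- A function of the size `N` of a subtree of a tree with `n` nodes that is harmonic for the
urn dynamics: the subtree gets the next node with probability `N / n`. -/
def IsUrnHarmonic (F : ℕ → ℕ → ℝ) : Prop :=
  ∀ n N : ℕ, 1 ≤ N → N ≤ n →
    (N : ℝ) * F (n + 1) (N + 1) + ((n : ℝ) - N) * F (n + 1) N = n * F n N

/-- The ratio of rising factorials. -/
noncomputable def risingRatio (q n N : ℕ) : ℝ := (N.ascFactorial q : ℝ) / (n.ascFactorial q : ℝ)

/-- The relative size weighted with a discrete version of its logarithm. -/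
noncomputable def entropyTerm (n N : ℕ) : ℝ := (N : ℝ) / n * (harm n - harm N)

/-- The discrete version of the logarithm of the relative size. -/
noncomputable def logTerm (n N : ℕ) : ℝ := harm (n - 1) - harm (N - 1)

theorem isUrnHarmonic_risingRatio (q : ℕ) : IsUrnHarmonic (risingRatio q) := by
  intro n N hN hn
  unfold risingRatio
  have hn1 : 1 ≤ n := hN.trans hn
  have h1 : (N : ℝ) * (N + 1).ascFactorial q = ((N : ℝ) + q) * N.ascFactorial q := by
    exact_mod_cast Nat.succ_ascFactorial N q
  have h2 : (n : ℝ) * (n + 1).ascFactorial q = ((n : ℝ) + q) * n.ascFactorial q := by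
    exact_mod_cast Nat.succ_ascFactorial n q
  have h3 : (0 : ℝ) < (n + 1).ascFactorial q := by exact_mod_cast Nat.ascFactorial_pos _ _
  have h4 : (0 : ℝ) < n.ascFactorial q := by
    obtain ⟨m, rfl⟩ := Nat.exists_eq_add_of_le' hn1
    exact_mod_cast Nat.ascFactorial_pos _ _
  rw [← mul_div_assoc, ← mul_div_assoc, ← mul_div_assoc, ← add_div, h1,
    div_eq_div_iff h3.ne' h4.ne']
  linear_combination (-(N.ascFactorial q : ℝ)) * h2

/-- The function comes from Γ(N+q)Γ(n) / (Γ(N)Γ(n+q)), which is harmonic in the same sense: up to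
sign, `entropyTerm` is its derivative in q at q = 1 and `logTerm` the one at q = 0. Harmonicity is
then a direct computation. -/
theorem isUrnHarmonic_entropyTerm : IsUrnHarmonic entropyTerm := by
  intro n N hN hn
  unfold entropyTerm
  have hn1 : (0 : ℝ) < n := by exact_mod_cast hN.trans hn
  have hN1 : (0 : ℝ) < (N : ℝ) := by exact_mod_cast hN
  rw [harm_succ, harm_succ]
  push_cast
  field_simp
  ring

theorem isUrnHarmonic_logTerm : IsUrnHarmonic logTerm := by
  intro n N hN hn
  unfold logTerm
  obtain ⟨N, rfl⟩ := Nat.exists_eq_add_of_le' hN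
  obtain ⟨n, rfl⟩ := Nat.exists_eq_add_of_le' (hN.trans hn)
  simp only [Nat.add_sub_cancel]
  rw [harm_succ, harm_succ]
  push_cast
  field_simp
  ring

theorem risingRatio_nonneg (q n N : ℕ) : 0 ≤ risingRatio q n N := by
  unfold risingRatio
  positivity

theorem risingRatio_le_one {q n N : ℕ} (h : N ≤ n) : risingRatio q n N ≤ 1 := by
  unfold risingRatio
  apply div_le_one_of_le₀ _ (by positivity)
  have : N.ascFactorial q ≤ n.ascFactorial q := by
    induction q with
    | zero => simp
    | succ q ih =>
      rw [Nat.ascFactorial_succ, Nat.ascFactorial_succ]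
      exact Nat.mul_le_mul (by omega) ih
  exact_mod_cast this

theorem risingRatio_one (n N : ℕ) : risingRatio 1 n N = (N : ℝ) / n := by
  simp [risingRatio, Nat.ascFactorial]

theorem risingRatio_two (n N : ℕ) :
    risingRatio 2 n N = ((N : ℝ) * ((N : ℝ) + 1)) / ((n : ℝ) * ((n : ℝ) + 1)) := by
  simp [risingRatio, Nat.ascFactorial]
  ring

/-- Every factor (N+i)/(n+i) is at least N/n when N ≤ n. This bounds moments of relative sizes by
expectations known from the martingale. -/
theorem pow_le_risingRatio {q n N : ℕ} (hn : N ≤ n) (h0 : 1 ≤ n) :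
    ((N : ℝ) / n) ^ q ≤ risingRatio q n N := by
  induction q with
  | zero => simp [risingRatio]
  | succ q ih =>
    have hn1 : (0 : ℝ) < n := by exact_mod_cast h0
    have h1 : risingRatio (q + 1) n N = risingRatio q n N * (((N : ℝ) + q) / ((n : ℝ) + q)) := by
      unfold risingRatio
      rw [Nat.ascFactorial_succ, Nat.ascFactorial_succ]
      push_cast
      rw [mul_div_mul_comm]
      ring
    rw [pow_succ, h1]
    apply mul_le_mul ih _ (by positivity) (risingRatio_nonneg _ _ _)
    rw [div_le_div_iff₀ hn1 (by positivity)]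
    have : (N : ℝ) ≤ n := by exact_mod_cast hn
    nlinarith [(Nat.cast_nonneg q : (0 : ℝ) ≤ q)]

theorem risingRatio_initial_le (q a : ℕ) :
    risingRatio q (a + 1) 1 ≤ (q.factorial : ℝ) / ((a : ℝ) + 1) ^ q := by
  unfold risingRatio
  rw [Nat.one_ascFactorial]
  apply div_le_div_of_nonneg_left (by positivity) (by positivity)
  exact_mod_cast Nat.pow_succ_le_ascFactorial (a + 1) q

theorem entropyTerm_nonneg {n N : ℕ} (h : N ≤ n) : 0 ≤ entropyTerm n N :=
  mul_nonneg (by positivity) (sub_nonneg.2 (harm_mono h))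

theorem entropyTerm_le_one {n N : ℕ} (h : N ≤ n) : entropyTerm n N ≤ 1 := by
  unfold entropyTerm
  rcases Nat.eq_zero_or_pos n with rfl | hn
  · simp
  have hn1 : (0 : ℝ) < n := by exact_mod_cast hn
  have hN : (N : ℝ) ≤ n := by exact_mod_cast h
  calc (N : ℝ) / n * (harm n - harm N) ≤ (N : ℝ) / n * (((n : ℝ) - N) / ((N : ℝ) + 1)) :=
        mul_le_mul_of_nonneg_left (harm_sub_le h) (by positivity)
    _ ≤ 1 := by
        rw [div_mul_div_comm, div_le_one (by positivity)]
        nlinarith [(Nat.cast_nonneg N : (0 : ℝ) ≤ N)]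

theorem logTerm_nonneg {n N : ℕ} (h : N ≤ n) : 0 ≤ logTerm n N :=
  sub_nonneg.2 (harm_mono (Nat.sub_le_sub_right h 1))

/-! ### The urn martingales -/

theorem nodeWord_update {j : ParentSeq} {m a : ℕ} (h : a ≤ m) (i : Fin (m + 1)) :
    nodeWord (Function.update j m i) a = nodeWord j a :=
  (isLocal_nodeWord h).update j i

theorem descCount_update {j : ParentSeq} {m : ℕ} (a : ℕ) (i : Fin (m + 1)) :
    descCount (Function.update j m i) (m + 1) a = descCount j (m + 1) a :=
  (isLocal_descCount m a).update j i

theorem descCount_update_succ {j : ParentSeq} {m a : ℕ} (h : a ≤ m) (i : Fin (m + 1)) :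
    descCount (Function.update j m i) (m + 2) a =
      descCount j (m + 1) a + if nodeWord j a <+: nodeWord j i then 1 else 0 := by
  rw [descCount_add_two h, descCount_update, Function.update_self, nodeWord_update h,
    nodeWord_update (Nat.le_of_lt_succ i.isLt)]

theorem sum_fin_prefix (j : ParentSeq) (n a : ℕ) (x y : ℝ) :
    ∑ i : Fin n, (if nodeWord j a <+: nodeWord j i then x else y) =
      descCount j n a * x + ((n : ℝ) - descCount j n a) * y := by
  rw [Fin.sum_univ_eq_sum_range (fun i => if nodeWord j a <+: nodeWord j i then x else y),
    Finset.sum_ite, Finset.sum_const, Finset.sum_const, nsmul_eq_mul, nsmul_eq_mul]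
  have h1 := Finset.card_filter_add_card_filter_not (s := Finset.range n)
    (fun b => nodeWord j a <+: nodeWord j b)
  rw [Finset.card_range] at h1
  have h2 : (n : ℝ) - descCount j n a =
      ((Finset.range n).filter (fun b => ¬ nodeWord j a <+: nodeWord j b)).card := by
    rw [sub_eq_iff_eq_add']
    exact_mod_cast h1.symm
  rw [h2, descCount]

/-- The process `F(n, N_n)` for the size `N_n` of the subtree of the node `a`, with its initial
value up to the time when `a` is born. -/
noncomputable def urnValue (F : ℕ → ℕ → ℝ) (a m : ℕ) (j : ParentSeq) : ℝ :=
  if m ≤ a then F (a + 1) 1 else F (m + 1) (descCount j (m + 1) a)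

theorem urnValue_of_le {F : ℕ → ℕ → ℝ} {a m : ℕ} (h : a ≤ m) (j : ParentSeq) :
    urnValue F a m j = F (m + 1) (descCount j (m + 1) a) := by
  unfold urnValue
  split_ifs with h'
  · obtain rfl : a = m := le_antisymm h h'
    rw [descCount_self_succ]
  · rfl

theorem isLocal_urnValue (F : ℕ → ℕ → ℝ) (a m : ℕ) : IsLocal m (urnValue F a m) := by
  intro j j' h
  unfold urnValue
  rw [descCount_congr h]

/-- Until the birth of `a` the value is frozen. There is no jump at the birth, because the newborn
subtree has exactly one node; afterwards `sum_fin_prefix` turns the average into the harmonicity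
relation. -/
theorem urnValue_average {F : ℕ → ℕ → ℝ} (hF : IsUrnHarmonic F) (a m : ℕ) (j : ParentSeq) :
    (∑ i : Fin (m + 1), urnValue F a (m + 1) (Function.update j m i)) / ((m : ℝ) + 1) =
      urnValue F a m j := by
  have hm : (m : ℝ) + 1 ≠ 0 := by positivity
  rw [div_eq_iff hm]
  rcases Nat.lt_or_ge m a with h | h
  · have h1 : ∀ j, urnValue F a (m + 1) j = F (a + 1) 1 := fun j => if_pos h
    have h2 : urnValue F a m j = F (a + 1) 1 := if_pos h.le
    simp only [h1, h2]
    simp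
    ring
  · rw [urnValue_of_le h]
    have h1 : ∀ i : Fin (m + 1), urnValue F a (m + 1) (Function.update j m i) =
        if nodeWord j a <+: nodeWord j i then F (m + 2) (descCount j (m + 1) a + 1)
        else F (m + 2) (descCount j (m + 1) a) := by
      intro i
      rw [urnValue_of_le (h.trans m.le_succ), descCount_update_succ h]
      split_ifs <;> rfl
    rw [Finset.sum_congr rfl fun i _ => h1 i, sum_fin_prefix]
    have := hF (m + 1) _ (one_le_descCount (j := j) (Nat.lt_succ_of_le h)) (descCount_le _ _ _)
    rw [this]
    push_cast
    ring

section Chain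

variable {Ω : Type*} [mΩ : MeasurableSpace Ω] {P : Measure Ω} [IsProbabilityMeasure P]
  {J : (k : ℕ) → Ω → Fin (k + 1)}

theorem martingale_of_average (hJ : IsRandomRecursiveTreeChain P J) {M : ℕ → ParentSeq → ℝ}
    (hloc : ∀ m, IsLocal m (M m))
    (havg : ∀ m j, (∑ i : Fin (m + 1), M (m + 1) (Function.update j m i)) / ((m : ℝ) + 1) = M m j) :
    Martingale (fun m ω => M m (parentSeq J ω)) (history hJ) P := by
  refine martingale_nat (fun m => (hloc m).stronglyMeasurable hJ) (fun m => (hloc m).integrable hJ)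
    fun m => ?_
  filter_upwards [condExp_next hJ (hloc (m + 1))] with ω hω
  rw [hω, havg]

theorem martingale_urnValue (hJ : IsRandomRecursiveTreeChain P J) {F : ℕ → ℕ → ℝ}
    (hF : IsUrnHarmonic F) (a : ℕ) :
    Martingale (fun m ω => urnValue F a m (parentSeq J ω)) (history hJ) P :=
  martingale_of_average hJ (isLocal_urnValue F a) (urnValue_average hF a)

theorem integral_urnValue (hJ : IsRandomRecursiveTreeChain P J) {F : ℕ → ℕ → ℝ}
    (hF : IsUrnHarmonic F) (a m : ℕ) :
    ∫ ω, urnValue F a m (parentSeq J ω) ∂P = F (a + 1) 1 := by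
  have h := (martingale_urnValue hJ hF a).setIntegral_eq m.zero_le MeasurableSet.univ
  rw [setIntegral_univ, setIntegral_univ] at h
  rw [← h]
  have h1 : ∀ j, urnValue F a 0 j = F (a + 1) 1 := fun j => if_pos a.zero_le
  simp [h1]

theorem urnValue_nonneg {F : ℕ → ℕ → ℝ} (h0 : ∀ n N, N ≤ n → 0 ≤ F n N) (a m : ℕ)
    (j : ParentSeq) : 0 ≤ urnValue F a m j := by
  unfold urnValue
  split_ifs
  · exact h0 _ _ (by omega)
  · exact h0 _ _ (descCount_le _ _ _)

theorem urnValue_le {F : ℕ → ℕ → ℝ} {C : ℝ} (h0 : ∀ n N, N ≤ n → F n N ≤ C) (a m : ℕ)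
    (j : ParentSeq) : urnValue F a m j ≤ C := by
  unfold urnValue
  split_ifs
  · exact h0 _ _ (by omega)
  · exact h0 _ _ (descCount_le _ _ _)

/-- A nonnegative martingale has constant expectation, hence is bounded in L¹ and converges almost
surely. -/
theorem ae_exists_tendsto_urn (hJ : IsRandomRecursiveTreeChain P J) {F : ℕ → ℕ → ℝ}
    (hF : IsUrnHarmonic F) (h0 : ∀ n N, N ≤ n → 0 ≤ F n N) (a : ℕ) :
    ∀ᵐ ω ∂P, ∃ c, Tendsto (fun n => F n (descCount (parentSeq J ω) n a)) atTop (𝓝 c) := by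
  have hM := martingale_urnValue hJ hF a
  have hb : ∀ m, eLpNorm (fun ω => urnValue F a m (parentSeq J ω)) 1 P ≤
      ((F (a + 1) 1).toNNReal : ENNReal) := by
    intro m
    rw [eLpNorm_one_eq_lintegral_enorm]
    have h1 : ∀ ω, ‖urnValue F a m (parentSeq J ω)‖ₑ =
        ENNReal.ofReal (urnValue F a m (parentSeq J ω)) := fun ω => by
      rw [Real.enorm_eq_ofReal (urnValue_nonneg h0 _ _ _)]
    simp only [h1]
    rw [← ofReal_integral_eq_lintegral_ofReal ((isLocal_urnValue F a m).integrable hJ)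
      (Eventually.of_forall fun ω => urnValue_nonneg h0 _ _ _), integral_urnValue hJ hF]
    exact le_rfl
  filter_upwards [hM.submartingale.exists_ae_tendsto_of_bdd hb] with ω hω
  obtain ⟨c, hc⟩ := hω
  refine ⟨c, (tendsto_add_atTop_iff_nat 1).1 (hc.congr' ?_)⟩
  filter_upwards [eventually_ge_atTop a] with m hm
  rw [urnValue_of_le hm]

/-- The limit of the relative size of the subtree of the node `a`. -/
noncomputable def mass (j : ParentSeq) (a : ℕ) : ℝ :=
  limsup (fun n : ℕ => (descCount j n a : ℝ) / n) atTop

/-- The almost sure properties of the sequence of direct ancestors: every node has infinitely many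
children, and the relative sizes of the subtrees have positive limits. -/
structure HasRegularLimits (j : ParentSeq) : Prop where
  infinite : ∀ a : ℕ, {k : ℕ | (j k : ℕ) = a}.Infinite
  tendsto : ∀ a : ℕ, Tendsto (fun n : ℕ => (descCount j n a : ℝ) / n) atTop (𝓝 (mass j a))
  pos : ∀ a : ℕ, 0 < mass j a

theorem pos_of_tendsto_logTerm {N : ℕ → ℕ} (hN : ∀ᶠ n in atTop, 1 ≤ N n) {c x : ℝ}
    (hc : Tendsto (fun n => logTerm n (N n)) atTop (𝓝 c))
    (hx : Tendsto (fun n => (N n : ℝ) / n) atTop (𝓝 x)) : 0 < x := by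
  -- In the constant `c + 2`, one unit comes from `logTerm < c + 1` eventually, the other from H_k ≤
  -- 1 + log k.
  have h1 : ∀ᶠ n in atTop, Real.exp (-(c + 2)) ≤ (N n : ℝ) / n := by
    filter_upwards [hN, eventually_ge_atTop 1, hc.eventually (gt_mem_nhds (lt_add_one c))]
      with n h1 h2 h3
    have hn : (0 : ℝ) < n := by exact_mod_cast h2
    have hNn : (0 : ℝ) < N n := by exact_mod_cast h1
    have h4 := log_le_harm (n - 1)
    have h5 : harm (N n - 1) ≤ 1 + Real.log (N n) := by
      rcases Nat.lt_or_ge 1 (N n) with h | h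
      · refine (harm_le _).trans ?_
        have : Real.log ((N n - 1 : ℕ) : ℝ) ≤ Real.log (N n) := by
          apply Real.log_le_log
          · exact_mod_cast (by omega : 0 < N n - 1)
          · exact_mod_cast (by omega : N n - 1 ≤ N n)
        linarith
      · rw [show N n = 1 by omega]
        simp [harm_zero]
    have h6 : (((n - 1 : ℕ) : ℝ) + 1) = n := by
      exact_mod_cast Nat.sub_add_cancel h2
    rw [h6] at h4
    unfold logTerm at h3
    rw [← Real.le_log_iff_exp_le (by positivity), Real.log_div hNn.ne' hn.ne']
    linarith
  exact (Real.exp_pos _).trans_le (ge_of_tendsto hx h1)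

theorem ae_hasRegularLimits (hJ : IsRandomRecursiveTreeChain P J) : ∀ᵐ ω ∂P, HasRegularLimits (parentSeq J ω) := by
  have h1 := ae_all_iff.2 fun a => ae_exists_tendsto_urn hJ (isUrnHarmonic_risingRatio 1)
    (fun n N _ => risingRatio_nonneg 1 n N) a
  have h2 := ae_all_iff.2 fun a => ae_exists_tendsto_urn hJ isUrnHarmonic_logTerm
    (fun n N h => logTerm_nonneg h) a
  filter_upwards [h1, h2, ae_infinite_children hJ] with ω h1 h2 h3
  have h4 : ∀ a : ℕ, Tendsto (fun n : ℕ => (descCount (parentSeq J ω) n a : ℝ) / n) atTop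
      (𝓝 (mass (parentSeq J ω) a)) := by
    intro a
    obtain ⟨c, hc⟩ := h1 a
    simp only [risingRatio_one] at hc
    rwa [mass, hc.limsup_eq]
  refine ⟨h3, h4, fun a => ?_⟩
  obtain ⟨c, hc⟩ := h2 a
  refine pos_of_tendsto_logTerm ?_ hc (h4 a)
  filter_upwards [eventually_gt_atTop a] with n hn
  exact one_le_descCount hn

/-- Positivity of `x` forces N_n → ∞, so Euler's constant appears in both harmonic numbers and
cancels. -/
theorem tendsto_entropyTerm {N : ℕ → ℕ} {x : ℝ} (hx : 0 < x)
    (hN : Tendsto (fun n => (N n : ℝ) / n) atTop (𝓝 x)) :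
    Tendsto (fun n => entropyTerm n (N n)) atTop (𝓝 (Real.negMulLog x)) := by
  have hpos : ∀ᶠ n : ℕ in atTop, x / 2 < (N n : ℝ) / n := hN.eventually (lt_mem_nhds (half_lt_self hx))
  have hNtop : Tendsto N atTop atTop := by
    have h : Tendsto (fun n : ℕ => x / 2 * (n : ℝ)) atTop atTop :=
      tendsto_natCast_atTop_atTop.const_mul_atTop (half_pos hx)
    refine tendsto_natCast_atTop_iff.1 (tendsto_atTop_mono' _ ?_ h)
    filter_upwards [hpos, eventually_gt_atTop 0] with n h1 h2
    rw [lt_div_iff₀ (by exact_mod_cast h2)] at h1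
    exact h1.le
  have h1 : Tendsto (fun n => harm n - Real.log n) atTop (𝓝 Real.eulerMascheroniConstant) :=
    Real.tendsto_harmonic_sub_log
  have h2 := h1.comp hNtop
  have h3 : Tendsto (fun n => Real.log ((N n : ℝ) / n)) atTop (𝓝 (Real.log x)) := hN.log hx.ne'
  have h4 := hN.mul ((h1.sub h2).sub h3)
  have h5 : x * (Real.eulerMascheroniConstant - Real.eulerMascheroniConstant - Real.log x) =
      Real.negMulLog x := by
    rw [Real.negMulLog]
    ring
  rw [h5] at h4
  refine h4.congr' ?_
  filter_upwards [hpos, eventually_gt_atTop 0] with n h6 h7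
  have hn : (0 : ℝ) < n := by exact_mod_cast h7
  have h8 : (0 : ℝ) < N n := by
    have : 0 < (N n : ℝ) / n := (half_pos hx).trans h6
    exact (div_pos_iff_of_pos_right hn).1 this
  simp only [Function.comp]
  rw [entropyTerm, Real.log_div h8.ne' hn.ne']
  ring

end Chain

/-! ### Interchange of sum and limit for martingales -/

theorem tendsto_sum_of_le_of_tendsto {g : ℕ → ℕ → ℝ} {G : ℕ → ℝ} {b : ℕ → ℝ} {S : ℝ}
    (hg0 : ∀ c n, c < n → 0 ≤ g c n) (hlim : ∀ c, Tendsto (g c) atTop (𝓝 (G c)))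
    (hS : HasSum G S) (hb : Tendsto b atTop (𝓝 S))
    (hle : ∀ n, ∑ c ∈ Finset.range n, g c n ≤ b n) :
    Tendsto (fun n => ∑ c ∈ Finset.range n, g c n) atTop (𝓝 S) := by
  rw [tendsto_order]
  constructor
  · intro x hx
    obtain ⟨C, hC⟩ := (hS.tendsto_sum_nat.eventually (lt_mem_nhds hx)).exists
    have h1 : Tendsto (fun n => ∑ c ∈ Finset.range C, g c n) atTop
        (𝓝 (∑ c ∈ Finset.range C, G c)) := tendsto_finsetSum _ fun c _ => hlim c
    filter_upwards [h1.eventually (lt_mem_nhds hC), eventually_ge_atTop C] with n hn hCn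
    refine hn.trans_le (Finset.sum_le_sum_of_subset_of_nonneg (Finset.range_mono hCn) ?_)
    intro c hc _
    exact hg0 c n (Finset.mem_range.1 hc)
  · intro x hx
    filter_upwards [hb.eventually (gt_mem_nhds hx)] with n hn
    exact (hle n).trans_lt hn

/-- No domination uniform in `n` is needed. The partial sums at time `n` are at most the conditional
expectation of the total `T`, which converges to `T`, while any finite number of terms already gives
the lower bound in the limit. -/
theorem ae_tendsto_sum_of_condExp {Ω : Type*} [mΩ : MeasurableSpace Ω] {P : Measure Ω}
    [IsProbabilityMeasure P] {ℱ : Filtration ℕ mΩ} {g : ℕ → ℕ → Ω → ℝ} {G : ℕ → Ω → ℝ}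
    (hg0 : ∀ c n, c < n → ∀ ω, 0 ≤ g c n ω)
    (hmeas : ∀ c, Measurable[⨆ n, ℱ n] (G c)) (hint : ∀ c, Integrable (G c) P)
    (hsum : Summable fun c => ∫ ω, G c ω ∂P)
    (hcond : ∀ c n, c < n → g c n =ᵐ[P] P[G c | ℱ n])
    (hlim : ∀ᵐ ω ∂P, ∀ c, Tendsto (fun n => g c n ω) atTop (𝓝 (G c ω))) :
    ∀ᵐ ω ∂P, Summable (fun c => G c ω) ∧
      Tendsto (fun n => ∑ c ∈ Finset.range n, g c n ω) atTop (𝓝 (∑' c, G c ω)) := by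
  have hle : (⨆ n, ℱ n) ≤ mΩ := iSup_le ℱ.le
  have hG0 : ∀ᵐ ω ∂P, ∀ c, 0 ≤ G c ω := by
    filter_upwards [hlim] with ω hω c
    refine ge_of_tendsto (hω c) ?_
    filter_upwards [eventually_gt_atTop c] with n hn
    exact hg0 c n hn ω
  have hfin : ∫⁻ ω, ∑' c, ENNReal.ofReal (G c ω) ∂P ≠ ⊤ := by
    rw [lintegral_tsum fun c => ((hmeas c).mono hle le_rfl).ennreal_ofReal.aemeasurable]
    have h1 : ∀ c, ∫⁻ ω, ENNReal.ofReal (G c ω) ∂P = ENNReal.ofReal (∫ ω, G c ω ∂P) := by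
      intro c
      rw [ofReal_integral_eq_lintegral_ofReal (hint c)]
      filter_upwards [hG0] with ω hω using hω c
    simp only [h1]
    exact hsum.tsum_ofReal_ne_top
  -- Summation in [0, ∞] makes `T` measurable for the limit σ-field everywhere; that it equals the
  -- real sum is needed only almost surely.
  set T : Ω → ℝ := fun ω => (∑' c, ENNReal.ofReal (G c ω)).toReal with hT
  have hTmeas : Measurable[⨆ n, ℱ n] T := by
    refine Measurable.ennreal_toReal ?_
    exact @Measurable.tsum _ _ _ (⨆ n, ℱ n) _ _ _ _ _ _ _ _ _ _ _ _ fun c => (hmeas c).ennreal_ofReal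
  have hTint : Integrable T P := by
    refine integrable_toReal_of_lintegral_ne_top ?_ hfin
    exact (Measurable.tsum fun c => ((hmeas c).mono hle le_rfl).ennreal_ofReal).aemeasurable
  have hTsum : ∀ᵐ ω ∂P, HasSum (fun c => G c ω) (T ω) := by
    have h1 : ∀ᵐ ω ∂P, ∑' c, ENNReal.ofReal (G c ω) < ⊤ := by
      refine ae_lt_top' ?_ hfin
      exact (Measurable.tsum fun c =>
        ((hmeas c).mono hle le_rfl).ennreal_ofReal).aemeasurable
    filter_upwards [h1, hG0] with ω h1 h2
    have h3 : Summable (fun c => (ENNReal.ofReal (G c ω)).toReal) := ENNReal.summable_toReal h1.ne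
    have h4 := h3.hasSum
    rw [← ENNReal.tsum_toReal_eq fun c => ENNReal.ofReal_ne_top] at h4
    simpa only [ENNReal.toReal_ofReal (h2 _)] using h4
  have hdom : ∀ n, ∀ᵐ ω ∂P, ∑ c ∈ Finset.range n, g c n ω ≤ (P[T | ℱ n]) ω := by
    intro n
    have h1 : P[∑ c ∈ Finset.range n, G c | ℱ n] ≤ᵐ[P] P[T | ℱ n] := by
      refine condExp_mono (integrable_finsetSum' _ fun c _ => hint c) hTint ?_
      filter_upwards [hTsum, hG0] with ω h1 h2
      rw [Finset.sum_apply]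
      exact sum_le_hasSum _ (fun c _ => h2 c) h1
    have h2 := condExp_finsetSum (μ := P) (s := Finset.range n) (fun c _ => hint c) (ℱ n)
    have h3 : ∀ᵐ ω ∂P, ∀ c, c < n → g c n ω = (P[G c | ℱ n]) ω := by
      rw [ae_all_iff]
      intro c
      by_cases hc : c < n
      · filter_upwards [hcond c n hc] with ω hω _ using hω
      · exact Eventually.of_forall fun ω h => absurd h hc
    filter_upwards [h1, h2, h3] with ω h1 h2 h3
    rw [Finset.sum_congr rfl fun c hc => h3 c (Finset.mem_range.1 hc)]
    rw [h2, Finset.sum_apply] at h1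
    exact h1
  -- Since `T` is measurable for the limit σ-field, Lévy's limit is `T` itself.
  have hlevy := tendsto_ae_condExp (μ := P) (ℱ := ℱ) T
  rw [condExp_of_stronglyMeasurable hle hTmeas.stronglyMeasurable hTint] at hlevy
  filter_upwards [hlevy, ae_all_iff.2 hdom, hTsum, hlim] with ω h1 h2 h3 h4
  refine ⟨h3.summable, ?_⟩
  rw [h3.tsum_eq]
  exact tendsto_sum_of_le_of_tendsto (fun c n hc => hg0 c n hc ω) h4 h3 h1 h2

/-- A bounded martingale is closed by its limit: dominated convergence for conditional expectations,
applied to the martingale started at time `m`. -/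
theorem condExp_eq_of_martingale_tendsto {Ω : Type*} [mΩ : MeasurableSpace Ω] {P : Measure Ω}
    [IsProbabilityMeasure P] {ℱ : Filtration ℕ mΩ} {M : ℕ → Ω → ℝ} {G : Ω → ℝ} {C : ℝ}
    (hM : Martingale M ℱ P) (hC : ∀ n ω, |M n ω| ≤ C)
    (hlim : ∀ᵐ ω ∂P, Tendsto (fun n => M n ω) atTop (𝓝 (G ω))) (m : ℕ) :
    M m =ᵐ[P] P[G | ℱ m] := by
  have h := tendsto_condExp_unique (m := ℱ m) (fun n => M (n + m)) (fun _ => M m) G (M m)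
    (fun n => hM.integrable _) (fun _ => hM.integrable m)
    (by
      filter_upwards [hlim] with ω hω
      exact (tendsto_add_atTop_iff_nat m).2 hω)
    (Eventually.of_forall fun ω => tendsto_const_nhds)
    (fun _ => C) (integrable_const C) (fun _ => C) (integrable_const C)
    (fun n => Eventually.of_forall fun ω => hC _ ω) (fun n => Eventually.of_forall fun ω => hC _ ω)
    (fun n => (hM.2 m (n + m) (Nat.le_add_left _ _)).trans
      (by rw [condExp_of_stronglyMeasurable (ℱ.le m) (hM.1 m) (hM.integrable m)]))
  rw [condExp_of_stronglyMeasurable (ℱ.le m) (hM.1 m) (hM.integrable m)] at h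
  exact h.symm

section Chain

variable {Ω : Type*} [mΩ : MeasurableSpace Ω] {P : Measure Ω} [IsProbabilityMeasure P]
  {J : (k : ℕ) → Ω → Fin (k + 1)}

theorem isLocal_descCount' (n a : ℕ) : IsLocal n (fun j => descCount j n a) := by
  rcases n with _ | m
  · intro j j' _
    simp [descCount]
  · exact (isLocal_descCount m a).mono m.le_succ

-- Because `mass` is defined as a limsup, this holds everywhere and not only up to a null set.
omit [IsProbabilityMeasure P] in
theorem measurable_mass_iSup (hJ : IsRandomRecursiveTreeChain P J) (a : ℕ) :
    Measurable[⨆ n, history hJ n] (fun ω => mass (parentSeq J ω) a) := by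
  refine Measurable.limsup fun n => ?_
  have h : IsLocal n (fun j => (descCount j n a : ℝ) / n) := fun j j' hj => by
    have := isLocal_descCount' n a j j' hj
    simp only at this
    simp only [this]
  exact ((h.stronglyMeasurable hJ).measurable).mono (le_iSup (fun n => history hJ n) n) le_rfl

omit [IsProbabilityMeasure P] in
theorem measurable_mass (hJ : IsRandomRecursiveTreeChain P J) (a : ℕ) :
    Measurable (fun ω => mass (parentSeq J ω) a) :=
  (measurable_mass_iSup hJ a).mono (iSup_le (history hJ).le) le_rfl

theorem ae_tendsto_urnValue (hJ : IsRandomRecursiveTreeChain P J) {F : ℕ → ℕ → ℝ} {φ : ℝ → ℝ}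
    (hlim : ∀ j a, HasRegularLimits j →
      Tendsto (fun n => F n (descCount j n a)) atTop (𝓝 (φ (mass j a)))) (a : ℕ) :
    ∀ᵐ ω ∂P, Tendsto (fun m => urnValue F a m (parentSeq J ω)) atTop
      (𝓝 (φ (mass (parentSeq J ω) a))) := by
  filter_upwards [ae_hasRegularLimits hJ] with ω hω
  refine ((tendsto_add_atTop_iff_nat 1).2 (hlim _ a hω)).congr' ?_
  filter_upwards [eventually_ge_atTop a] with m hm
  rw [urnValue_of_le hm]

theorem condExp_urn_limit (hJ : IsRandomRecursiveTreeChain P J) {F : ℕ → ℕ → ℝ} {φ : ℝ → ℝ}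
    (hF : IsUrnHarmonic F) {C : ℝ} (h0 : ∀ n N, N ≤ n → 0 ≤ F n N) (hC : ∀ n N, N ≤ n → F n N ≤ C)
    (hlim : ∀ j a, HasRegularLimits j →
      Tendsto (fun n => F n (descCount j n a)) atTop (𝓝 (φ (mass j a)))) (a m : ℕ) :
    (fun ω => urnValue F a m (parentSeq J ω)) =ᵐ[P]
      P[fun ω => φ (mass (parentSeq J ω) a) | history hJ m] :=
  condExp_eq_of_martingale_tendsto (martingale_urnValue hJ hF a)
    (fun n ω => by
      rw [abs_of_nonneg (urnValue_nonneg h0 _ _ _)]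
      exact urnValue_le hC _ _ _)
    (ae_tendsto_urnValue hJ hlim a) m

/-- Weighted sums over the nodes of a harmonic function of the subtree sizes converge to the sum
of the limits. The weight of a node may depend on the history up to its birth. -/
theorem ae_tendsto_sum_urn (hJ : IsRandomRecursiveTreeChain P J) {F : ℕ → ℕ → ℝ} {φ : ℝ → ℝ}
    (hF : IsUrnHarmonic F) {C : ℝ} (h0 : ∀ n N, N ≤ n → 0 ≤ F n N) (hC : ∀ n N, N ≤ n → F n N ≤ C)
    (hφ : Measurable φ)
    (hlim : ∀ j a, HasRegularLimits j →
      Tendsto (fun n => F n (descCount j n a)) atTop (𝓝 (φ (mass j a))))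
    {w : ℕ → ParentSeq → ℝ} (hw : ∀ k, IsLocal (k + 1) (w k)) (hw0 : ∀ k j, 0 ≤ w k j)
    (hw1 : ∀ k j, w k j ≤ 1)
    (hsum : Summable fun k => F (k + 2) 1 * ∫ ω, w k (parentSeq J ω) ∂P) :
    ∀ᵐ ω ∂P, Summable (fun k => w k (parentSeq J ω) * φ (mass (parentSeq J ω) (k + 1))) ∧
      Tendsto (fun n => ∑ k ∈ Finset.range n, w k (parentSeq J ω) *
        F (n + 1) (descCount (parentSeq J ω) (n + 1) (k + 1))) atTop
        (𝓝 (∑' k, w k (parentSeq J ω) * φ (mass (parentSeq J ω) (k + 1)))) := by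
  set g : ℕ → ℕ → Ω → ℝ := fun k n ω => w k (parentSeq J ω) * urnValue F (k + 1) n (parentSeq J ω)
    with hg
  set G : ℕ → Ω → ℝ := fun k ω => w k (parentSeq J ω) * φ (mass (parentSeq J ω) (k + 1)) with hG
  have hφint : ∀ a, Integrable (fun ω => φ (mass (parentSeq J ω) a)) P := by
    intro a
    refine Integrable.of_bound (hφ.comp (measurable_mass hJ a)).aestronglyMeasurable C ?_
    filter_upwards [ae_tendsto_urnValue hJ hlim a] with ω hω
    refine le_of_tendsto hω.norm (Eventually.of_forall fun m => ?_)
    rw [Real.norm_of_nonneg (urnValue_nonneg h0 _ _ _)]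
    exact urnValue_le hC _ _ _
  have hwb : ∀ k, ∀ᵐ ω ∂P, ‖w k (parentSeq J ω)‖ ≤ 1 := fun k => Eventually.of_forall fun ω => by
    rw [Real.norm_of_nonneg (hw0 _ _)]
    exact hw1 _ _
  have hGint : ∀ k, Integrable (G k) P := fun k =>
    (hφint (k + 1)).bdd_mul ((hw k).measurable hJ).aestronglyMeasurable (hwb k)
  have hcond : ∀ k n, k < n → g k n =ᵐ[P] P[G k | history hJ n] := by
    intro k n hk
    have h1 := condExp_stronglyMeasurable_mul_of_bound ((history hJ).le n)
      (((hw k).mono hk).stronglyMeasurable hJ) (hφint (k + 1)) 1 (hwb k)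
    have h2 := condExp_urn_limit hJ hF h0 hC hlim (k + 1) n
    filter_upwards [h1, h2] with ω h1 h2
    simp only [hg, h2]
    exact h1.symm
  have hGmeas : ∀ k, Measurable[⨆ n, history hJ n] (G k) := by
    intro k
    have h1 : Measurable[⨆ n, history hJ n] (fun ω => w k (parentSeq J ω)) :=
      (((hw k).stronglyMeasurable hJ).measurable).mono
        (le_iSup (fun n => history hJ n) (k + 1)) le_rfl
    exact h1.mul (hφ.comp (measurable_mass_iSup hJ (k + 1)))
  -- Conditioning at time `k + 1`, when the node `k + 1` has just been born, replaces the limit by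
  -- the initial value `F (k + 2) 1`, which is deterministic.
  have hGsum : Summable fun k => ∫ ω, G k ω ∂P := by
    refine hsum.congr fun k => ?_
    rw [← integral_condExp (f := G k) ((history hJ).le (k + 1)), ← integral_const_mul]
    refine integral_congr_ae ?_
    filter_upwards [hcond k (k + 1) k.lt_succ_self] with ω hω
    rw [← hω]
    simp only [hg]
    rw [urnValue, if_pos le_rfl, mul_comm]
  have hglim : ∀ᵐ ω ∂P, ∀ k, Tendsto (fun n => g k n ω) atTop (𝓝 (G k ω)) := by
    rw [ae_all_iff]
    intro k
    filter_upwards [ae_tendsto_urnValue hJ hlim (k + 1)] with ω hω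
    exact hω.const_mul _
  filter_upwards [ae_tendsto_sum_of_condExp
    (fun k n _ ω => mul_nonneg (hw0 k _) (urnValue_nonneg h0 _ _ _))
    hGmeas hGint hGsum hcond hglim] with ω hω
  refine ⟨hω.1, hω.2.congr fun n => Finset.sum_congr rfl fun k hk => ?_⟩
  rw [Finset.mem_range] at hk
  show _ * urnValue F (k + 1) n (parentSeq J ω) = _
  rw [urnValue_of_le (by omega)]

end Chain

/-! ### The limits of the sums over children and over all nodes -/

/-- The indicator that the node `k + 1` is a child of `a`. -/
noncomputable def childInd (a k : ℕ) (j : ParentSeq) : ℝ := if (j k : ℕ) = a then 1 else 0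

theorem childInd_nonneg (a k : ℕ) (j : ParentSeq) : 0 ≤ childInd a k j := by
  unfold childInd
  split_ifs <;> norm_num

theorem childInd_le_one (a k : ℕ) (j : ParentSeq) : childInd a k j ≤ 1 := by
  unfold childInd
  split_ifs <;> norm_num

theorem isLocal_childInd (a k : ℕ) : IsLocal (k + 1) (childInd a k) := by
  intro j j' h
  unfold childInd
  rw [h k k.lt_succ_self]

theorem tendsto_harm_div : Tendsto (fun n : ℕ => harm n / n) atTop (𝓝 0) := by
  have h1 : Tendsto (fun n : ℕ => Real.log n / n) atTop (𝓝 0) :=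
    (Real.isLittleO_log_id_atTop.tendsto_div_nhds_zero).comp tendsto_natCast_atTop_atTop
  have h2 : Tendsto (fun n : ℕ => 1 / (n : ℝ) + Real.log n / n) atTop (𝓝 (0 + 0)) :=
    tendsto_one_div_atTop_nhds_zero_nat.add h1
  rw [add_zero] at h2
  refine squeeze_zero (fun n => div_nonneg (harm_nonneg n) n.cast_nonneg) (fun n => ?_) h2
  rw [← add_div]
  exact div_le_div_of_nonneg_right (harm_le n) n.cast_nonneg

theorem tendsto_risingRatio_one {j : ParentSeq} (a : ℕ) (hj : HasRegularLimits j) :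
    Tendsto (fun n => risingRatio 1 n (descCount j n a)) atTop (𝓝 (mass j a)) := by
  simpa only [risingRatio_one] using hj.tendsto a

theorem tendsto_risingRatio_two {j : ParentSeq} (a : ℕ) (hj : HasRegularLimits j) :
    Tendsto (fun n => risingRatio 2 n (descCount j n a)) atTop (𝓝 (mass j a ^ 2)) := by
  have h0 : Tendsto (fun n : ℕ => 1 / (n : ℝ)) atTop (𝓝 0) := tendsto_one_div_atTop_nhds_zero_nat
  have h1 := ((hj.tendsto a).mul ((hj.tendsto a).add h0)).div (h0.const_add 1) (by norm_num)
  have h2 : mass j a * (mass j a + 0) / (1 + 0) = mass j a ^ 2 := by ring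
  rw [h2] at h1
  refine h1.congr' ?_
  filter_upwards [eventually_gt_atTop 0] with n hn
  have hn' : (0 : ℝ) < n := by exact_mod_cast hn
  rw [risingRatio_two]
  simp only [Pi.div_apply]
  field_simp

section Chain

variable {Ω : Type*} [mΩ : MeasurableSpace Ω] {P : Measure Ω}
  {J : (k : ℕ) → Ω → Fin (k + 1)}

theorem integral_childInd_le (hJ : IsRandomRecursiveTreeChain P J) (a k : ℕ) :
    ∫ ω, childInd a k (parentSeq J ω) ∂P ≤ 1 / ((k : ℝ) + 1) := by
  by_cases h : a < k + 1
  · have h1 : (fun ω => childInd a k (parentSeq J ω)) =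
        (J k ⁻¹' {⟨a, h⟩}).indicator (fun _ => (1 : ℝ)) := by
      ext ω
      simp only [childInd, parentSeq, Set.indicator, Set.mem_preimage, Set.mem_singleton_iff,
        Fin.ext_iff]
      congr
    rw [h1, integral_indicator_const _ (hJ.measurable k (measurableSet_singleton _)),
      hJ.uniform]
    simp
  · have h1 : (fun ω => childInd a k (parentSeq J ω)) = fun _ => 0 := by
      ext ω
      rw [childInd, if_neg]
      have := (parentSeq J ω k).isLt
      omega
    rw [h1, integral_zero]
    positivity

theorem integral_childInd_nonneg (a k : ℕ) :
    0 ≤ ∫ ω, childInd a k (parentSeq J ω) ∂P :=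
  integral_nonneg fun _ => childInd_nonneg _ _ _

variable [IsProbabilityMeasure P]

/-- At each finite time the subtrees of the children have N_a - 1 nodes in total. The limit may be
taken termwise because the expected terms are at most 1/(k+1)²: one factor is the initial relative
size, the other the probability of being a child of `a`. -/
theorem ae_hasSum_children_mass (hJ : IsRandomRecursiveTreeChain P J) (a : ℕ) :
    ∀ᵐ ω ∂P, HasSum (fun k => childInd a k (parentSeq J ω) * mass (parentSeq J ω) (k + 1))
      (mass (parentSeq J ω) a) := by
  have hsum : Summable fun k => risingRatio 1 (k + 2) 1 * ∫ ω, childInd a k (parentSeq J ω) ∂P := by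
    refine Summable.of_nonneg_of_le
      (fun k => mul_nonneg (risingRatio_nonneg _ _ _) (integral_childInd_nonneg a k))
      (fun k => ?_) (f := fun k : ℕ => 1 / ((k : ℝ) + 1) ^ 2) ?_
    · have h1 : risingRatio 1 (k + 2) 1 ≤ 1 / ((k : ℝ) + 1) := by
        rw [risingRatio_one]
        push_cast
        apply one_div_le_one_div_of_le (by positivity)
        linarith
      calc _ ≤ 1 / ((k : ℝ) + 1) * (1 / ((k : ℝ) + 1)) :=
            mul_le_mul h1 (integral_childInd_le hJ a k) (integral_childInd_nonneg a k)
              (by positivity)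
        _ = _ := by rw [div_mul_div_comm, one_mul, sq]
    · exact_mod_cast (summable_nat_add_iff 1).2 (Real.summable_one_div_nat_pow.2 one_lt_two)
  have h := ae_tendsto_sum_urn hJ (isUrnHarmonic_risingRatio 1)
    (fun n N _ => risingRatio_nonneg 1 n N) (fun n N h => risingRatio_le_one h) measurable_id
    (fun j a hj => tendsto_risingRatio_one a hj) (isLocal_childInd a) (childInd_nonneg a)
    (childInd_le_one a) hsum
  filter_upwards [h, ae_hasRegularLimits hJ] with ω hω hj
  set j := parentSeq J ω
  have h1 : Tendsto (fun n : ℕ => ((descCount j (n + 1) a : ℝ) - 1) / ((n + 1 : ℕ) : ℝ)) atTop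
      (𝓝 (mass j a)) := by
    have h2 := ((hj.tendsto a).sub tendsto_one_div_atTop_nhds_zero_nat)
    rw [sub_zero] at h2
    refine ((tendsto_add_atTop_iff_nat 1).2 h2).congr fun n => ?_
    rw [sub_div]
  have h3 : ∑' k, childInd a k j * id (mass j (k + 1)) = mass j a := by
    refine tendsto_nhds_unique hω.2 (h1.congr' ?_)
    filter_upwards [eventually_ge_atTop a] with n hn
    rw [← sum_children_descCount hn]
    push_cast
    rw [add_sub_cancel_right, Finset.sum_div]
    apply Finset.sum_congr rfl
    intro k _
    rw [risingRatio_one, childInd]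
    push_cast
    split_ifs <;> simp
  rw [← h3]
  exact hω.1.hasSum

theorem ae_tendsto_children_entropy (hJ : IsRandomRecursiveTreeChain P J) (a : ℕ) :
    ∀ᵐ ω ∂P, Summable (fun k => childInd a k (parentSeq J ω) *
        Real.negMulLog (mass (parentSeq J ω) (k + 1))) ∧
      Tendsto (fun n => ∑ k ∈ Finset.range n, childInd a k (parentSeq J ω) *
        entropyTerm (n + 1) (descCount (parentSeq J ω) (n + 1) (k + 1))) atTop
        (𝓝 (∑' k, childInd a k (parentSeq J ω) *
          Real.negMulLog (mass (parentSeq J ω) (k + 1)))) := by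
  -- The initial entropy is of order log k / k and the probability of being a child of `a` is at
  -- most 1/(k+1); bounding log x by 2 x^{1/2} leaves the summable exponent 3/2.
  have hsum : Summable fun k => entropyTerm (k + 2) 1 * ∫ ω, childInd a k (parentSeq J ω) ∂P := by
    refine Summable.of_nonneg_of_le
      (fun k => mul_nonneg (entropyTerm_nonneg (by omega)) (integral_childInd_nonneg a k))
      (fun k => ?_) (f := fun k : ℕ => 2 * (1 / (((k + 1 : ℕ) : ℝ) ^ (3 / 2 : ℝ)))) ?_
    · have hk : (0 : ℝ) < (k : ℝ) + 1 := by positivity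
      have h1 : entropyTerm (k + 2) 1 ≤ 2 * ((k : ℝ) + 1) ^ (-(1 / 2) : ℝ) := by
        have h2 : harm (k + 2) - harm 1 ≤ 2 * ((k : ℝ) + 2) ^ (1 / 2 : ℝ) := by
          have h3 := harm_le (k + 2)
          have h4 := Real.log_le_rpow_div (x := (k : ℝ) + 2) (by positivity)
            (show (0 : ℝ) < 1 / 2 by norm_num)
          push_cast at h3
          rw [harm_one]
          linarith
        have h5 : ((k : ℝ) + 2) ^ (1 / 2 : ℝ) / ((k : ℝ) + 2) = ((k : ℝ) + 2) ^ (-(1 / 2) : ℝ) := by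
          rw [← Real.rpow_sub_one (by positivity)]
          norm_num
        have h6 : ((k : ℝ) + 2) ^ (-(1 / 2) : ℝ) ≤ ((k : ℝ) + 1) ^ (-(1 / 2) : ℝ) :=
          Real.rpow_le_rpow_of_nonpos hk (by linarith) (by norm_num)
        calc entropyTerm (k + 2) 1 = 1 / ((k : ℝ) + 2) * (harm (k + 2) - harm 1) := by
              simp [entropyTerm]
          _ ≤ 1 / ((k : ℝ) + 2) * (2 * ((k : ℝ) + 2) ^ (1 / 2 : ℝ)) :=
              mul_le_mul_of_nonneg_left h2 (by positivity)
          _ = 2 * ((k : ℝ) + 2) ^ (-(1 / 2) : ℝ) := by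
              rw [← h5]
              ring
          _ ≤ _ := by linarith
      calc _ ≤ 2 * ((k : ℝ) + 1) ^ (-(1 / 2) : ℝ) * (1 / ((k : ℝ) + 1)) :=
            mul_le_mul h1 (integral_childInd_le hJ a k) (integral_childInd_nonneg a k)
              (by positivity)
        _ = _ := by
            push_cast
            have h2 : 1 / ((k : ℝ) + 1) = ((k : ℝ) + 1) ^ (-1 : ℝ) := by
              rw [Real.rpow_neg_one, one_div]
            rw [one_div (((k : ℝ) + 1) ^ (3 / 2 : ℝ)), ← Real.rpow_neg hk.le, h2, mul_assoc,
              ← Real.rpow_add hk]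
            norm_num
    · exact ((summable_nat_add_iff 1).2
        (Real.summable_one_div_nat_rpow.2 (by norm_num : (1 : ℝ) < 3 / 2))).mul_left 2
  exact ae_tendsto_sum_urn hJ isUrnHarmonic_entropyTerm (fun n N h => entropyTerm_nonneg h)
    (fun n N h => entropyTerm_le_one h) Real.continuous_negMulLog.measurable
    (fun j a hj => tendsto_entropyTerm (hj.pos a) (hj.tendsto a)) (isLocal_childInd a)
    (childInd_nonneg a) (childInd_le_one a) hsum

theorem ae_tendsto_sum_squares (hJ : IsRandomRecursiveTreeChain P J) :
    ∀ᵐ ω ∂P, Summable (fun k => mass (parentSeq J ω) (k + 1) ^ 2) ∧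
      Tendsto (fun n => ∑ k ∈ Finset.range n,
        risingRatio 2 (n + 1) (descCount (parentSeq J ω) (n + 1) (k + 1))) atTop
        (𝓝 (∑' k, mass (parentSeq J ω) (k + 1) ^ 2)) := by
  have hsum : Summable fun k : ℕ => risingRatio 2 (k + 2) 1 * ∫ _, (1 : ℝ) ∂P := by
    have h2 : Summable fun k : ℕ => (2 : ℝ) * (1 / ((k + 2 : ℕ) : ℝ) ^ 2) :=
      ((summable_nat_add_iff 2).2 (Real.summable_one_div_nat_pow.2 one_lt_two)).mul_left 2
    refine Summable.of_nonneg_of_le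
      (fun k => mul_nonneg (risingRatio_nonneg _ _ _) (integral_nonneg fun _ => zero_le_one))
      (fun k => ?_) h2
    have h1 := risingRatio_initial_le 2 (k + 1)
    simp only [integral_const, probReal_univ, smul_eq_mul, mul_one]
    refine h1.trans (le_of_eq ?_)
    push_cast
    simp [Nat.factorial]
    ring
  have h := ae_tendsto_sum_urn hJ (isUrnHarmonic_risingRatio 2)
    (fun n N _ => risingRatio_nonneg 2 n N) (fun n N h => risingRatio_le_one h)
    (φ := fun x => x ^ 2) (measurable_id.pow_const 2)
    (fun j a hj => tendsto_risingRatio_two a hj) (w := fun _ _ => 1)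
    (fun k => isLocal_const _ _) (fun _ _ => zero_le_one) (fun _ _ => le_rfl) hsum
  simpa only [one_mul] using h

end Chain

/-! ### The toll of a node -/

/-- The mean of the internal path length plus the number of nodes. -/
noncomputable def pathMean (n : ℕ) : ℝ := n * harm n

/-- The centred contribution of the node `a` to the internal path length of the tree with the nodes
`0, …, m`. -/
noncomputable def toll (j : ParentSeq) (m a : ℕ) : ℝ :=
  descCount j (m + 1) a + ∑ k ∈ Finset.range m, childInd a k j * pathMean (descCount j (m + 1) (k + 1))
    - pathMean (descCount j (m + 1) a)

/-- The terms that grow like H_n cancel up to H_n/n, because the subtree sizes of the children add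
up to N_a - 1. What remains has a limit. -/
theorem toll_div_eq {j : ParentSeq} {m a : ℕ} (h : a ≤ m) : toll j m a / ((m + 1 : ℕ) : ℝ) =
    (descCount j (m + 1) a : ℝ) / ((m + 1 : ℕ) : ℝ) - harm (m + 1) / ((m + 1 : ℕ) : ℝ) +
      entropyTerm (m + 1) (descCount j (m + 1) a) -
      ∑ k ∈ Finset.range m, childInd a k j * entropyTerm (m + 1) (descCount j (m + 1) (k + 1)) := by
  have h1 : ∀ N : ℕ, pathMean N / ((m + 1 : ℕ) : ℝ) =
      (N : ℝ) / ((m + 1 : ℕ) : ℝ) * harm (m + 1) - entropyTerm (m + 1) N := by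
    intro N
    unfold pathMean entropyTerm
    ring
  have h2 : ∑ k ∈ Finset.range m, childInd a k j * (descCount j (m + 1) (k + 1) : ℝ) =
      descCount j (m + 1) a - 1 := by
    rw [eq_sub_iff_add_eq, ← sum_children_descCount h]
    push_cast
    congr 1
    apply Finset.sum_congr rfl
    intro k _
    unfold childInd
    split_ifs <;> simp
  have h3 : (∑ k ∈ Finset.range m, childInd a k j * pathMean (descCount j (m + 1) (k + 1))) /
      ((m + 1 : ℕ) : ℝ) = ((descCount j (m + 1) a : ℝ) - 1) / ((m + 1 : ℕ) : ℝ) * harm (m + 1) -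
      ∑ k ∈ Finset.range m, childInd a k j *
        entropyTerm (m + 1) (descCount j (m + 1) (k + 1)) := by
    rw [← h2, Finset.sum_div, Finset.sum_div, Finset.sum_mul, ← Finset.sum_sub_distrib]
    apply Finset.sum_congr rfl
    intro k _
    rw [mul_div_assoc, h1]
    ring
  rw [toll, sub_div, add_div, h3, h1]
  ring

/-- The limit of the relative toll of the node `a`. -/
noncomputable def tollLimit (j : ParentSeq) (a : ℕ) : ℝ :=
  mass j a + Real.negMulLog (mass j a) - ∑' k, childInd a k j * Real.negMulLog (mass j (k + 1))

theorem ae_tendsto_toll {Ω : Type*} [MeasurableSpace Ω] {P : Measure Ω} [IsProbabilityMeasure P]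
    {J : (k : ℕ) → Ω → Fin (k + 1)} (hJ : IsRandomRecursiveTreeChain P J) :
    ∀ᵐ ω ∂P, ∀ a, Tendsto (fun m : ℕ => toll (parentSeq J ω) m a / ((m + 1 : ℕ) : ℝ)) atTop
      (𝓝 (tollLimit (parentSeq J ω) a)) := by
  filter_upwards [ae_all_iff.2 fun a => ae_tendsto_children_entropy hJ a, ae_hasRegularLimits hJ]
    with ω h1 hj a
  have h2 := (tendsto_add_atTop_iff_nat 1).2 (hj.tendsto a)
  have h3 := (tendsto_add_atTop_iff_nat 1).2 tendsto_harm_div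
  have h4 := (tendsto_add_atTop_iff_nat 1).2 (tendsto_entropyTerm (hj.pos a) (hj.tendsto a))
  have h5 := ((h2.sub h3).add h4).sub (h1 a).2
  rw [sub_zero] at h5
  refine h5.congr' ?_
  filter_upwards [eventually_ge_atTop a] with m hm
  rw [toll_div_eq hm]

/-! ### The centred path length as a martingale -/

theorem pathMean_succ (N : ℕ) : pathMean (N + 1) = pathMean N + harm N + 1 := by
  unfold pathMean
  rw [harm_succ]
  push_cast
  field_simp

theorem pathMean_one : pathMean 1 = 1 := by
  simp [pathMean, harm_one]

/-- The increment of the toll of the node `a` if the next node is a child of `i`. -/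
noncomputable def tollStep (j : ParentSeq) (m a i : ℕ) : ℝ :=
  (if nodeWord j a <+: nodeWord j i then -harm (descCount j (m + 1) a) else 0) +
  ∑ k ∈ Finset.range m, childInd a k j *
    (if nodeWord j (k + 1) <+: nodeWord j i then harm (descCount j (m + 1) (k + 1)) + 1 else 0) +
  (if i = a then 1 else 0)

theorem childInd_update {j : ParentSeq} {m k : ℕ} (a : ℕ) (h : k < m) (i : Fin (m + 1)) :
    childInd a k (Function.update j m i) = childInd a k j :=
  ((isLocal_childInd a k).mono h).update j i

/-- `pathMean` grows by H_N + 1 when N grows by one, so together with the growth of the size itself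
an affected node contributes -H_N. The last term of `tollStep` is the toll of a newborn child of
`a`, `pathMean 1 = 1`. -/
theorem toll_update {j : ParentSeq} {m a : ℕ} (h : a ≤ m) (i : Fin (m + 1)) :
    toll (Function.update j m i) (m + 1) a = toll j m a + tollStep j m a i := by
  have hlast : childInd a m (Function.update j m i) *
      pathMean (descCount (Function.update j m i) (m + 2) (m + 1)) = if (i : ℕ) = a then 1 else 0 := by
    rw [descCount_self_succ, pathMean_one, mul_one, childInd, Function.update_self]
  have hk : ∀ k ∈ Finset.range m, childInd a k (Function.update j m i) *
      pathMean (descCount (Function.update j m i) (m + 2) (k + 1)) =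
      childInd a k j * pathMean (descCount j (m + 1) (k + 1)) + childInd a k j *
      (if nodeWord j (k + 1) <+: nodeWord j i then harm (descCount j (m + 1) (k + 1)) + 1 else 0) := by
    intro k hk
    rw [Finset.mem_range] at hk
    rw [childInd_update a hk, descCount_update_succ (by omega)]
    split_ifs
    · rw [pathMean_succ]
      ring
    · rw [add_zero]
      ring
  unfold toll tollStep
  rw [Finset.sum_range_succ, hlast, Finset.sum_congr rfl hk, Finset.sum_add_distrib,
    descCount_update_succ h]
  by_cases h1 : nodeWord j a <+: nodeWord j i
  · rw [if_pos h1, if_pos h1, pathMean_succ]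
    push_cast
    ring
  · rw [if_neg h1, if_neg h1, add_zero]
    ring

theorem toll_self (j : ParentSeq) (m : ℕ) : toll j m m = 0 := by
  unfold toll
  rw [descCount_self_succ, pathMean_one, Finset.sum_eq_zero]
  · simp
  · intro k hk
    rw [Finset.mem_range] at hk
    have : ¬ (j k : ℕ) = m := by
      have := (j k).isLt
      omega
    simp [childInd, this]

theorem sum_childInd_descCount {j : ParentSeq} {m a : ℕ} (h : a ≤ m) :
    ∑ k ∈ Finset.range m, childInd a k j * (descCount j (m + 1) (k + 1) : ℝ) =
      descCount j (m + 1) a - 1 := by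
  rw [eq_sub_iff_add_eq, ← sum_children_descCount h]
  push_cast
  congr 1
  apply Finset.sum_congr rfl
  intro k _
  unfold childInd
  split_ifs <;> simp

/-- The choice of `n * harm n` as centring pays off here: the mean increment is the toll divided by
the number of nodes, which makes the toll divided by the number of nodes a martingale after the
birth of `a`. -/
theorem sum_tollStep {j : ParentSeq} {m a : ℕ} (h : a ≤ m) :
    ∑ i : Fin (m + 1), tollStep j m a i = toll j m a := by
  have h1 : ∑ i : Fin (m + 1), (if (i : ℕ) = a then (1 : ℝ) else 0) = 1 := by
    rw [Fin.sum_univ_eq_sum_range (fun i => if i = a then (1 : ℝ) else 0),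
      Finset.sum_ite_eq' (Finset.range (m + 1)) a, if_pos (Finset.mem_range.2 (by omega))]
  unfold tollStep
  rw [Finset.sum_add_distrib, Finset.sum_add_distrib, h1, sum_fin_prefix, Finset.sum_comm]
  simp only [← Finset.mul_sum, sum_fin_prefix]
  have h2 : ∀ k, childInd a k j * ((descCount j (m + 1) (k + 1) : ℝ) *
      (harm (descCount j (m + 1) (k + 1)) + 1) +
      (((m + 1 : ℕ) : ℝ) - descCount j (m + 1) (k + 1)) * 0) =
      childInd a k j * pathMean (descCount j (m + 1) (k + 1)) +
        childInd a k j * (descCount j (m + 1) (k + 1) : ℝ) := by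
    intro k
    unfold pathMean
    ring
  simp only [h2]
  rw [Finset.sum_add_distrib, sum_childInd_descCount h, toll]
  unfold pathMean
  ring

/-- Only the ancestors of `i` matter. Each contributes at most H once through its own subtree and at
most H + 1 once as a child of its direct ancestor, and the new leaf contributes 1; this is the
factor 3. -/
theorem sum_abs_tollStep_le (j : ParentSeq) (m i : ℕ) :
    ∑ a ∈ Finset.range (m + 1), |tollStep j m a i| ≤
      3 * (harm (m + 1) + 1) * ((nodeWord j i).length + 1) := by
  have hH : ∀ b, harm (descCount j (m + 1) b) ≤ harm (m + 1) := fun b => harm_mono (descCount_le _ _ _)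
  have hanc : ∑ a ∈ Finset.range (m + 1), (if nodeWord j a <+: nodeWord j i then (1 : ℝ) else 0) ≤
      (nodeWord j i).length + 1 := by
    rw [Finset.sum_boole]
    exact_mod_cast card_ancestors_le j (m + 1) i
  have hanc' : ∑ k ∈ Finset.range m, (if nodeWord j (k + 1) <+: nodeWord j i then (1 : ℝ) else 0) ≤
      (nodeWord j i).length + 1 := by
    refine le_trans ?_ hanc
    rw [Finset.sum_range_succ' _ m]
    apply le_add_of_nonneg_right
    split_ifs <;> norm_num
  have hstep : ∀ a, |tollStep j m a i| ≤
      harm (m + 1) * (if nodeWord j a <+: nodeWord j i then 1 else 0) +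
      ∑ k ∈ Finset.range m, childInd a k j *
        ((harm (m + 1) + 1) * if nodeWord j (k + 1) <+: nodeWord j i then 1 else 0) +
      (if i = a then 1 else 0) := by
    intro a
    unfold tollStep
    refine (abs_add_three _ _ _).trans (add_le_add_three ?_ ?_ ?_)
    · split_ifs
      · rw [abs_neg, abs_of_nonneg (harm_nonneg _), mul_one]
        exact hH a
      · simp
    · refine (Finset.abs_sum_le_sum_abs _ _).trans (Finset.sum_le_sum fun k _ => ?_)
      rw [abs_mul, abs_of_nonneg (childInd_nonneg _ _ _)]
      refine mul_le_mul_of_nonneg_left ?_ (childInd_nonneg _ _ _)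
      split_ifs
      · rw [abs_of_nonneg (by have := harm_nonneg (descCount j (m + 1) (k + 1)); linarith), mul_one]
        linarith [hH (k + 1)]
      · simp
    · split_ifs <;> simp
  have hchild : ∀ k, ∑ a ∈ Finset.range (m + 1), childInd a k j ≤ 1 := by
    intro k
    unfold childInd
    rw [Finset.sum_ite_eq]
    split_ifs <;> norm_num
  have hroot : ∑ a ∈ Finset.range (m + 1), (if i = a then (1 : ℝ) else 0) ≤ 1 := by
    rw [Finset.sum_ite_eq]
    split_ifs <;> norm_num
  have hH0 := harm_nonneg (m + 1)
  have hl : (0 : ℝ) ≤ (nodeWord j i).length := Nat.cast_nonneg _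
  refine (Finset.sum_le_sum fun a _ => hstep a).trans ?_
  rw [Finset.sum_add_distrib, Finset.sum_add_distrib, ← Finset.mul_sum, Finset.sum_comm]
  simp only [← Finset.sum_mul]
  have h2 : ∑ k ∈ Finset.range m, (∑ a ∈ Finset.range (m + 1), childInd a k j) *
      ((harm (m + 1) + 1) * if nodeWord j (k + 1) <+: nodeWord j i then 1 else 0) ≤
      (harm (m + 1) + 1) * ((nodeWord j i).length + 1) := by
    calc _ ≤ ∑ k ∈ Finset.range m, 1 *
          ((harm (m + 1) + 1) * if nodeWord j (k + 1) <+: nodeWord j i then 1 else 0) := by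
          refine Finset.sum_le_sum fun k _ => mul_le_mul_of_nonneg_right (hchild k) ?_
          split_ifs <;> simp
          linarith
      _ ≤ _ := by
          simp only [one_mul, ← Finset.mul_sum]
          exact mul_le_mul_of_nonneg_left hanc' (by linarith)
  have h3 := mul_le_mul_of_nonneg_left hanc hH0
  nlinarith

/-- The centred internal path length, restricted by a weight on the words. -/
noncomputable def tollSum (σ : List ℕ+ → ℝ) (m : ℕ) (j : ParentSeq) : ℝ :=
  (∑ a ∈ Finset.range (m + 1), σ (nodeWord j a) * toll j m a) / ((m : ℝ) + 1)

/-- The increment of the unnormalized weighted toll sum if the next node is a child of `i`. -/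
noncomputable def tollSumStep (σ : List ℕ+ → ℝ) (m : ℕ) (j : ParentSeq) (i : ℕ) : ℝ :=
  ∑ a ∈ Finset.range (m + 1), σ (nodeWord j a) * tollStep j m a i

theorem isLocal_toll (m a : ℕ) : IsLocal m (fun j => toll j m a) := by
  intro j j' h
  have h1 : ∀ b, descCount j (m + 1) b = descCount j' (m + 1) b := fun b => descCount_congr h
  simp only [toll, h1]
  congr 2
  apply Finset.sum_congr rfl
  intro k hk
  rw [((isLocal_childInd a k).mono (Finset.mem_range.1 hk)) j j' h]

theorem isLocal_tollSum (σ : List ℕ+ → ℝ) (m : ℕ) : IsLocal m (tollSum σ m) := by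
  intro j j' h
  unfold tollSum
  congr 1
  apply Finset.sum_congr rfl
  intro a ha
  have h1 := isLocal_toll m a j j' h
  simp only at h1
  have h2 := isLocal_nodeWord (Nat.le_of_lt_succ (Finset.mem_range.1 ha)) j j' h
  simp only at h2
  rw [h1, h2]

theorem tollSum_update (σ : List ℕ+ → ℝ) (m : ℕ) (j : ParentSeq) (i : Fin (m + 1)) :
    tollSum σ (m + 1) (Function.update j m i) =
      tollSum σ m j + (tollSumStep σ m j i - tollSum σ m j) / ((m : ℝ) + 2) := by
  have h1 : ∑ a ∈ Finset.range (m + 2), σ (nodeWord (Function.update j m i) a) *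
      toll (Function.update j m i) (m + 1) a =
      ∑ a ∈ Finset.range (m + 1), σ (nodeWord j a) * toll j m a + tollSumStep σ m j i := by
    rw [Finset.sum_range_succ, toll_self, mul_zero, add_zero, tollSumStep,
      ← Finset.sum_add_distrib]
    apply Finset.sum_congr rfl
    intro a ha
    have ha' := Nat.le_of_lt_succ (Finset.mem_range.1 ha)
    rw [nodeWord_update ha', toll_update ha']
    ring
  unfold tollSum
  rw [h1]
  push_cast
  field_simp
  ring

theorem sum_tollSumStep (σ : List ℕ+ → ℝ) (m : ℕ) (j : ParentSeq) :
    ∑ i : Fin (m + 1), tollSumStep σ m j i = ((m : ℝ) + 1) * tollSum σ m j := by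
  unfold tollSumStep tollSum
  rw [Finset.sum_comm, mul_div_cancel₀ _ (by positivity)]
  apply Finset.sum_congr rfl
  intro a ha
  rw [← Finset.mul_sum, sum_tollStep (Nat.le_of_lt_succ (Finset.mem_range.1 ha))]

/-- The mean of the step over `i` equals the current value, so the increments in `tollSum_update`
are centred. -/
theorem tollSum_average (σ : List ℕ+ → ℝ) (m : ℕ) (j : ParentSeq) :
    (∑ i : Fin (m + 1), tollSum σ (m + 1) (Function.update j m i)) / ((m : ℝ) + 1) =
      tollSum σ m j := by
  simp only [tollSum_update, Finset.sum_add_distrib, ← Finset.sum_div, Finset.sum_sub_distrib,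
    sum_tollSumStep]
  simp
  field_simp

theorem abs_tollSumStep_le {σ : List ℕ+ → ℝ} (hσ : ∀ u, |σ u| ≤ 1) (m : ℕ) (j : ParentSeq) (i : ℕ) :
    |tollSumStep σ m j i| ≤ 3 * (harm (m + 1) + 1) * ((nodeWord j i).length + 1) := by
  refine le_trans ?_ (sum_abs_tollStep_le j m i)
  refine (Finset.abs_sum_le_sum_abs _ _).trans (Finset.sum_le_sum fun a _ => ?_)
  rw [abs_mul]
  exact mul_le_of_le_one_left (abs_nonneg _) (hσ _)

theorem martingale_tollSum {Ω : Type*} [MeasurableSpace Ω] {P : Measure Ω} [IsProbabilityMeasure P]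
    {J : (k : ℕ) → Ω → Fin (k + 1)} (hJ : IsRandomRecursiveTreeChain P J) (σ : List ℕ+ → ℝ) :
    Martingale (fun m ω => tollSum σ m (parentSeq J ω)) (history hJ) P :=
  martingale_of_average hJ (isLocal_tollSum σ) (tollSum_average σ)

/-- Telescoping along the tree: `pathMean` of every node but the root enters once with each sign. -/
theorem sum_toll (j : ParentSeq) (m : ℕ) : ∑ a ∈ Finset.range (m + 1), toll j m a =
    ∑ a ∈ Finset.range (m + 1), (descCount j (m + 1) a : ℝ) - pathMean (m + 1) := by
  unfold toll
  rw [Finset.sum_sub_distrib, Finset.sum_add_distrib, Finset.sum_comm,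
    Finset.sum_range_succ' (fun a => pathMean (descCount j (m + 1) a)), descCount_zero_right]
  have h1 : ∀ k ∈ Finset.range m, ∑ a ∈ Finset.range (m + 1),
      childInd a k j * pathMean (descCount j (m + 1) (k + 1)) =
      pathMean (descCount j (m + 1) (k + 1)) := by
    intro k hk
    rw [Finset.mem_range] at hk
    rw [← Finset.sum_mul]
    unfold childInd
    rw [Finset.sum_ite_eq, if_pos (Finset.mem_range.2 (by have := (j k).isLt; omega)), one_mul]
  rw [Finset.sum_congr rfl h1]
  ring

theorem tollSum_one (j : ParentSeq) (m : ℕ) : tollSum (fun _ => 1) m j =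
    ∑ a ∈ Finset.range (m + 1), (descCount j (m + 1) a : ℝ) / ((m + 1 : ℕ) : ℝ) - harm (m + 1) := by
  unfold tollSum
  simp only [one_mul]
  rw [sum_toll, sub_div, Finset.sum_div, pathMean]
  push_cast
  rw [mul_div_cancel_left₀ _ (by positivity)]

theorem letterSum_nodeWord_le (j : ParentSeq) (m : ℕ) : letterSum (nodeWord j m) ≤ m := by
  induction m using Nat.strong_induction_on with
  | _ m ih =>
    rcases m with _ | m
    · simp [nodeWord_zero, letterSum]
    · have h1 := ih (j m) (j m).isLt
      -- Siblings are born after their direct ancestor `j m`, so the earlier ones have indices in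
      -- `[j m, m)`.
      have h2 : ((Finset.range m).filter (fun i => (j i : ℕ) = (j m : ℕ))).card ≤ m - j m := by
        rw [← Nat.card_Ico]
        apply Finset.card_le_card
        intro i hi
        rw [Finset.mem_filter, Finset.mem_range] at hi
        rw [Finset.mem_Ico]
        have := (j i).isLt
        omega
      have h3 := (j m).isLt
      rw [nodeWord_succ]
      unfold letterSum at h1 ⊢
      rw [List.map_append, List.sum_append, List.map_singleton, List.sum_singleton,
        Nat.succPNat_coe]
      omega

/-- Up to time `k` no word with letter sum above `k` has appeared, so a weight that ignores the
small words starts from 0. -/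
theorem tollSum_eq_zero {σ : List ℕ+ → ℝ} {k m : ℕ} (hσ : ∀ u, letterSum u ≤ k → σ u = 0)
    (hm : m ≤ k) (j : ParentSeq) : tollSum σ m j = 0 := by
  unfold tollSum
  rw [Finset.sum_eq_zero, zero_div]
  intro a ha
  rw [hσ, zero_mul]
  have := letterSum_nodeWord_le j a
  have := Finset.mem_range.1 ha
  omega

/-! ### Moments of the centred path length -/

theorem abs_add_pow_sub_le (q d : ℝ) (n : ℕ) :
    |(q + d) ^ (n + 2) - q ^ (n + 2) - ((n : ℝ) + 2) * q ^ (n + 1) * d| ≤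
      ((n : ℝ) + 2) ^ 2 * (d ^ 2 * (|q| + |d|) ^ n) := by
  induction n with
  | zero =>
    have h1 : (q + d) ^ (0 + 2) - q ^ (0 + 2) - (((0 : ℕ) : ℝ) + 2) * q ^ (0 + 1) * d = d ^ 2 := by
      push_cast
      ring
    rw [h1, abs_of_nonneg (sq_nonneg d)]
    push_cast
    nlinarith [sq_nonneg d]
  | succ n ih =>
    set R := (q + d) ^ (n + 2) - q ^ (n + 2) - ((n : ℝ) + 2) * q ^ (n + 1) * d with hR
    have h1 : (q + d) ^ (n + 1 + 2) - q ^ (n + 1 + 2) -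
        (((n + 1 : ℕ) : ℝ) + 2) * q ^ (n + 1 + 1) * d =
        (q + d) * R + ((n : ℝ) + 2) * q ^ (n + 1) * d ^ 2 := by
      rw [hR]
      push_cast
      ring
    have hs : 0 ≤ |q| + |d| := by positivity
    have h2 : |(q + d) * R| ≤ (|q| + |d|) * (((n : ℝ) + 2) ^ 2 * (d ^ 2 * (|q| + |d|) ^ n)) := by
      rw [abs_mul]
      exact mul_le_mul (abs_add_le _ _) ih (abs_nonneg _) hs
    have h3 : |((n : ℝ) + 2) * q ^ (n + 1) * d ^ 2| ≤
        ((n : ℝ) + 2) * (|q| + |d|) ^ (n + 1) * d ^ 2 := by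
      rw [abs_mul, abs_mul, abs_pow, abs_of_nonneg (sq_nonneg d),
        abs_of_nonneg (by positivity : (0 : ℝ) ≤ (n : ℝ) + 2)]
      gcongr
      linarith [abs_nonneg d]
    rw [h1]
    refine (abs_add_le _ _).trans ((add_le_add h2 h3).trans ?_)
    have h4 : 0 ≤ d ^ 2 * (|q| + |d|) ^ (n + 1) := by positivity
    have h5 : (|q| + |d|) * (((n : ℝ) + 2) ^ 2 * (d ^ 2 * (|q| + |d|) ^ n)) +
        ((n : ℝ) + 2) * (|q| + |d|) ^ (n + 1) * d ^ 2 =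
        (((n : ℝ) + 2) ^ 2 + ((n : ℝ) + 2)) * (d ^ 2 * (|q| + |d|) ^ (n + 1)) := by ring
    rw [h5]
    push_cast
    have h6 : (0 : ℝ) ≤ n := n.cast_nonneg
    exact mul_le_mul_of_nonneg_right (by nlinarith) h4

/-- Second-order Taylor bound arranged for small steps: the remainder keeps the full factor η²,
while `e` enters only through its power of order `n + 2`, whose mean can be controlled. -/
theorem add_mul_pow_le {q e η : ℝ} (hη0 : 0 ≤ η) (hη1 : η ≤ 1) {n : ℕ} (hn : Even n) :
    (q + η * e) ^ (n + 2) ≤ q ^ (n + 2) + ((n : ℝ) + 2) * q ^ (n + 1) * (η * e) +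
      ((n : ℝ) + 2) ^ 2 * 2 ^ (n + 1) * η ^ 2 * (q ^ (n + 2) + e ^ (n + 2)) := by
  have h1 := (abs_le.1 (abs_add_pow_sub_le q (η * e) n)).2
  have he : |η * e| ≤ |e| := by
    rw [abs_mul, abs_of_nonneg hη0]
    exact mul_le_of_le_one_left (abs_nonneg _) hη1
  have hev : Even (n + 2) := hn.add even_two
  have h2 : (η * e) ^ 2 * (|q| + |η * e|) ^ n ≤
      2 ^ (n + 1) * η ^ 2 * (q ^ (n + 2) + e ^ (n + 2)) := by
    calc (η * e) ^ 2 * (|q| + |η * e|) ^ n = η ^ 2 * (|e| ^ 2 * (|q| + |η * e|) ^ n) := by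
          rw [sq_abs]
          ring
      _ ≤ η ^ 2 * ((|q| + |e|) ^ 2 * (|q| + |e|) ^ n) := by
          gcongr
          linarith [abs_nonneg q]
      _ = η ^ 2 * (|q| + |e|) ^ (n + 2) := by ring
      _ ≤ η ^ 2 * (2 ^ (n + 2 - 1) * (|q| ^ (n + 2) + |e| ^ (n + 2))) := by
          gcongr
          exact add_pow_le (abs_nonneg _) (abs_nonneg _) _
      _ = _ := by
          rw [hev.pow_abs, hev.pow_abs]
          simp only [Nat.add_succ_sub_one]
          ring
  have h3 := mul_le_mul_of_nonneg_left h2 (by positivity : (0 : ℝ) ≤ ((n : ℝ) + 2) ^ 2)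
  linarith

theorem exists_pow_le_geometric (p : ℕ) :
    ∃ K : ℝ, 0 ≤ K ∧ ∀ l : ℕ, ((l : ℝ) + 1) ^ p ≤ K * (5 / 4 : ℝ) ^ l := by
  have h := tendsto_pow_const_mul_const_pow_of_abs_lt_one p
    (show |(4 / 5 : ℝ)| < 1 by rw [abs_of_pos] <;> norm_num)
  obtain ⟨B, hB⟩ := h.bddAbove_range
  have hB' : ∀ l : ℕ, (l : ℝ) ^ p * (4 / 5 : ℝ) ^ l ≤ B := fun l => hB ⟨l, rfl⟩
  refine ⟨B * (5 / 4), mul_nonneg (le_trans (by positivity) (hB' 1)) (by norm_num), fun l => ?_⟩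
  have h1 := hB' (l + 1)
  have h2 : (4 / 5 : ℝ) ^ (l + 1) * (5 / 4) ^ (l + 1) = 1 := by
    rw [← mul_pow]
    norm_num
  calc ((l : ℝ) + 1) ^ p = ((l + 1 : ℕ) : ℝ) ^ p * (4 / 5 : ℝ) ^ (l + 1) * (5 / 4) ^ (l + 1) := by
        rw [mul_assoc, h2]
        push_cast
        ring
    _ ≤ B * (5 / 4) ^ (l + 1) := mul_le_mul_of_nonneg_right h1 (by positivity)
    _ = _ := by ring

theorem exists_harm_pow_le {p : ℕ} (hp : p ≠ 0) :
    ∃ K : ℝ, 0 ≤ K ∧ ∀ m : ℕ, (3 * (harm (m + 1) + 1)) ^ p ≤ K * ((m : ℝ) + 2) ^ (1 / 4 : ℝ) := by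
  have hp' : (0 : ℝ) < p := by exact_mod_cast Nat.pos_of_ne_zero hp
  refine ⟨(3 * (2 + 4 * (p : ℝ))) ^ p, by positivity, fun m => ?_⟩
  have hx : (0 : ℝ) < (m : ℝ) + 2 := by positivity
  set ε : ℝ := 1 / (4 * p) with hε
  have hε0 : 0 < ε := by positivity
  have h1 : harm (m + 1) ≤ 1 + Real.log ((m : ℝ) + 2) := by
    refine (harm_le _).trans ?_
    push_cast
    have := Real.log_le_log (by positivity : (0 : ℝ) < (m : ℝ) + 1)
      (by linarith : (m : ℝ) + 1 ≤ (m : ℝ) + 2)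
    linarith
  have h2 : Real.log ((m : ℝ) + 2) ≤ 4 * p * ((m : ℝ) + 2) ^ ε := by
    refine (Real.log_le_rpow_div hx.le hε0).trans (le_of_eq ?_)
    rw [hε, div_div_eq_mul_div, div_one]
    ring
  have h3 : 1 ≤ ((m : ℝ) + 2) ^ ε := Real.one_le_rpow (by linarith [(m.cast_nonneg : (0 : ℝ) ≤ m)]) hε0.le
  have h4 : 3 * (harm (m + 1) + 1) ≤ 3 * (2 + 4 * (p : ℝ)) * ((m : ℝ) + 2) ^ ε := by nlinarith
  calc (3 * (harm (m + 1) + 1)) ^ p ≤ (3 * (2 + 4 * (p : ℝ)) * ((m : ℝ) + 2) ^ ε) ^ p := by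
        apply pow_le_pow_left₀ _ h4
        have := harm_nonneg (m + 1)
        linarith
    _ = _ := by
        rw [mul_pow, ← Real.rpow_mul_natCast hx.le]
        congr 2
        rw [hε]
        field_simp

section Chain

variable {Ω : Type*} [mΩ : MeasurableSpace Ω] {P : Measure Ω} [IsProbabilityMeasure P]
  {J : (k : ℕ) → Ω → Fin (k + 1)}

/-- The generating function of the depth profile. -/
noncomputable def profile (m : ℕ) (j : ParentSeq) : ℝ :=
  ∑ a ∈ Finset.range (m + 1), (5 / 4 : ℝ) ^ (nodeWord j a).length

theorem isLocal_profile (m : ℕ) : IsLocal m (profile m) := by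
  intro j j' h
  unfold profile
  apply Finset.sum_congr rfl
  intro a ha
  have h2 := isLocal_nodeWord (Nat.le_of_lt_succ (Finset.mem_range.1 ha)) j j' h
  simp only at h2
  rw [h2]

/-- A child of `i` adds 5/4 times the term of `i`, so the mean is multiplied by 1 + (5/4)/(m+1),
which Bernoulli's inequality bounds by (1 + 1/(m+1))^{5/4}. The base 5/4 is chosen so that the
average over the nodes grows only like m^{1/4}. -/
theorem integral_profile_le (hJ : IsRandomRecursiveTreeChain P J) (m : ℕ) :
    ∫ ω, profile m (parentSeq J ω) ∂P ≤ ((m : ℝ) + 1) ^ (5 / 4 : ℝ) := by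
  induction m with
  | zero => simp [profile, nodeWord_zero]
  | succ m ih =>
    have hm : (0 : ℝ) < (m : ℝ) + 1 := by positivity
    have h1 : ∀ j, (∑ i : Fin (m + 1), profile (m + 1) (Function.update j m i)) / ((m : ℝ) + 1) =
        (1 + 5 / 4 * (1 / ((m : ℝ) + 1))) * profile m j := by
      intro j
      have h2 : ∀ i : Fin (m + 1), profile (m + 1) (Function.update j m i) =
          profile m j + 5 / 4 * (5 / 4 : ℝ) ^ (nodeWord j i).length := by
        intro i
        have h3 : profile (m + 1) (Function.update j m i) = profile m (Function.update j m i) +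
            (5 / 4 : ℝ) ^ (nodeWord (Function.update j m i) (m + 1)).length :=
          Finset.sum_range_succ _ _
        rw [h3, (isLocal_profile m).update, nodeWord_succ, List.length_append, Function.update_self,
          nodeWord_update (Nat.le_of_lt_succ i.isLt), List.length_singleton, pow_succ]
        ring
      simp only [h2, Finset.sum_add_distrib, ← Finset.mul_sum]
      rw [Fin.sum_univ_eq_sum_range (fun i => (5 / 4 : ℝ) ^ (nodeWord j i).length), ← profile]
      simp
      field_simp
    rw [integral_next hJ (isLocal_profile (m + 1))]
    simp only [h1]
    rw [integral_const_mul]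
    have h4 := one_add_mul_self_le_rpow_one_add
      (show (-1 : ℝ) ≤ 1 / ((m : ℝ) + 1) by linarith [show (0 : ℝ) < 1 / ((m : ℝ) + 1) by positivity])
      (show (1 : ℝ) ≤ 5 / 4 by norm_num)
    calc _ ≤ (1 + 1 / ((m : ℝ) + 1)) ^ (5 / 4 : ℝ) * ((m : ℝ) + 1) ^ (5 / 4 : ℝ) := by
          apply mul_le_mul h4 ih
          · exact integral_nonneg fun ω => Finset.sum_nonneg fun a _ => by positivity
          · positivity
      _ = _ := by
          rw [← Real.mul_rpow (by positivity) (by positivity)]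
          congr 1
          push_cast
          field_simp

theorem average_tollSum_pow_le (σ : List ℕ+ → ℝ) (j : ParentSeq) (m : ℕ) {n : ℕ} (hn : Even n)
    {s : ℝ} (hs1 : 1 ≤ s) (hs : s ^ 4 = (m : ℝ) + 2) :
    (∑ i : Fin (m + 1), tollSum σ (m + 1) (Function.update j m i) ^ (n + 2)) / ((m : ℝ) + 1) ≤
      tollSum σ m j ^ (n + 2) + ((n : ℝ) + 2) ^ 2 * 2 ^ (n + 1) * (s ^ 6)⁻¹ *
        ((1 + 2 ^ (n + 1)) * tollSum σ m j ^ (n + 2) + 2 ^ (n + 1) *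
          ((∑ i : Fin (m + 1), tollSumStep σ m j i ^ (n + 2)) / s ^ 2 / ((m : ℝ) + 1))) := by
  have hs0 : 0 < s := by linarith
  have hev : Even (n + 2) := hn.add even_two
  set q := tollSum σ m j with hq
  set D : ℝ := ((n : ℝ) + 2) ^ 2 * 2 ^ (n + 1) with hD
  have hD0 : 0 ≤ D := by positivity
  have hη0 : 0 ≤ (s ^ 3)⁻¹ := by positivity
  have hη1 : (s ^ 3)⁻¹ ≤ 1 := inv_le_one_of_one_le₀ (one_le_pow₀ hs1)
  have hterm : ∀ i : Fin (m + 1), tollSum σ (m + 1) (Function.update j m i) ^ (n + 2) ≤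
      q ^ (n + 2) + ((n : ℝ) + 2) * q ^ (n + 1) * ((tollSumStep σ m j i - q) / ((m : ℝ) + 2)) +
      D * (s ^ 6)⁻¹ * ((1 + 2 ^ (n + 1)) * q ^ (n + 2) + 2 ^ (n + 1) *
        (tollSumStep σ m j i ^ (n + 2) / s ^ 2)) := by
    intro i
    set X := tollSumStep σ m j i
    -- The step size 1/(m+2) = s⁻⁴ is split as s⁻³ · s⁻¹. Then η² = s⁻⁶ = (m+2)^{-3/2} is summable,
    -- and the factor 1/s left in `e` compensates the growth s² of the mean of X^{n+2}.
    have h1 : (X - q) / ((m : ℝ) + 2) = (s ^ 3)⁻¹ * ((X - q) / s) := by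
      rw [← hs]
      field_simp
    have h2 := add_mul_pow_le (q := q) (e := (X - q) / s) hη0 hη1 hn
    rw [← hD, ← h1] at h2
    rw [tollSum_update]
    refine h2.trans ?_
    have h3 : ((X - q) / s) ^ (n + 2) ≤ 2 ^ (n + 1) * (X ^ (n + 2) / s ^ 2 + q ^ (n + 2)) := by
      have h4 : (X - q) ^ (n + 2) ≤ 2 ^ (n + 1) * (X ^ (n + 2) + q ^ (n + 2)) := by
        calc (X - q) ^ (n + 2) = |X - q| ^ (n + 2) := (hev.pow_abs _).symm
          _ ≤ (|X| + |q|) ^ (n + 2) := pow_le_pow_left₀ (abs_nonneg _) (abs_sub _ _) _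
          _ ≤ 2 ^ (n + 2 - 1) * (|X| ^ (n + 2) + |q| ^ (n + 2)) :=
              add_pow_le (abs_nonneg _) (abs_nonneg _) _
          _ = _ := by rw [hev.pow_abs, hev.pow_abs]; rfl
      have h5 : s ^ 2 ≤ s ^ (n + 2) := pow_le_pow_right₀ hs1 (by omega)
      have h6 : 0 ≤ X ^ (n + 2) := hev.pow_nonneg _
      have h7 : 0 ≤ q ^ (n + 2) := hev.pow_nonneg _
      rw [div_pow]
      calc (X - q) ^ (n + 2) / s ^ (n + 2) ≤
            2 ^ (n + 1) * (X ^ (n + 2) + q ^ (n + 2)) / s ^ 2 := by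
            apply div_le_div₀ (by positivity) h4 (by positivity) h5
        _ = 2 ^ (n + 1) * (X ^ (n + 2) / s ^ 2 + q ^ (n + 2) / s ^ 2) := by ring
        _ ≤ _ := by
            gcongr
            exact div_le_self h7 (one_le_pow₀ hs1)
    have h8 : ((s ^ 3)⁻¹) ^ 2 = (s ^ 6)⁻¹ := by
      rw [inv_pow, ← pow_mul]
    rw [h8]
    have h9 := mul_le_mul_of_nonneg_left h3 (by positivity : 0 ≤ D * (s ^ 6)⁻¹)
    linarith
  have hm : (0 : ℝ) < (m : ℝ) + 1 := by positivity
  rw [div_le_iff₀ hm]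
  refine (Finset.sum_le_sum fun i _ => hterm i).trans (le_of_eq ?_)
  have h0 : ∑ i : Fin (m + 1), (tollSumStep σ m j i - q) / ((m : ℝ) + 2) = 0 := by
    rw [← Finset.sum_div, Finset.sum_sub_distrib, sum_tollSumStep, ← hq]
    simp
  rw [Finset.sum_add_distrib, Finset.sum_add_distrib, ← Finset.mul_sum, h0, ← Finset.mul_sum,
    Finset.sum_add_distrib]
  simp only [← Finset.mul_sum, ← Finset.sum_div, Finset.sum_const, Finset.card_univ, Fintype.card_fin, nsmul_eq_mul]
  push_cast
  field_simp
  ring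

/-- The powers of the harmonic number and of the depth each cost an exponent 1/4, which together
give 1/2. -/
theorem integral_tollSumStep_pow_le (hJ : IsRandomRecursiveTreeChain P J) {p : ℕ} (hp : Even p)
    (hp0 : p ≠ 0) : ∃ K : ℝ, 0 ≤ K ∧ ∀ σ : List ℕ+ → ℝ, (∀ u, |σ u| ≤ 1) → ∀ m : ℕ,
      ∫ ω, (∑ i : Fin (m + 1), tollSumStep σ m (parentSeq J ω) i ^ p) / ((m : ℝ) + 1) ∂P ≤
        K * ((m : ℝ) + 2) ^ (1 / 2 : ℝ) := by
  obtain ⟨K₁, hK₁, h1⟩ := exists_pow_le_geometric p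
  obtain ⟨K₂, hK₂, h2⟩ := exists_harm_pow_le hp0
  refine ⟨K₂ * K₁, by positivity, fun σ hσ m => ?_⟩
  have hm : (0 : ℝ) < (m : ℝ) + 1 := by positivity
  have h3 : ∀ j, (∑ i : Fin (m + 1), tollSumStep σ m j i ^ p) / ((m : ℝ) + 1) ≤
      K₂ * ((m : ℝ) + 2) ^ (1 / 4 : ℝ) * K₁ / ((m : ℝ) + 1) * profile m j := by
    intro j
    have h4 : ∀ i : Fin (m + 1), tollSumStep σ m j i ^ p ≤
        K₂ * ((m : ℝ) + 2) ^ (1 / 4 : ℝ) * K₁ * (5 / 4 : ℝ) ^ (nodeWord j i).length := by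
      intro i
      calc tollSumStep σ m j i ^ p = |tollSumStep σ m j i| ^ p := (hp.pow_abs _).symm
        _ ≤ (3 * (harm (m + 1) + 1) * ((nodeWord j i).length + 1)) ^ p :=
            pow_le_pow_left₀ (abs_nonneg _) (abs_tollSumStep_le hσ m j i) _
        _ = (3 * (harm (m + 1) + 1)) ^ p * (((nodeWord j i).length : ℝ) + 1) ^ p := mul_pow _ _ _
        _ ≤ (K₂ * ((m : ℝ) + 2) ^ (1 / 4 : ℝ)) * (K₁ * (5 / 4 : ℝ) ^ (nodeWord j i).length) :=
            mul_le_mul (h2 m) (h1 _) (by positivity) (by positivity)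
        _ = _ := by ring
    rw [div_mul_eq_mul_div]
    apply div_le_div_of_nonneg_right _ hm.le
    refine (Finset.sum_le_sum fun i _ => h4 i).trans (le_of_eq ?_)
    rw [← Finset.mul_sum, Fin.sum_univ_eq_sum_range (fun i => (5 / 4 : ℝ) ^ (nodeWord j i).length)]
    rfl
  have hint := ((isLocal_profile m).integrable hJ).const_mul
    (K₂ * ((m : ℝ) + 2) ^ (1 / 4 : ℝ) * K₁ / ((m : ℝ) + 1))
  calc _ ≤ ∫ ω, K₂ * ((m : ℝ) + 2) ^ (1 / 4 : ℝ) * K₁ / ((m : ℝ) + 1) *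
          profile m (parentSeq J ω) ∂P :=
        integral_mono_of_nonneg (Eventually.of_forall fun ω => div_nonneg
          (Finset.sum_nonneg fun i _ => hp.pow_nonneg _) hm.le) hint
          (Eventually.of_forall fun ω => h3 _)
    _ ≤ K₂ * ((m : ℝ) + 2) ^ (1 / 4 : ℝ) * K₁ / ((m : ℝ) + 1) * ((m : ℝ) + 1) ^ (5 / 4 : ℝ) := by
        rw [integral_const_mul]
        exact mul_le_mul_of_nonneg_left (integral_profile_le hJ m) (by positivity)
    _ = K₂ * K₁ * (((m : ℝ) + 2) ^ (1 / 4 : ℝ) * ((m : ℝ) + 1) ^ (1 / 4 : ℝ)) := by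
        have h5 : ((m : ℝ) + 1) ^ (5 / 4 : ℝ) = ((m : ℝ) + 1) ^ (1 / 4 : ℝ) * ((m : ℝ) + 1) := by
          rw [← Real.rpow_add_one hm.ne']
          norm_num
        rw [h5]
        field_simp
    _ ≤ K₂ * K₁ * (((m : ℝ) + 2) ^ (1 / 4 : ℝ) * ((m : ℝ) + 2) ^ (1 / 4 : ℝ)) := by
        gcongr
        norm_num
    _ = _ := by
        rw [← Real.rpow_add (by positivity)]
        norm_num

theorem integral_tollSum_pow_succ_le (hJ : IsRandomRecursiveTreeChain P J) {n : ℕ} (hn : Even n) :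
    ∃ A : ℝ, 0 ≤ A ∧ ∀ σ : List ℕ+ → ℝ, (∀ u, |σ u| ≤ 1) → ∀ m : ℕ,
      1 + ∫ ω, tollSum σ (m + 1) (parentSeq J ω) ^ (n + 2) ∂P ≤
        (1 + A * (1 / ((m + 2 : ℕ) : ℝ) ^ (3 / 2 : ℝ))) *
          (1 + ∫ ω, tollSum σ m (parentSeq J ω) ^ (n + 2) ∂P) := by
  have hev : Even (n + 2) := hn.add even_two
  obtain ⟨K, hK, h1⟩ := integral_tollSumStep_pow_le hJ hev (by omega)
  set D : ℝ := ((n : ℝ) + 2) ^ 2 * 2 ^ (n + 1) with hD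
  have hD0 : 0 ≤ D := by positivity
  refine ⟨D * ((1 + 2 ^ (n + 1)) + 2 ^ (n + 1) * K), by positivity, fun σ hσ m => ?_⟩
  have hx : (0 : ℝ) < (m : ℝ) + 2 := by positivity
  set s : ℝ := ((m : ℝ) + 2) ^ (1 / 4 : ℝ) with hs
  have hs1 : 1 ≤ s := Real.one_le_rpow (by linarith [(m.cast_nonneg : (0 : ℝ) ≤ m)]) (by norm_num)
  have hs4 : s ^ 4 = (m : ℝ) + 2 := by
    rw [hs, ← Real.rpow_mul_natCast hx.le]
    norm_num
  have hs6 : s ^ 6 = ((m : ℝ) + 2) ^ (3 / 2 : ℝ) := by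
    rw [hs, ← Real.rpow_mul_natCast hx.le]
    norm_num
  have hs2 : s ^ 2 = ((m : ℝ) + 2) ^ (1 / 2 : ℝ) := by
    rw [hs, ← Real.rpow_mul_natCast hx.le]
    norm_num
  have hs0 : 0 < s := by linarith
  set b := ∫ ω, tollSum σ m (parentSeq J ω) ^ (n + 2) ∂P with hb
  have hb0 : 0 ≤ b := integral_nonneg fun ω => hev.pow_nonneg _
  have hQloc : ∀ m, IsLocal m (fun j => tollSum σ m j ^ (n + 2)) := fun m j j' h => by
    simp only [isLocal_tollSum σ m j j' h]
  -- The step is recovered from two consecutive toll sums and inherits locality from them.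
  have hXloc : ∀ i : Fin (m + 1), IsLocal m (fun j => tollSumStep σ m j i ^ (n + 2)) := by
    intro i j j' h
    have h2 : ∀ j, tollSumStep σ m j i =
        (tollSum σ (m + 1) (Function.update j m i) - tollSum σ m j) * ((m : ℝ) + 2) +
          tollSum σ m j := by
      intro j
      rw [tollSum_update]
      field_simp
      ring
    simp only [h2, isLocal_tollSum σ m j j' h, (isLocal_tollSum σ (m + 1)).update_succ i j j' h]
  have hQint := (hQloc m).integrable hJ
  have hXint : Integrable (fun ω =>
      (∑ i : Fin (m + 1), tollSumStep σ m (parentSeq J ω) i ^ (n + 2)) / ((m : ℝ) + 1)) P :=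
    (integrable_finsetSum _ fun i _ => (hXloc i).integrable hJ).div_const _
  have hlin : ∀ (f h : Ω → ℝ) (c d : ℝ), Integrable f P → Integrable h P →
      ∫ ω, (f ω + (c * f ω + d * h ω)) ∂P = ∫ ω, f ω ∂P + (c * ∫ ω, f ω ∂P + d * ∫ ω, h ω ∂P) := by
    intro f h c d hf hh
    have h3 : Integrable (fun ω => c * f ω + d * h ω) P := (hf.const_mul c).add (hh.const_mul d)
    rw [integral_add hf h3, integral_add (hf.const_mul c) (hh.const_mul d), integral_const_mul,
      integral_const_mul]
  have h2 : ∫ ω, tollSum σ (m + 1) (parentSeq J ω) ^ (n + 2) ∂P ≤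
      ∫ ω, (tollSum σ m (parentSeq J ω) ^ (n + 2) + (D * (s ^ 6)⁻¹ * (1 + 2 ^ (n + 1)) *
        tollSum σ m (parentSeq J ω) ^ (n + 2) + D * (s ^ 6)⁻¹ * 2 ^ (n + 1) / s ^ 2 *
        ((∑ i : Fin (m + 1), tollSumStep σ m (parentSeq J ω) i ^ (n + 2)) / ((m : ℝ) + 1)))) ∂P := by
    rw [integral_next hJ (hQloc (m + 1))]
    refine integral_mono_of_nonneg (Eventually.of_forall fun ω => div_nonneg
      (Finset.sum_nonneg fun i _ => hev.pow_nonneg _) (by positivity))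
      (hQint.add ((hQint.const_mul _).add (hXint.const_mul _))) (Eventually.of_forall fun ω => ?_)
    refine (average_tollSum_pow_le σ (parentSeq J ω) m hn hs1 hs4).trans (le_of_eq ?_)
    rw [← hD]
    ring
  rw [hlin _ _ _ _ hQint hXint, ← hb] at h2
  have h3 := h1 σ hσ m
  rw [← hs2] at h3
  have h4 : D * (s ^ 6)⁻¹ * 2 ^ (n + 1) / s ^ 2 *
      ∫ ω, (∑ i : Fin (m + 1), tollSumStep σ m (parentSeq J ω) i ^ (n + 2)) / ((m : ℝ) + 1) ∂P ≤
      D * (s ^ 6)⁻¹ * 2 ^ (n + 1) * K := by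
    calc _ ≤ D * (s ^ 6)⁻¹ * 2 ^ (n + 1) / s ^ 2 * (K * s ^ 2) :=
          mul_le_mul_of_nonneg_left h3 (by positivity)
      _ = _ := by
          field_simp
  have h5 : 1 / ((m + 2 : ℕ) : ℝ) ^ (3 / 2 : ℝ) = (s ^ 6)⁻¹ := by
    rw [hs6, one_div]
    push_cast
    rfl
  rw [h5]
  have h6 : 0 ≤ D * (s ^ 6)⁻¹ * (1 + 2 ^ (n + 1)) := by positivity
  have h7 : 0 ≤ D * (s ^ 6)⁻¹ * 2 ^ (n + 1) * K * b := by positivity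
  linarith

/-- The even moments of the weighted toll sums are bounded, uniformly small if the weight suppresses
the early nodes. -/
theorem exists_tollSum_moment_bound (hJ : IsRandomRecursiveTreeChain P J) {n : ℕ} (hn : Even n) :
    ∃ τ : ℕ → ℝ, Tendsto τ atTop (𝓝 0) ∧ ∀ σ : List ℕ+ → ℝ, (∀ u, |σ u| ≤ 1) → ∀ k : ℕ,
      (∀ j, tollSum σ k j = 0) → ∀ m, k ≤ m →
        ∫ ω, tollSum σ m (parentSeq J ω) ^ (n + 2) ∂P ≤ τ k := by
  obtain ⟨A, hA, h1⟩ := integral_tollSum_pow_succ_le hJ hn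
  set c : ℕ → ℝ := fun m => A * (1 / ((m + 2 : ℕ) : ℝ) ^ (3 / 2 : ℝ)) with hc
  have hc0 : ∀ m, 0 ≤ c m := fun m => by positivity
  have hcsum : Summable c := ((summable_nat_add_iff 2).2
    (Real.summable_one_div_nat_rpow.2 (by norm_num : (1 : ℝ) < 3 / 2))).mul_left A
  -- The recursion started from 1 + 0 at time `k` multiplies factors 1 + c_i ≤ exp(c_i) with i ≥ k,
  -- so only the tail of a convergent series enters.
  refine ⟨fun k => Real.exp (∑' i, c (i + k)) - 1, ?_, fun σ hσ k h0 m hm => ?_⟩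
  · have h2 := (Real.continuous_exp.tendsto 0).comp (tendsto_sum_nat_add c)
    have h3 := h2.sub_const 1
    rw [Real.exp_zero, sub_self] at h3
    exact h3
  · have h2 : 1 + ∫ ω, tollSum σ m (parentSeq J ω) ^ (n + 2) ∂P ≤
        Real.exp (∑ i ∈ Finset.range (m - k), c (i + k)) := by
      induction m, hm using Nat.le_induction with
      | base => simp [h0]
      | succ m hm ih =>
        rw [Nat.succ_sub hm, Finset.sum_range_succ, Nat.sub_add_cancel hm, Real.exp_add, mul_comm]
        refine (h1 σ hσ m).trans (mul_le_mul ?_ ih ?_ (Real.exp_pos _).le)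
        · have := Real.add_one_le_exp (c m)
          linarith
        · have : 0 ≤ ∫ ω, tollSum σ m (parentSeq J ω) ^ (n + 2) ∂P :=
            integral_nonneg fun ω => (hn.add even_two).pow_nonneg _
          linarith
    have h3 : ∑ i ∈ Finset.range (m - k), c (i + k) ≤ ∑' i, c (i + k) :=
      ((summable_nat_add_iff k).2 hcsum).sum_le_tsum _ fun i _ => hc0 _
    have h4 := Real.exp_le_exp.2 h3
    show _ ≤ Real.exp (∑' i, c (i + k)) - 1
    linarith

end Chain

section Limits

open scoped ENNReal NNReal

/-! ### Convergence in `L^p` from bounded moments -/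

section Lp

variable {Ω : Type*} [mΩ : MeasurableSpace Ω] {P : Measure Ω} [IsProbabilityMeasure P]

omit [IsProbabilityMeasure P] in
theorem eLpNorm_le_of_tendsto_ae {X : ℕ → Ω → ℝ} {Y : Ω → ℝ} {p C : ℝ≥0∞}
    (hX : ∀ n, AEStronglyMeasurable (X n) P)
    (hlim : ∀ᵐ ω ∂P, Tendsto (fun n => X n ω) atTop (𝓝 (Y ω)))
    (hC : ∀ᶠ n in atTop, eLpNorm (X n) p P ≤ C) : eLpNorm Y p P ≤ C := by
  refine (Lp.eLpNorm_lim_le_liminf_eLpNorm hX Y hlim).trans ?_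
  exact liminf_le_of_frequently_le' hC.frequently

omit [IsProbabilityMeasure P] in
theorem unifIntegrable_of_eLpNorm_le {X : ℕ → Ω → ℝ} {q : ℕ} (hq : q ≠ 0) {C : ℝ≥0∞} (hC : C ≠ ∞)
    (hX : ∀ n, AEStronglyMeasurable (X n) P) (hb : ∀ n, eLpNorm (X n) (2 * q : ℕ) P ≤ C) :
    UnifIntegrable X q P := by
  intro ε hε
  have hq' : (0 : ℝ) < q := by exact_mod_cast Nat.pos_of_ne_zero hq
  -- Hölder's inequality between the exponents q and 2q gives ‖X 1_s‖_q ≤ C P(s)^{1/(2q)}; `δ` makes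
  -- this at most ε. The summand 1 keeps the denominator positive.
  set δ : ℝ := (ε / (C.toReal + 1)) ^ (2 * (q : ℝ)) with hδ
  have hC1 : 0 < C.toReal + 1 := by positivity
  have hεC : 0 < ε / (C.toReal + 1) := by positivity
  refine ⟨δ, by positivity, fun n s hs hμ => ?_⟩
  rw [eLpNorm_indicator_eq_eLpNorm_restrict hs]
  have h1 := eLpNorm_le_eLpNorm_mul_rpow_measure_univ (μ := P.restrict s) (f := X n)
    (p := (q : ℝ≥0∞)) (q := ((2 * q : ℕ) : ℝ≥0∞)) (by exact_mod_cast (by omega : q ≤ 2 * q))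
    (hX n).restrict
  refine h1.trans ?_
  have h2 : 1 / ((q : ℝ≥0∞)).toReal - 1 / (((2 * q : ℕ) : ℝ≥0∞)).toReal = 1 / (2 * (q : ℝ)) := by
    rw [ENNReal.toReal_natCast, ENNReal.toReal_natCast]
    push_cast
    field_simp
    norm_num
  rw [h2, Measure.restrict_apply_univ]
  calc eLpNorm (X n) (2 * q : ℕ) (P.restrict s) * P s ^ (1 / (2 * (q : ℝ))) ≤
        ENNReal.ofReal (C.toReal + 1) * ENNReal.ofReal (ε / (C.toReal + 1)) := by
        apply mul_le_mul'
        · refine (eLpNorm_mono_measure _ Measure.restrict_le_self).trans ((hb n).trans ?_)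
          rw [← ENNReal.ofReal_toReal hC]
          exact ENNReal.ofReal_le_ofReal (by simp)
        · calc P s ^ (1 / (2 * (q : ℝ))) ≤ (ENNReal.ofReal δ) ^ (1 / (2 * (q : ℝ))) :=
                ENNReal.rpow_le_rpow hμ (by positivity)
            _ = _ := by
                rw [ENNReal.ofReal_rpow_of_pos (by positivity), hδ, ← Real.rpow_mul hεC.le]
                congr 1
                rw [mul_one_div_cancel (by positivity), Real.rpow_one]
    _ = ENNReal.ofReal ε := by
        rw [← ENNReal.ofReal_mul hC1.le]
        congr 1
        field_simp

/-- Almost sure convergence together with bounds on all moments gives convergence in `L^p`. -/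
theorem memLp_and_tendsto_eLpNorm {X : ℕ → Ω → ℝ} {Y : Ω → ℝ}
    (hX : ∀ n, AEStronglyMeasurable (X n) P) (hY : AEStronglyMeasurable Y P)
    (hlim : ∀ᵐ ω ∂P, Tendsto (fun n => X n ω) atTop (𝓝 (Y ω)))
    (hb : ∀ n : ℕ, Even n → ∃ C : ℝ≥0∞, C ≠ ∞ ∧ ∀ m, eLpNorm (X m) (n + 2 : ℕ) P ≤ C)
    {p : ℝ≥0∞} (hp : p ≠ ∞) :
    MemLp Y p P ∧ Tendsto (fun m => eLpNorm (fun ω => X m ω - Y ω) p P) atTop (𝓝 0) := by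
  obtain ⟨q, hq⟩ : ∃ q : ℕ, p ≤ ((2 * q + 2 : ℕ) : ℝ≥0∞) := by
    obtain ⟨q, hq⟩ := ENNReal.exists_nat_gt hp
    exact ⟨q, hq.le.trans (by exact_mod_cast (by omega : q ≤ 2 * q + 2))⟩
  obtain ⟨C, hC, h1⟩ := hb (2 * q) (even_two_mul q)
  -- Uniform integrability at the exponent 2q + 2 uses a moment of twice that order, 2(2q + 1) + 2.
  obtain ⟨C', hC', h2⟩ := hb (2 * (2 * q + 1)) (even_two_mul _)
  have hYq : MemLp Y ((2 * q + 2 : ℕ) : ℝ≥0∞) P :=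
    ⟨hY, (eLpNorm_le_of_tendsto_ae hX hlim (Eventually.of_forall h1)).trans_lt hC.lt_top⟩
  have hui : UnifIntegrable X ((2 * q + 2 : ℕ) : ℝ≥0∞) P := by
    refine unifIntegrable_of_eLpNorm_le (by omega) hC' hX fun n => ?_
    have := h2 n
    rwa [show 2 * (2 * q + 1) + 2 = 2 * (2 * q + 2) by ring] at this
  refine ⟨hYq.mono_exponent hq, ?_⟩
  have h3 := tendsto_Lp_finite_of_tendsto_ae (by exact_mod_cast (by omega : 1 ≤ 2 * q + 2))
    (ENNReal.natCast_ne_top _) hX hYq hui hlim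
  refine tendsto_of_tendsto_of_tendsto_of_le_of_le tendsto_const_nhds h3 (fun _ => zero_le) fun m => ?_
  exact eLpNorm_le_eLpNorm_of_exponent_le hq ((hX m).sub hY)

omit [IsProbabilityMeasure P] in
theorem eLpNorm_le_of_integral_pow_le {X : Ω → ℝ} {n : ℕ} (hn : Even n) (hn0 : n ≠ 0)
    (hX : MemLp X n P) {c : ℝ} (hc : ∫ ω, X ω ^ n ∂P ≤ c) :
    eLpNorm X n P ≤ ENNReal.ofReal (c ^ ((n : ℝ)⁻¹)) := by
  rw [hX.eLpNorm_eq_integral_rpow_norm (by exact_mod_cast hn0) (ENNReal.natCast_ne_top _)]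
  apply ENNReal.ofReal_le_ofReal
  rw [ENNReal.toReal_natCast]
  have h1 : ∀ ω, ‖X ω‖ ^ (n : ℝ) = X ω ^ n := fun ω => by
    rw [Real.rpow_natCast, Real.norm_eq_abs, hn.pow_abs]
  simp only [h1]
  exact Real.rpow_le_rpow (integral_nonneg fun ω => hn.pow_nonneg _) hc (by positivity)

end Lp

section Chain

variable {Ω : Type*} [mΩ : MeasurableSpace Ω] {P : Measure Ω} [IsProbabilityMeasure P]
  {J : (k : ℕ) → Ω → Fin (k + 1)}

theorem IsLocal.memLp {n : ℕ} {Φ : ParentSeq → ℝ} (h : IsLocal n Φ)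
    (hJ : IsRandomRecursiveTreeChain P J) (p : ℝ≥0∞) : MemLp (fun ω => Φ (parentSeq J ω)) p P := by
  obtain ⟨C, hC⟩ := h.exists_bound
  exact MemLp.of_bound (h.measurable hJ).aestronglyMeasurable C
    (Eventually.of_forall fun ω => hC _)

theorem eLpNorm_tollSum_le (hJ : IsRandomRecursiveTreeChain P J) {n : ℕ} (hn : Even n) :
    ∃ τ : ℕ → ℝ≥0∞, Tendsto τ atTop (𝓝 0) ∧ (∀ k, τ k ≠ ∞) ∧
      ∀ σ : List ℕ+ → ℝ, (∀ u, |σ u| ≤ 1) → ∀ k : ℕ, (∀ j, tollSum σ k j = 0) → ∀ m, k ≤ m →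
        eLpNorm (fun ω => tollSum σ m (parentSeq J ω)) (n + 2 : ℕ) P ≤ τ k := by
  obtain ⟨τ, hτ, h1⟩ := exists_tollSum_moment_bound hJ hn
  refine ⟨fun k => ENNReal.ofReal (τ k ^ (((n + 2 : ℕ) : ℝ)⁻¹)), ?_, fun _ => ENNReal.ofReal_ne_top,
    fun σ hσ k h0 m hm => ?_⟩
  · have h2 := ENNReal.tendsto_ofReal
      (hτ.rpow_const (p := ((n + 2 : ℕ) : ℝ)⁻¹) (Or.inr (by positivity)))
    rwa [Real.zero_rpow (by positivity), ENNReal.ofReal_zero] at h2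
  · exact eLpNorm_le_of_integral_pow_le (hn.add even_two) (by omega)
      ((isLocal_tollSum σ m).memLp hJ _) (h1 σ hσ k h0 m hm)

theorem tollSum_zero (σ : List ℕ+ → ℝ) (j : ParentSeq) : tollSum σ 0 j = 0 := by
  unfold tollSum
  rw [zero_add, Finset.sum_range_one, toll_self]
  simp

/-- The limit of the centred internal path length per node. -/
noncomputable def pathLimit (j : ParentSeq) : ℝ :=
  limsup (fun m => tollSum (fun _ => 1) m j) atTop

theorem ae_tendsto_pathLimit (hJ : IsRandomRecursiveTreeChain P J) :
    ∀ᵐ ω ∂P, Tendsto (fun m => tollSum (fun _ => 1) m (parentSeq J ω)) atTop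
      (𝓝 (pathLimit (parentSeq J ω))) := by
  obtain ⟨τ, -, hτ, h1⟩ := eLpNorm_tollSum_le hJ (n := 0) Even.zero
  have hM := martingale_tollSum hJ (fun _ => 1)
  have hb : ∀ m, eLpNorm (fun ω => tollSum (fun _ => 1) m (parentSeq J ω)) 1 P ≤
      ((τ 0).toNNReal : ℝ≥0∞) := by
    intro m
    rw [ENNReal.coe_toNNReal (hτ 0)]
    refine le_trans ?_ (h1 (fun _ => 1) (fun _ => by simp) 0 (tollSum_zero _) m m.zero_le)
    exact eLpNorm_le_eLpNorm_of_exponent_le (by norm_num)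
      ((isLocal_tollSum _ m).measurable hJ).aestronglyMeasurable
  filter_upwards [hM.submartingale.exists_ae_tendsto_of_bdd hb] with ω hω
  obtain ⟨c, hc⟩ := hω
  rwa [pathLimit, hc.limsup_eq]

omit [IsProbabilityMeasure P] in
theorem measurable_pathLimit (hJ : IsRandomRecursiveTreeChain P J) :
    Measurable (fun ω => pathLimit (parentSeq J ω)) :=
  Measurable.limsup fun m => (isLocal_tollSum _ m).measurable hJ

/-! ### The sum of the squares of the subtree sizes -/

/-- The sum of the squares of the relative subtree sizes in the tree with the nodes `0, …, m`. -/
noncomputable def squares (m : ℕ) (j : ParentSeq) : ℝ :=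
  ∑ a ∈ Finset.range (m + 1), ((descCount j (m + 1) a : ℝ) / ((m + 1 : ℕ) : ℝ)) ^ 2

theorem isLocal_squares (m : ℕ) : IsLocal m (squares m) := by
  intro j j' h
  unfold squares
  simp only [descCount_congr h]

/-- Minkowski's inequality over the nodes: the rising-factorial martingale of order 2q bounds the
norm of the square belonging to `a` by ((2q)!)^{1/q} / (a+1)², which is summable. -/
theorem eLpNorm_squares_le (hJ : IsRandomRecursiveTreeChain P J) {n : ℕ} (hn : Even n) :
    ∃ C : ℝ≥0∞, C ≠ ∞ ∧
      ∀ m, eLpNorm (fun ω => squares m (parentSeq J ω)) (n + 2 : ℕ) P ≤ C := by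
  have hev : Even (n + 2) := hn.add even_two
  set q : ℕ := n + 2 with hq
  have hq0 : (q : ℝ) ≠ 0 := by positivity
  set A : ℝ := (((2 * q).factorial : ℕ) : ℝ) ^ ((q : ℝ)⁻¹) with hA
  have hA0 : 0 ≤ A := by positivity
  have hterm : ∀ m a, a ≤ m → eLpNorm (fun ω =>
      ((descCount (parentSeq J ω) (m + 1) a : ℝ) / ((m + 1 : ℕ) : ℝ)) ^ 2) q P ≤
      ENNReal.ofReal (A * (1 / (((a + 1 : ℕ) : ℝ)) ^ 2)) := by
    intro m a ha
    have hloc : IsLocal m (fun j => ((descCount j (m + 1) a : ℝ) / ((m + 1 : ℕ) : ℝ)) ^ 2) :=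
      fun j j' h => by simp only [descCount_congr h]
    have h1 : ∫ ω, (((descCount (parentSeq J ω) (m + 1) a : ℝ) / ((m + 1 : ℕ) : ℝ)) ^ 2) ^ q ∂P ≤
        ((2 * q).factorial : ℝ) / ((a : ℝ) + 1) ^ (2 * q) := by
      calc _ ≤ ∫ ω, urnValue (risingRatio (2 * q)) a m (parentSeq J ω) ∂P := by
            refine integral_mono_of_nonneg (Eventually.of_forall fun ω => by positivity)
              ((isLocal_urnValue _ a m).integrable hJ) (Eventually.of_forall fun ω => ?_)
            simp only
            rw [urnValue_of_le ha, ← pow_mul]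
            exact pow_le_risingRatio (descCount_le _ _ _) (by omega)
        _ ≤ _ := by
            rw [integral_urnValue hJ (isUrnHarmonic_risingRatio _)]
            exact risingRatio_initial_le _ _
    refine (eLpNorm_le_of_integral_pow_le hev (by omega) (hloc.memLp hJ _) h1).trans (le_of_eq ?_)
    congr 1
    rw [Real.div_rpow (by positivity) (by positivity), pow_mul,
      Real.pow_rpow_inv_natCast (by positivity) (by omega)]
    push_cast
    rw [← hA, mul_one_div]
  have hsum : Summable fun a : ℕ => A * (1 / (((a + 1 : ℕ) : ℝ)) ^ 2) :=
    ((summable_nat_add_iff 1).2 (Real.summable_one_div_nat_pow.2 one_lt_two)).mul_left A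
  refine ⟨∑' a : ℕ, ENNReal.ofReal (A * (1 / (((a + 1 : ℕ) : ℝ)) ^ 2)), hsum.tsum_ofReal_ne_top,
    fun m => ?_⟩
  have h2 : (fun ω => squares m (parentSeq J ω)) = ∑ a ∈ Finset.range (m + 1), fun ω =>
      ((descCount (parentSeq J ω) (m + 1) a : ℝ) / ((m + 1 : ℕ) : ℝ)) ^ 2 := by
    ext ω
    rw [Finset.sum_apply]
    rfl
  rw [h2]
  refine (eLpNorm_sum_le (fun a _ => ?_) (by exact_mod_cast (by omega : 1 ≤ q))).trans ?_
  · have hloc : IsLocal m (fun j => ((descCount j (m + 1) a : ℝ) / ((m + 1 : ℕ) : ℝ)) ^ 2) :=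
      fun j j' h => by simp only [descCount_congr h]
    exact (hloc.measurable hJ).aestronglyMeasurable
  · refine (Finset.sum_le_sum fun a ha =>
      hterm m a (Nat.le_of_lt_succ (Finset.mem_range.1 ha))).trans ?_
    exact ENNReal.sum_le_tsum _

theorem HasRegularLimits.mass_zero {j : ParentSeq} (hj : HasRegularLimits j) : mass j 0 = 1 := by
  refine tendsto_nhds_unique (hj.tendsto 0) (tendsto_const_nhds.congr' ?_)
  filter_upwards [eventually_gt_atTop 0] with n hn
  rw [descCount_zero_right, div_self]
  exact_mod_cast hn.ne'

theorem ae_tendsto_squares (hJ : IsRandomRecursiveTreeChain P J) :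
    ∀ᵐ ω ∂P, Summable (fun a => mass (parentSeq J ω) a ^ 2) ∧
      Tendsto (fun m => squares m (parentSeq J ω)) atTop
        (𝓝 (∑' a, mass (parentSeq J ω) a ^ 2)) := by
  filter_upwards [ae_tendsto_sum_squares hJ, ae_tendsto_pathLimit hJ, ae_hasRegularLimits hJ]
    with ω h1 h2 hj
  set j := parentSeq J ω
  have hs : Summable (fun a => mass j a ^ 2) := (summable_nat_add_iff 1).1 h1.1
  refine ⟨hs, ?_⟩
  rw [hs.tsum_eq_zero_add, hj.mass_zero]
  have h3 : Tendsto (fun n : ℕ => 1 / (((n + 1 : ℕ) : ℝ))) atTop (𝓝 0) :=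
    (tendsto_add_atTop_iff_nat 1).2 tendsto_one_div_atTop_nhds_zero_nat
  have h4 : Tendsto (fun n : ℕ => harm (n + 1) / (((n + 1 : ℕ) : ℝ))) atTop (𝓝 0) :=
    (tendsto_add_atTop_iff_nat 1).2 tendsto_harm_div
  have h5 := (((h3.const_add 1).mul h1.2).sub (((h2.mul h3).add h4).sub h3)).const_add (1 ^ 2)
  have h6 : (1 : ℝ) ^ 2 + ((1 + 0) * ∑' k, mass j (k + 1) ^ 2 - (pathLimit j * 0 + 0 - 0)) =
      1 ^ 2 + ∑' k, mass j (k + 1) ^ 2 := by ring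
  rw [h6] at h5
  refine h5.congr fun m => ?_
  have hm : ((m + 1 : ℕ) : ℝ) ≠ 0 := by positivity
  -- Squares differ from the harmonic ratios N(N+1)/(n(n+1)) by a factor 1 + 1/n and a correction
  -- N/n². Summed over the nodes the correction is (H_n + O(1))/n and vanishes.
  have h7 : ∀ N : ℕ, ((N : ℝ) / ((m + 1 : ℕ) : ℝ)) ^ 2 = (1 + 1 / ((m + 1 : ℕ) : ℝ)) *
      risingRatio 2 (m + 1) N - (N : ℝ) / ((m + 1 : ℕ) : ℝ) * (1 / ((m + 1 : ℕ) : ℝ)) := by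
    intro N
    rw [risingRatio_two]
    have : ((m + 1 : ℕ) : ℝ) + 1 ≠ 0 := by positivity
    field_simp
    ring
  rw [tollSum_one, squares, Finset.sum_range_succ', Finset.sum_range_succ' (fun a =>
    ((descCount j (m + 1) a : ℝ) / ((m + 1 : ℕ) : ℝ)) ^ 2), descCount_zero_right, div_self hm]
  simp only [h7, Finset.sum_sub_distrib, ← Finset.mul_sum, ← Finset.sum_mul]
  ring

theorem treeWienerIndex_standardized (j : ParentSeq) (m : ℕ) :
    1 / ((m + 1 : ℕ) : ℝ) ^ 2 * treeWienerIndex (harrisTree j (m + 1)) - (harmonic (m + 1) : ℝ) =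
      tollSum (fun _ => 1) m j - squares m j := by
  rw [treeWienerIndex_harrisTree, tollSum_one, squares, Finset.mul_sum]
  have hm : ((m + 1 : ℕ) : ℝ) ≠ 0 := by positivity
  have h1 : ∀ a, 1 / ((m + 1 : ℕ) : ℝ) ^ 2 * (((m + 1 : ℕ) : ℝ) * descCount j (m + 1) a -
      (descCount j (m + 1) a : ℝ) ^ 2) = (descCount j (m + 1) a : ℝ) / ((m + 1 : ℕ) : ℝ) -
      ((descCount j (m + 1) a : ℝ) / ((m + 1 : ℕ) : ℝ)) ^ 2 := by
    intro a
    field_simp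
  simp only [h1, Finset.sum_sub_distrib]
  rw [harm]
  ring

/-! ### The mean -/

theorem integral_descCount (hJ : IsRandomRecursiveTreeChain P J) {m a : ℕ} (h : a ≤ m) :
    ∫ ω, (descCount (parentSeq J ω) (m + 1) a : ℝ) ∂P = ((m : ℝ) + 1) / ((a : ℝ) + 1) := by
  have h1 := integral_urnValue hJ (isUrnHarmonic_risingRatio 1) a m
  simp only [urnValue_of_le h, risingRatio_one] at h1
  rw [integral_div, div_eq_iff (by positivity)] at h1
  rw [h1]
  push_cast
  ring

theorem integral_descCount_sq (hJ : IsRandomRecursiveTreeChain P J) {m a : ℕ} (h : a ≤ m) :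
    ∫ ω, (descCount (parentSeq J ω) (m + 1) a : ℝ) ^ 2 ∂P =
      2 * ((m : ℝ) + 1) * ((m : ℝ) + 2) * (1 / ((a : ℝ) + 1) - 1 / ((a : ℝ) + 2)) -
        ((m : ℝ) + 1) / ((a : ℝ) + 1) := by
  have hloc : IsLocal m (fun j => (descCount j (m + 1) a : ℝ)) := fun j j' h => by
    simp only [descCount_congr h]
  have hloc2 : IsLocal m (fun j => (descCount j (m + 1) a : ℝ) ^ 2) := fun j j' h => by
    simp only [descCount_congr h]
  have h1 := integral_urnValue hJ (isUrnHarmonic_risingRatio 2) a m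
  simp only [urnValue_of_le h, risingRatio_two] at h1
  rw [integral_div, div_eq_iff (by positivity)] at h1
  have h2 : ∀ ω, (descCount (parentSeq J ω) (m + 1) a : ℝ) *
      ((descCount (parentSeq J ω) (m + 1) a : ℝ) + 1) =
      (descCount (parentSeq J ω) (m + 1) a : ℝ) ^ 2 + descCount (parentSeq J ω) (m + 1) a :=
    fun ω => by ring
  simp only [h2] at h1
  rw [integral_add (hloc2.integrable hJ) (hloc.integrable hJ), integral_descCount hJ h] at h1
  rw [eq_sub_iff_add_eq, h1]
  push_cast
  field_simp
  ring

theorem integral_treeWienerIndex (hJ : IsRandomRecursiveTreeChain P J) (m : ℕ) :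
    Integrable (fun ω => treeWienerIndex (harrisChain J (m + 1) ω)) P ∧
      ∫ ω, treeWienerIndex (harrisChain J (m + 1) ω) ∂P = ((m + 1 : ℕ) : ℝ) *
        (((m + 1 : ℕ) : ℝ) + 1) * (harmonic (m + 1) : ℝ) - 2 * ((m + 1 : ℕ) : ℝ) ^ 2 := by
  have hloc : ∀ a, IsLocal m (fun j => (descCount j (m + 1) a : ℝ)) := fun a j j' h => by
    simp only [descCount_congr h]
  have hloc2 : ∀ a, IsLocal m (fun j => (descCount j (m + 1) a : ℝ) ^ 2) := fun a j j' h => by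
    simp only [descCount_congr h]
  have hWI : ∀ ω, treeWienerIndex (harrisChain J (m + 1) ω) =
      ∑ a ∈ Finset.range (m + 1), (((m + 1 : ℕ) : ℝ) * descCount (parentSeq J ω) (m + 1) a -
        (descCount (parentSeq J ω) (m + 1) a : ℝ) ^ 2) :=
    fun ω => treeWienerIndex_harrisTree (parentSeq J ω) (m + 1)
  have hint : ∀ a, Integrable (fun ω => ((m + 1 : ℕ) : ℝ) * descCount (parentSeq J ω) (m + 1) a -
      (descCount (parentSeq J ω) (m + 1) a : ℝ) ^ 2) P := fun a =>
    (((hloc a).integrable hJ).const_mul _).sub ((hloc2 a).integrable hJ)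
  simp only [hWI]
  refine ⟨integrable_finsetSum _ fun a _ => hint a, ?_⟩
  rw [integral_finsetSum _ fun a _ => hint a]
  -- Separating 1/(a+1) from the difference of reciprocals lets the first part sum to a harmonic
  -- number and the second telescope.
  have h1 : ∀ a ∈ Finset.range (m + 1), ∫ ω, (((m + 1 : ℕ) : ℝ) *
      descCount (parentSeq J ω) (m + 1) a - (descCount (parentSeq J ω) (m + 1) a : ℝ) ^ 2) ∂P =
      ((m : ℝ) + 1) * ((m : ℝ) + 2) * (1 / ((a : ℝ) + 1)) -
      2 * ((m : ℝ) + 1) * ((m : ℝ) + 2) * (1 / ((a : ℝ) + 1) - 1 / (((a + 1 : ℕ) : ℝ) + 1)) := by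
    intro a ha
    have ha' := Nat.le_of_lt_succ (Finset.mem_range.1 ha)
    rw [integral_sub (((hloc a).integrable hJ).const_mul _) ((hloc2 a).integrable hJ),
      integral_const_mul, integral_descCount hJ ha', integral_descCount_sq hJ ha']
    push_cast
    ring
  have hharm : ∀ n : ℕ, ∑ a ∈ Finset.range n, 1 / ((a : ℝ) + 1) = harm n := by
    intro n
    induction n with
    | zero => simp [harm_zero]
    | succ n ih => rw [Finset.sum_range_succ, ih, harm_succ]
  rw [Finset.sum_congr rfl h1, Finset.sum_sub_distrib, ← Finset.mul_sum, ← Finset.mul_sum, hharm,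
    Finset.sum_range_sub' (fun a : ℕ => 1 / ((a : ℝ) + 1)), harm]
  push_cast
  field_simp
  ring

end Chain

/-! ### Probability measures on the limit space with given masses -/

/-- The prefixes of the infinite word in which the word `w` is followed by the letter `K w`. -/
def letterPath (K : List ℕ+ → ℕ+) : ℕ → List ℕ+
  | 0 => []
  | n + 1 => letterPath K n ++ [K (letterPath K n)]

/-- The infinite word in which the word `w` is followed by the letter `K w`. -/
def letterWord (K : List ℕ+ → ℕ+) : NodeBar := NodeBar.infinite fun n => K (letterPath K n)

theorem letterWord_mem_cylinderSet (K : List ℕ+ → ℕ+) (u : List ℕ+) :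
    letterWord K ∈ cylinderSet u ↔ ∀ (i : ℕ) (hi : i < u.length), K (u.take i) = u[i] := by
  have hstep : ∀ i, (∀ k, k < i → ∀ hk : k < u.length, u.take k = letterPath K k →
      K (u.take k) = u[k]) → i ≤ u.length → u.take i = letterPath K i := by
    intro i
    induction i with
    | zero => simp [letterPath]
    | succ i ih =>
      intro h hi
      have h1 := ih (fun k hk => h k (hk.trans i.lt_succ_self)) (by omega)
      rw [List.take_succ_eq_append_getElem (by omega), letterPath, ← h1,
        h i i.lt_succ_self (by omega) h1]
  constructor
  · intro h i hi
    have h' : ∀ (i : ℕ) (hi : i < u.length), u[i] = K (letterPath K i) := h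
    rw [hstep i (fun k _ hk h1 => by rw [h1, h' k hk]) hi.le, h' i hi]
  · intro h
    show ∀ (i : ℕ) (hi : i < u.length), u[i] = K (letterPath K i)
    intro i hi
    rw [← hstep i (fun k _ hk _ => h k hk) hi.le, h i hi]

/-- The one-step law with the weights `m (u ++ [i]) / m u`. -/
noncomputable def stepLaw (m : List ℕ+ → ℝ) (hm : ∀ u, 0 < m u)
    (hsum : ∀ u, HasSum (fun i : ℕ+ => m (u ++ [i])) (m u)) (u : List ℕ+) : PMF ℕ+ :=
  ⟨fun i => ENNReal.ofReal (m (u ++ [i]) / m u), by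
    have h := (hsum u).div_const (m u)
    rw [div_self (hm u).ne'] at h
    have h2 := ENNReal.ofReal_tsum_of_nonneg
      (fun i : ℕ+ => (div_pos (hm (u ++ [i])) (hm u)).le) h.summable
    rw [h.tsum_eq, ENNReal.ofReal_one] at h2
    rw [h2]
    exact ENNReal.summable.hasSum⟩

/-- Independent letters are drawn at all words, with the one-step law at each, and followed from the
root. The probability of a prefix is a product of ratios that telescopes to its mass. The resulting
measure is the law of a random infinite word. -/
theorem exists_measure_cylinderSet (m : List ℕ+ → ℝ) (h1 : m [] = 1) (hm : ∀ u, 0 < m u)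
    (hsum : ∀ u, HasSum (fun i : ℕ+ => m (u ++ [i])) (m u)) :
    ∃ μ : Measure NodeBar, IsProbabilityMeasure μ ∧ ∀ u, μ.real (cylinderSet u) = m u := by
  classical
  let : MeasurableSpace ℕ+ := ⊤
  have : DiscreteMeasurableSpace ℕ+ := ⟨fun _ => trivial⟩
  set ν : Measure (List ℕ+ → ℕ+) :=
    Measure.infinitePi fun u => (stepLaw m hm hsum u).toMeasure with hν
  set t : List ℕ+ → List ℕ+ → Set ℕ+ := fun u w =>
    if hw : w.length < u.length then {u[w.length]} else Set.univ with ht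
  set s : List ℕ+ → Finset (List ℕ+) := fun u => (Finset.range u.length).image u.take with hs
  have hpre : ∀ u, letterWord ⁻¹' cylinderSet u = Set.pi (s u) (t u) := by
    intro u
    ext K
    rw [Set.mem_preimage, letterWord_mem_cylinderSet]
    simp only [Set.mem_pi, hs, Finset.coe_image, Set.forall_mem_image, Finset.coe_range,
      Set.mem_Iio]
    refine forall_congr' fun i => forall_congr' fun hi => ?_
    have hl : (u.take i).length = i := by
      rw [List.length_take]
      omega
    have h2 : t u (u.take i) = {u[i]} := by
      simp only [ht]
      rw [dif_pos (by omega)]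
      simp only [hl]
    rw [h2, Set.mem_singleton_iff]
  have htmeas : ∀ u w, MeasurableSet (t u w) := fun u w => MeasurableSet.of_discrete
  have hmeas : Measurable letterWord := by
    refine measurable_generateFrom ?_
    rintro _ ⟨u, rfl⟩
    rw [hpre]
    exact MeasurableSet.pi (s u).countable_toSet fun w _ => htmeas u w
  refine ⟨ν.map letterWord, Measure.isProbabilityMeasure_map hmeas.aemeasurable, fun u => ?_⟩
  have hcyl : MeasurableSet (cylinderSet u) := MeasurableSpace.measurableSet_generateFrom ⟨u, rfl⟩
  rw [measureReal_def, Measure.map_apply hmeas hcyl, hpre, hν,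
    Measure.infinitePi_pi _ fun w _ => htmeas u w, hs, Finset.prod_image]
  · have h2 : ∀ i ∈ Finset.range u.length, (stepLaw m hm hsum (u.take i)).toMeasure
        (t u (u.take i)) = ENNReal.ofReal (m (u.take (i + 1)) / m (u.take i)) := by
      intro i hi
      rw [Finset.mem_range] at hi
      have hl : (u.take i).length = i := by
        rw [List.length_take]
        omega
      have h2 : t u (u.take i) = {u[i]} := by
        simp only [ht]
        rw [dif_pos (by omega)]
        simp only [hl]
      rw [h2, PMF.toMeasure_apply_singleton _ _ (measurableSet_singleton _),
        List.take_succ_eq_append_getElem hi]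
      rfl
    have h3 : ∀ n, ∏ i ∈ Finset.range n, ENNReal.ofReal (m (u.take (i + 1)) / m (u.take i)) =
        ENNReal.ofReal (m (u.take n)) := by
      intro n
      induction n with
      | zero => simp [h1]
      | succ n ih =>
        rw [Finset.prod_range_succ, ih, ← ENNReal.ofReal_mul (hm _).le,
          mul_div_cancel₀ _ (hm _).ne']
    rw [Finset.prod_congr rfl h2, h3, List.take_length, ENNReal.toReal_ofReal (hm u).le]
  · intro i hi k hk hik
    have h2 := congrArg List.length hik
    simp only [Finset.coe_range, Set.mem_Iio] at hi hk
    rw [List.length_take, List.length_take] at h2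
    omega

/-! ### Children as letters -/

/-- The child of the node `a` whose word is the word of `a` followed by `i`. -/
noncomputable def childNode (j : ParentSeq) (a : ℕ) (i : ℕ+) : ℕ :=
  Nat.nth (fun k => (j k : ℕ) = a) i.natPred + 1

theorem HasRegularLimits.nodeWord_childNode {j : ParentSeq} (hj : HasRegularLimits j) (a : ℕ)
    (i : ℕ+) : nodeWord j (childNode j a i) = nodeWord j a ++ [i] :=
  nodeWord_nth (hj.infinite a) i

/-- Reindexes the children of `a`, listed by birth time, by their letters; all other indices have
weight 0. -/
theorem HasRegularLimits.hasSum_childNode {j : ParentSeq} (hj : HasRegularLimits j) {a : ℕ}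
    {f : ℕ → ℝ} {S : ℝ} (h : HasSum (fun k => childInd a k j * f (k + 1)) S) :
    HasSum (fun i => f (childNode j a i)) S := by
  have hinj : Function.Injective fun i : ℕ+ => Nat.nth (fun k => (j k : ℕ) = a) i.natPred :=
    (Nat.nth_injective (hj.infinite a)).comp PNat.natPred_injective
  rw [← hinj.hasSum_iff] at h
  · refine h.congr_fun ?_
    intro i
    have h1 : (j (Nat.nth (fun k => (j k : ℕ) = a) i.natPred) : ℕ) = a :=
      Nat.nth_mem_of_infinite (hj.infinite a) _
    simp only [Function.comp, childInd, if_pos h1, one_mul]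
    rfl
  · intro k hk
    rw [childInd, if_neg, zero_mul]
    intro h1
    have h2 : k ∈ Set.range (Nat.nth fun k => (j k : ℕ) = a) := by
      rw [Nat.range_nth_of_infinite (hj.infinite a)]
      exact h1
    obtain ⟨n, rfl⟩ := h2
    exact hk ⟨Nat.succPNat n, by simp⟩

theorem HasRegularLimits.tendsto_subtreeSize {j : ParentSeq} (hj : HasRegularLimits j) (a : ℕ) :
    Tendsto (fun n : ℕ => (subtreeSize (harrisTree j n) (nodeWord j a) : ℝ) / n) atTop
      (𝓝 (mass j a)) := by
  simpa only [subtreeSize_harrisTree] using hj.tendsto a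

section Chain

variable {Ω : Type*} [mΩ : MeasurableSpace Ω] {P : Measure Ω} [IsProbabilityMeasure P]
  {J : (k : ℕ) → Ω → Fin (k + 1)}

theorem isLocal_harrisTree (n : ℕ) : IsLocal n (fun j => harrisTree j n) := by
  intro j j' h
  refine Finset.image_congr fun a ha => ?_
  exact nodeWord_congr fun i hi => h i (hi.trans (by simpa using ha))

theorem exists_isDoobMartinLimit (hJ : IsRandomRecursiveTreeChain P J) :
    ∃ Xinf : Ω → Measure NodeBar, IsDoobMartinLimit P (harrisChain J) Xinf := by
  classical
  set M : List ℕ+ → Ω → ℝ := fun u ω =>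
    limsup (fun n : ℕ => (subtreeSize (harrisChain J n ω) u : ℝ) / n) atTop with hM
  have hMmeas : ∀ u, Measurable (M u) := fun u => by
    refine Measurable.limsup fun n => ?_
    have h : IsLocal n (fun j => (subtreeSize (harrisTree j n) u : ℝ) / n) := fun j j' hj => by
      have := isLocal_harrisTree n j j' hj
      simp only at this
      simp only [this]
    exact h.measurable hJ
  have hgood : ∀ᵐ ω ∂P, (∀ u, Tendsto
      (fun n : ℕ => (subtreeSize (harrisChain J n ω) u : ℝ) / n) atTop (𝓝 (M u ω))) ∧
      ∃ μ : Measure NodeBar, IsProbabilityMeasure μ ∧ ∀ u, μ.real (cylinderSet u) = M u ω := by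
    filter_upwards [ae_hasRegularLimits hJ, ae_all_iff.2 (ae_hasSum_children_mass hJ)] with ω hj h1
    set j := parentSeq J ω
    have hword : ∀ a, Tendsto
        (fun n : ℕ => (subtreeSize (harrisChain J n ω) (nodeWord j a) : ℝ) / n) atTop
        (𝓝 (mass j a)) := hj.tendsto_subtreeSize
    have hmass : ∀ a, M (nodeWord j a) ω = mass j a := fun a => (hword a).limsup_eq
    have hsurj := nodeWord_surjective hj.infinite
    refine ⟨fun u => ?_, exists_measure_cylinderSet (fun u => M u ω) ?_ ?_ ?_⟩
    · obtain ⟨a, rfl⟩ := hsurj u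
      rw [hmass]
      exact hword a
    · show M [] ω = 1
      rw [← nodeWord_zero j, hmass, hj.mass_zero]
    · intro u
      obtain ⟨a, rfl⟩ := hsurj u
      show 0 < M _ ω
      rw [hmass]
      exact hj.pos a
    · intro u
      obtain ⟨a, rfl⟩ := hsurj u
      show HasSum (fun i => M (nodeWord j a ++ [i]) ω) (M (nodeWord j a) ω)
      simp only [← hj.nodeWord_childNode, hmass]
      exact hj.hasSum_childNode (h1 a)
  -- The exceptional set is enlarged to a measurable null set, on which a Dirac measure is used, so
  -- that the limit is a probability measure for every ω and its masses are measurable.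
  obtain ⟨S, hS, hSmeas, hSnull⟩ := exists_measurable_superset_of_null (ae_iff.1 hgood)
  have hgood' : ∀ ω, ω ∉ S → (∀ u, Tendsto
      (fun n : ℕ => (subtreeSize (harrisChain J n ω) u : ℝ) / n) atTop (𝓝 (M u ω))) ∧
      ∃ μ : Measure NodeBar, IsProbabilityMeasure μ ∧ ∀ u, μ.real (cylinderSet u) = M u ω :=
    fun ω hω => by_contra fun h => hω (hS h)
  have hex : ∀ ω, ∃ μ : Measure NodeBar, IsProbabilityMeasure μ ∧ ∀ u, μ.real (cylinderSet u) =
      if ω ∈ S then (Measure.dirac (NodeBar.finite [])).real (cylinderSet u) else M u ω := by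
    intro ω
    by_cases hω : ω ∈ S
    · exact ⟨Measure.dirac (NodeBar.finite []), inferInstance, fun u => by rw [if_pos hω]⟩
    · obtain ⟨μ, h1, h2⟩ := (hgood' ω hω).2
      exact ⟨μ, h1, fun u => by rw [if_neg hω, h2]⟩
  choose Xinf hX1 hX2 using hex
  refine ⟨Xinf, hX1, fun u => ?_, ?_⟩
  · simp only [hX2]
    exact Measurable.ite hSmeas measurable_const (hMmeas u)
  · have h3 : ∀ᵐ ω ∂P, ω ∉ S := measure_eq_zero_iff_ae_notMem.1 hSnull
    filter_upwards [h3] with ω hω u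
    rw [hX2, if_neg hω]
    exact (hgood' ω hω).1 u

end Chain

/-! ### The functionals of the limit -/

/-- The measure `μ` gives the cylinder sets the masses of the nodes of `j`, and the sums over the
children of a node converge. -/
structure IsLimitOf (j : ParentSeq) (μ : Measure NodeBar) : Prop where
  regular : HasRegularLimits j
  mass_eq : ∀ a, μ.real (cylinderSet (nodeWord j a)) = mass j a
  hasSum_mass : ∀ a, HasSum (fun k => childInd a k j * mass j (k + 1)) (mass j a)
  summable_entropy : ∀ a, Summable fun k => childInd a k j * Real.negMulLog (mass j (k + 1))

namespace IsLimitOf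

variable {j : ParentSeq} {μ : Measure NodeBar}

theorem surjective (h : IsLimitOf j μ) : Function.Surjective (nodeWord j) :=
  nodeWord_surjective h.regular.infinite

theorem bijective (h : IsLimitOf j μ) : Function.Bijective (nodeWord j) :=
  ⟨nodeWord_injective j, h.surjective⟩

theorem massRatio_eq (h : IsLimitOf j μ) (a : ℕ) (i : ℕ+) :
    massRatio μ (nodeWord j a) i = mass j (childNode j a i) / mass j a := by
  rw [massRatio, ← h.regular.nodeWord_childNode, h.mass_eq, h.mass_eq]

theorem hasSum_massRatio (h : IsLimitOf j μ) (a : ℕ) : HasSum (massRatio μ (nodeWord j a)) 1 := by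
  have h1 := (h.regular.hasSum_childNode (h.hasSum_mass a)).div_const (mass j a)
  rw [div_self (h.regular.pos a).ne'] at h1
  exact h1.congr_fun fun i => h.massRatio_eq a i

theorem hasSum_massRatio_mul_log (h : IsLimitOf j μ) (a : ℕ) :
    HasSum (fun i => massRatio μ (nodeWord j a) i * Real.log (massRatio μ (nodeWord j a) i))
      ((-(∑' k, childInd a k j * Real.negMulLog (mass j (k + 1))) -
        mass j a * Real.log (mass j a)) / mass j a) := by
  have h1 := h.regular.hasSum_childNode (h.hasSum_mass a)
  have h2 := h.regular.hasSum_childNode (f := fun k => Real.negMulLog (mass j k))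
    (h.summable_entropy a).hasSum
  have h3 := (h2.neg.sub (h1.mul_right (Real.log (mass j a)))).div_const (mass j a)
  refine h3.congr_fun fun i => ?_
  rw [h.massRatio_eq, Real.log_div (h.regular.pos _).ne' (h.regular.pos _).ne', Real.negMulLog]
  ring

/-- Writing the logarithm of a ratio as a difference turns X_∞(A_u) C(ρ) into the limit of the toll
of the node; the normalization by the mass uses positivity. -/
theorem mass_mul_entropyToll (h : IsLimitOf j μ) (a : ℕ) :
    μ.real (cylinderSet (nodeWord j a)) * entropyToll (massRatio μ (nodeWord j a)) =
      tollLimit j a := by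
  rw [entropyToll, (h.hasSum_massRatio_mul_log a).tsum_eq, h.mass_eq, tollLimit, Real.negMulLog]
  have := (h.regular.pos a).ne'
  field_simp
  ring

theorem squareSum_eq (h : IsLimitOf j μ) : squareSum μ = ∑' a, mass j a ^ 2 := by
  rw [squareSum, ← (Equiv.ofBijective _ h.bijective).tsum_eq]
  exact tsum_congr fun a => by rw [Equiv.ofBijective_apply, h.mass_eq]

theorem summable_sq (h : IsLimitOf j μ) (hs : Summable fun a => mass j a ^ 2) :
    Summable fun u : List ℕ+ => μ.real (cylinderSet u) ^ 2 := by
  rw [← (Equiv.ofBijective _ h.bijective).summable_iff]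
  refine hs.congr fun a => ?_
  rw [Function.comp_apply, Equiv.ofBijective_apply, h.mass_eq]

end IsLimitOf

/-- The weight that suppresses the words with small sum of letters. -/
noncomputable def lateWeight (k : ℕ) (u : List ℕ+) : ℝ := if letterSum u ≤ k then 0 else 1

theorem abs_lateWeight_le (k : ℕ) (u : List ℕ+) : |lateWeight k u| ≤ 1 := by
  unfold lateWeight
  split_ifs <;> simp

/-- Suppressing the small words removes finitely many tolls from the full sum, and each of them has
a limit. -/
theorem tendsto_tollSum_lateWeight {j : ParentSeq} {μ : Measure NodeBar} (h : IsLimitOf j μ)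
    (htoll : ∀ a, Tendsto (fun m : ℕ => toll j m a / ((m + 1 : ℕ) : ℝ)) atTop (𝓝 (tollLimit j a)))
    (hpath : Tendsto (fun m => tollSum (fun _ => 1) m j) atTop (𝓝 (pathLimit j))) (k : ℕ) :
    Tendsto (fun m => tollSum (lateWeight k) m j) atTop
      (𝓝 (pathLimit j - pathLengthPartialSum μ k)) := by
  classical
  set S : Finset ℕ :=
    (finite_letterSum_le k).toFinset.preimage (nodeWord j) (nodeWord_injective j).injOn with hS
  have hmem : ∀ a, a ∈ S ↔ letterSum (nodeWord j a) ≤ k := by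
    intro a
    simp [hS]
  have hpart : pathLengthPartialSum μ k = ∑ a ∈ S, tollLimit j a := by
    rw [pathLengthPartialSum, hS, Finset.sum_congr rfl fun a _ => (h.mass_mul_entropyToll a).symm]
    symm
    refine Finset.sum_preimage (nodeWord j) _ (nodeWord_injective j).injOn
      (fun u => μ.real (cylinderSet u) * entropyToll (massRatio μ u)) fun u _ hu => ?_
    exact absurd (Set.mem_range.2 (h.surjective u)) hu
  rw [hpart]
  refine (hpath.sub (tendsto_finsetSum S fun a _ => htoll a)).congr' ?_
  obtain ⟨B, hB⟩ := S.bddAbove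
  filter_upwards [eventually_ge_atTop B] with m hm
  have hSm : S ⊆ Finset.range (m + 1) := fun a ha =>
    Finset.mem_range.2 (Nat.lt_succ_of_le ((hB ha).trans hm))
  have hsub : ∑ a ∈ S, toll j m a =
      ∑ a ∈ Finset.range (m + 1), (if a ∈ S then toll j m a else 0) := by
    rw [Finset.sum_ite_mem, Finset.inter_eq_right.2 hSm]
  unfold tollSum
  rw [← Finset.sum_div]
  push_cast
  rw [← sub_div, hsub, ← Finset.sum_sub_distrib]
  congr 1
  apply Finset.sum_congr rfl
  intro a _
  by_cases ha : a ∈ S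
  · rw [if_pos ha, lateWeight, if_pos ((hmem a).1 ha)]
    ring
  · rw [if_neg ha, lateWeight, if_neg (fun h => ha ((hmem a).2 h))]
    ring

/-! ### Identification of Y_∞ and convergence of the Wiener index -/

section Chain

variable {Ω : Type*} [mΩ : MeasurableSpace Ω] {P : Measure Ω} [IsProbabilityMeasure P]
  {J : (k : ℕ) → Ω → Fin (k + 1)}

theorem ae_isLimitOf (hJ : IsRandomRecursiveTreeChain P J) {Xinf : Ω → Measure NodeBar}
    (hX : IsDoobMartinLimit P (harrisChain J) Xinf) :
    ∀ᵐ ω ∂P, IsLimitOf (parentSeq J ω) (Xinf ω) := by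
  filter_upwards [hX.tendsto, ae_hasRegularLimits hJ, ae_all_iff.2 (ae_hasSum_children_mass hJ),
    ae_all_iff.2 (ae_tendsto_children_entropy hJ)] with ω h1 h2 h3 h4
  exact ⟨h2, fun a => tendsto_nhds_unique (h1 _) (h2.tendsto_subtreeSize a), h3, fun a => (h4 a).1⟩

theorem isPathLengthLimit_pathLimit (hJ : IsRandomRecursiveTreeChain P J)
    {Xinf : Ω → Measure NodeBar} (hX : IsDoobMartinLimit P (harrisChain J) Xinf) :
    IsPathLengthLimit P Xinf (fun ω => pathLimit (parentSeq J ω)) := by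
  have hmeas : ∀ σ m, AEStronglyMeasurable (fun ω => tollSum σ m (parentSeq J ω)) P :=
    fun σ m => ((isLocal_tollSum σ m).measurable hJ).aestronglyMeasurable
  have hlate : ∀ k, ∀ᵐ ω ∂P, Tendsto (fun m => tollSum (lateWeight k) m (parentSeq J ω)) atTop
      (𝓝 (pathLimit (parentSeq J ω) - pathLengthPartialSum (Xinf ω) k)) := by
    intro k
    filter_upwards [ae_isLimitOf hJ hX, ae_tendsto_toll hJ, ae_tendsto_pathLimit hJ]
      with ω h1 h2 h3
    exact tendsto_tollSum_lateWeight h1 h2 h3 k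
  intro p hp
  refine ⟨(memLp_and_tendsto_eLpNorm (hmeas _) (measurable_pathLimit hJ).aestronglyMeasurable
    (ae_tendsto_pathLimit hJ) (fun n hn => ?_) ENNReal.ofReal_ne_top).1, ?_⟩
  · obtain ⟨τ, -, hτ, h1⟩ := eLpNorm_tollSum_le hJ hn
    exact ⟨τ 0, hτ 0, fun m => h1 _ (fun _ => by simp) 0 (tollSum_zero _) m m.zero_le⟩
  · obtain ⟨q, hq⟩ : ∃ q : ℕ, ENNReal.ofReal p ≤ ((2 * q + 2 : ℕ) : ℝ≥0∞) := by
      obtain ⟨q, hq⟩ := ENNReal.exists_nat_gt (ENNReal.ofReal_ne_top (r := p))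
      exact ⟨q, hq.le.trans (by exact_mod_cast (by omega : q ≤ 2 * q + 2))⟩
    obtain ⟨τ, hτ, -, h1⟩ := eLpNorm_tollSum_le hJ (even_two_mul q)
    refine tendsto_of_tendsto_of_tendsto_of_le_of_le tendsto_const_nhds hτ (fun _ => zero_le)
      fun k => ?_
    have h2 : (fun ω => pathLengthPartialSum (Xinf ω) k - pathLimit (parentSeq J ω)) =
        -fun ω => pathLimit (parentSeq J ω) - pathLengthPartialSum (Xinf ω) k := by
      ext ω
      simp
    simp only [h2, eLpNorm_neg]
    refine (eLpNorm_le_eLpNorm_of_exponent_le hq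
      (aestronglyMeasurable_of_tendsto_ae atTop (hmeas _) (hlate k))).trans ?_
    -- Fatou in L^p: the bound `τ k` holds for all times `m ≥ k` and hence for the limit, which is
    -- Y_∞ minus its k-th partial sum.
    refine eLpNorm_le_of_tendsto_ae (hmeas _) (hlate k) ?_
    filter_upwards [eventually_ge_atTop k] with m hm
    exact h1 _ (abs_lateWeight_le k) k
      (tollSum_eq_zero (fun u hu => by rw [lateWeight, if_pos hu]) le_rfl) m hm

/-- Uniqueness of limits in L¹. The triangle inequality needs measurable partial sums; they are
obtained, up to null sets, from limits of functions of finitely many choices. -/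
theorem ae_eq_of_isPathLengthLimit (hJ : IsRandomRecursiveTreeChain P J)
    {Xinf : Ω → Measure NodeBar} (hX : IsDoobMartinLimit P (harrisChain J) Xinf) {Yinf : Ω → ℝ}
    (hY : IsPathLengthLimit P Xinf Yinf) : Yinf =ᵐ[P] fun ω => pathLimit (parentSeq J ω) := by
  have hZ := isPathLengthLimit_pathLimit hJ hX
  have hpart : ∀ k, AEStronglyMeasurable (fun ω => pathLengthPartialSum (Xinf ω) k) P := by
    intro k
    have h1 : AEStronglyMeasurable
        (fun ω => pathLimit (parentSeq J ω) - pathLengthPartialSum (Xinf ω) k) P := by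
      refine aestronglyMeasurable_of_tendsto_ae atTop
        (f := fun m ω => tollSum (lateWeight k) m (parentSeq J ω))
        (fun m => ((isLocal_tollSum _ m).measurable hJ).aestronglyMeasurable) ?_
      filter_upwards [ae_isLimitOf hJ hX, ae_tendsto_toll hJ, ae_tendsto_pathLimit hJ]
        with ω h1 h2 h3
      exact tendsto_tollSum_lateWeight h1 h2 h3 k
    have h2 := (measurable_pathLimit hJ).aestronglyMeasurable (μ := P).sub h1
    refine h2.congr (Eventually.of_forall fun ω => ?_)
    simp
  have h1 := hY 1 le_rfl
  have h2 := hZ 1 le_rfl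
  rw [ENNReal.ofReal_one] at h1 h2
  have h3 : ∀ k, eLpNorm (Yinf - fun ω => pathLimit (parentSeq J ω)) 1 P ≤
      eLpNorm (fun ω => pathLengthPartialSum (Xinf ω) k - pathLimit (parentSeq J ω)) 1 P +
      eLpNorm (fun ω => pathLengthPartialSum (Xinf ω) k - Yinf ω) 1 P := by
    intro k
    have h4 : (Yinf - fun ω => pathLimit (parentSeq J ω)) =
        (fun ω => pathLengthPartialSum (Xinf ω) k - pathLimit (parentSeq J ω)) -
        (fun ω => pathLengthPartialSum (Xinf ω) k - Yinf ω) := by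
      ext ω
      simp
    rw [h4]
    exact eLpNorm_sub_le ((hpart k).sub h2.1.1) ((hpart k).sub h1.1.1) le_rfl
  have h5 : eLpNorm (Yinf - fun ω => pathLimit (parentSeq J ω)) 1 P ≤ 0 + 0 :=
    ge_of_tendsto' (h2.2.add h1.2) h3
  rw [add_zero, nonpos_iff_eq_zero, eLpNorm_eq_zero_iff (h1.1.1.sub h2.1.1) one_ne_zero] at h5
  filter_upwards [h5] with ω hω
  exact sub_eq_zero.1 hω

theorem ae_tendsto_wiener (hJ : IsRandomRecursiveTreeChain P J) :
    ∀ᵐ ω ∂P, Tendsto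
      (fun m => tollSum (fun _ => 1) m (parentSeq J ω) - squares m (parentSeq J ω)) atTop
      (𝓝 (pathLimit (parentSeq J ω) - ∑' a, mass (parentSeq J ω) a ^ 2)) := by
  filter_upwards [ae_tendsto_pathLimit hJ, ae_tendsto_squares hJ] with ω h1 h2
  exact h1.sub h2.2

theorem memLp_and_tendsto_wiener (hJ : IsRandomRecursiveTreeChain P J) {p : ℝ≥0∞} (hp : p ≠ ∞) :
    MemLp (fun ω => pathLimit (parentSeq J ω) - ∑' a, mass (parentSeq J ω) a ^ 2) p P ∧
      Tendsto (fun m => eLpNorm (fun ω => (tollSum (fun _ => 1) m (parentSeq J ω) -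
        squares m (parentSeq J ω)) -
        (pathLimit (parentSeq J ω) - ∑' a, mass (parentSeq J ω) a ^ 2)) p P) atTop (𝓝 0) := by
  have hm1 : ∀ m, AEStronglyMeasurable (fun ω => tollSum (fun _ => 1) m (parentSeq J ω)) P :=
    fun m => ((isLocal_tollSum _ m).measurable hJ).aestronglyMeasurable
  have hm2 : ∀ m, AEStronglyMeasurable (fun ω => squares m (parentSeq J ω)) P :=
    fun m => ((isLocal_squares m).measurable hJ).aestronglyMeasurable
  refine memLp_and_tendsto_eLpNorm (fun m => (hm1 m).sub (hm2 m))
    (aestronglyMeasurable_of_tendsto_ae atTop (fun m => (hm1 m).sub (hm2 m))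
      (ae_tendsto_wiener hJ)) (ae_tendsto_wiener hJ) (fun n hn => ?_) hp
  obtain ⟨τ, -, hτ, h1⟩ := eLpNorm_tollSum_le hJ hn
  obtain ⟨C, hC, h2⟩ := eLpNorm_squares_le hJ hn
  refine ⟨τ 0 + C, ENNReal.add_ne_top.2 ⟨hτ 0, hC⟩, fun m => ?_⟩
  refine (eLpNorm_sub_le (hm1 m) (hm2 m) (by exact_mod_cast (by omega : 1 ≤ n + 2))).trans ?_
  exact add_le_add (h1 _ (fun _ => by simp) 0 (tollSum_zero _) m m.zero_le) (h2 m)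

end Chain

end Limits

theorem theorem8 {Ω : Type*} [MeasurableSpace Ω] (P : Measure Ω) [IsProbabilityMeasure P]
    (J : (k : ℕ) → Ω → Fin (k + 1)) (hJ : IsRandomRecursiveTreeChain P J) :
    -- the limit of the Harris chain exists
    (∃ Xinf : Ω → Measure NodeBar, IsDoobMartinLimit P (harrisChain J) Xinf) ∧
    -- and whichever version of the limit is chosen, the functionals of it exist and
    -- the standardized Wiener index converges almost surely and in every `L^p`
    (∀ Xinf : Ω → Measure NodeBar, IsDoobMartinLimit P (harrisChain J) Xinf →
      (∀ᵐ ω ∂P, ∀ u : List ℕ+,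
        0 < (Xinf ω).real (cylinderSet u) ∧ HasSum (massRatio (Xinf ω) u) 1 ∧
        Summable (fun i => massRatio (Xinf ω) u i * Real.log (massRatio (Xinf ω) u i))) ∧
      (∀ᵐ ω ∂P, Summable (fun u : List ℕ+ => (Xinf ω).real (cylinderSet u) ^ 2)) ∧
      (∃ Yinf : Ω → ℝ, IsPathLengthLimit P Xinf Yinf) ∧
      (∀ Yinf : Ω → ℝ, IsPathLengthLimit P Xinf Yinf →
        (∀ᵐ ω ∂P, Tendsto
          (fun n : ℕ => 1 / (n : ℝ) ^ 2 * treeWienerIndex (harrisChain J n ω) - (harmonic n : ℝ))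
          atTop (𝓝 (Yinf ω - squareSum (Xinf ω)))) ∧
        (∀ p : ℝ, 0 < p →
          MemLp (fun ω => Yinf ω - squareSum (Xinf ω)) (ENNReal.ofReal p) P ∧
          Tendsto
            (fun n : ℕ => eLpNorm
              (fun ω => 1 / (n : ℝ) ^ 2 * treeWienerIndex (harrisChain J n ω) - (harmonic n : ℝ)
                - (Yinf ω - squareSum (Xinf ω)))
              (ENNReal.ofReal p) P)
            atTop (𝓝 0)))) ∧
    -- the mean
    (∀ n : ℕ, 1 ≤ n →
      Integrable (fun ω => treeWienerIndex (harrisChain J n ω)) P ∧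
      ∫ ω, treeWienerIndex (harrisChain J n ω) ∂P
        = (n : ℝ) * ((n : ℝ) + 1) * (harmonic n : ℝ) - 2 * (n : ℝ) ^ 2) := by
  refine ⟨exists_isDoobMartinLimit hJ, fun Xinf hX => ?_, fun n hn => ?_⟩
  · have hlim := ae_isLimitOf hJ hX
    refine ⟨?_, ?_, ⟨_, isPathLengthLimit_pathLimit hJ hX⟩, fun Yinf hY => ?_⟩
    · filter_upwards [hlim] with ω h u
      obtain ⟨a, rfl⟩ := h.surjective u
      refine ⟨?_, h.hasSum_massRatio a, (h.hasSum_massRatio_mul_log a).summable⟩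
      rw [h.mass_eq]
      exact h.regular.pos a
    · filter_upwards [hlim, ae_tendsto_squares hJ] with ω h hs
      exact h.summable_sq hs.1
    · have hW : (fun ω => Yinf ω - squareSum (Xinf ω)) =ᵐ[P]
          fun ω => pathLimit (parentSeq J ω) - ∑' a, mass (parentSeq J ω) a ^ 2 := by
        filter_upwards [hlim, ae_eq_of_isPathLengthLimit hJ hX hY] with ω h hYω
        rw [h.squareSum_eq, hYω]
      -- The number of nodes is shifted to `m + 1`, which also avoids the empty tree; neither kind
      -- of limit is affected.
      have hstd : ∀ (m : ℕ) ω, 1 / ((m + 1 : ℕ) : ℝ) ^ 2 *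
          treeWienerIndex (harrisChain J (m + 1) ω) - (harmonic (m + 1) : ℝ) =
          tollSum (fun _ => 1) m (parentSeq J ω) - squares m (parentSeq J ω) :=
        fun m ω => treeWienerIndex_standardized (parentSeq J ω) m
      refine ⟨?_, fun p _ => ?_⟩
      · filter_upwards [hW, ae_tendsto_wiener hJ] with ω h1 h2
        rw [h1, ← tendsto_add_atTop_iff_nat 1]
        simpa only [hstd] using h2
      · obtain ⟨h1, h2⟩ := memLp_and_tendsto_wiener hJ (ENNReal.ofReal_ne_top (r := p))
        refine ⟨(memLp_congr_ae hW).2 h1, ?_⟩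
        rw [← tendsto_add_atTop_iff_nat 1]
        refine h2.congr fun m => eLpNorm_congr_ae ?_
        filter_upwards [hW] with ω hω
        rw [hstd, hω]
  · obtain ⟨m, rfl⟩ := Nat.exists_eq_add_of_le' hn
    exact integral_treeWienerIndex hJ m
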